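/- **Setting.** Consider $\min_{x\in\mathbb R^p}\max_{y\in\mathbb R^n}\{\mathcal R(x)+\mathbb E_\xi\langle Ky,\mathbf F(x,\xi)\rangle-\psi(y)\}$, where $K\in\mathbb R^{q\times n}$, $K\ne0$, and $\mathcal R,\psi$ are proper, closed, convex with values in $\mathbb R\cup\{+\infty\}$. Put $F(x):=\mathbb E_\xi[\mathbf F(x,\xi)]$, $\phi_0(u):=\max_y\{\langle u,Ky\rangle-\psi(y)\}$ with maximizer $y_0^*(u)$, $\Phi_0:=\phi_0\circ F$, $\Psi_0:=\Phi_0+\mathcal R$, and assume $\Psi_0^\star:=\inf_x\Psi_0(x)>-\infty$. $\mathbf F(\cdot,\xi)$ and $F$ are differentiable at the points of $\mathrm{dom}\,\Psi_0$, with Jacobians $\mathbf F'(\cdot,\xi)$ and $F'$. $\|\cdot\|$ is the Euclidean norm of vectors, the Euclidean (Frobenius) norm of Jacobians, and the operator norm of $K$. For positive constants $L_F,M_F,\sigma_F,\sigma_J,M_\psi$ and all $x,y\in\mathrm{dom}\,\Psi_0$ assume $$\mathbb E\|\mathbf F'(x,\xi)-\mathbf F'(y,\xi)\|^2\le L_F^2\|x-y\|^2,\quad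 \mathbb E\|\mathbf F(x,\xi)-F(x)\|^2\le\sigma_F^2,\quad \mathbb E\|\mathbf F'(x,\xi)-F'(x)\|^2\le\sigma_J^2,\quad \mathbb E\|\mathbf F'(x,\xi)\|^2\le M_F^2,$$ that $\|y\|\le M_\psi$ on $\mathrm{dom}\,\psi$, and that $\psi$ is $1$-strongly convex. The gradient mapping is $\mathcal G_\eta(x):=\eta^{-1}\big(x-\mathrm{prox}_{\eta\mathcal R}(x-\eta\nabla\Phi_0(x))\big)$. **Algorithm.** Let $b,\hat b_0,S\ge1$ and $T\ge0$ be integers and $c_0>0$ be such that $c_0b,c_0\hat b_0$ are integers; put $b_0:=c_0\hat b_0$, $b_1=b_2:=c_0b$, $\hat b_1=\hat b_2:=b$. Start from $\tilde x^0\in\mathrm{dom}\,\Psi_0$. Stage $s=1,\dots,S$ starts from $x_0:=\tilde x^{s-1}$ with $$\tilde F_0:=\tfrac1{b_0}\sum_{\xi\in\mathcal B^0}\mathbf F(x_0,\xi),\qquad \tilde J_0:=\tfrac1{\hat b_0}\sum_{\xi\in\hat{\mathcal B}^0}\mathbf F'(x_0,\xi).$$ For $t=0,\dots,T$ it computes $v_t:=\tilde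 J_t^\top Ky_0^*(\tilde F_t)$, $\hat x_{t+1}:=\mathrm{prox}_{\eta\mathcal R}(x_t-\eta v_t)$, $x_{t+1}:=(1-\theta)x_t+\theta\hat x_{t+1}$, where for $1\le t\le T$ $$\tilde F_t:=\beta\tilde F_{t-1}+\tfrac{\beta}{b_1}\sum_{\xi\in\mathcal B^1_t}[\mathbf F(x_t,\xi)-\mathbf F(x_{t-1},\xi)]+\tfrac{1-\beta}{b_2}\sum_{\zeta\in\mathcal B^2_t}\mathbf F(x_t,\zeta),$$ $$\tilde J_t:=\beta\tilde J_{t-1}+\tfrac{\beta}{\hat b_1}\sum_{\xi\in\hat{\mathcal B}^1_t}[\mathbf F'(x_t,\xi)-\mathbf F'(x_{t-1},\xi)]+\tfrac{1-\beta}{\hat b_2}\sum_{\zeta\in\hat{\mathcal B}^2_t}\mathbf F'(x_t,\zeta).$$ Then $\tilde x^s:=x_{T+1}$. The mini-batches $\mathcal B^0,\hat{\mathcal B}^0,\mathcal B^1_t,\hat{\mathcal B}^1_t,\mathcal B^2_t,\hat{\mathcal B}^2_t$ have sizes $b_0,\hat b_0,b_1,\hat b_1,b_2,\hat b_2$; each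 is i.i.d. with the law of $\xi$, and those drawn at different iterations are independent (those of the same iteration may be dependent). Put $\kappa:=1$ if $\mathcal B^1_t$ is always independent of $\mathcal B^2_t$, $\kappa:=2$ otherwise; $\hat\kappa$ likewise for $\hat{\mathcal B}^1_t,\hat{\mathcal B}^2_t$. Iteration $t\ge1$ costs $2b_1+b_2$ evaluations of $\mathbf F$ and $2\hat b_1+\hat b_2$ of $\mathbf F'$; the start of a stage costs $b_0$ and $\hat b_0$. The output $\bar x_N$ is uniformly chosen, independently of all samples, among the $S(T+1)$ points $x_t^{(s)}$ ($1\le s\le S$, $0\le t\le T$). Let $\mathcal T_F,\mathcal T_J$ be the total numbers of evaluations of $\mathbf F,\mathbf F'$ in all stages run. **Parameters.** Let $$P:=\tfrac{\sqrt{26}\|K\|}{3\sqrt{c_0}}\sqrt{\kappa M_F^4\|K\|^2+c_0\hat\kappa L_F^2M_\psi^2},\quad Q:=\tfrac{26}{9c_0}\|K\|^2\big(\kappa M_F^2\|K\|^2\sigma_F^2+c_0\hat\kappa M_\psi^2\sigma_J^2\big),\quad L:=L_FM_\psi\|K\|+M_F^2\|K\|^2,$$ $$\beta:=1-\tfrac{b^{1/2}}{[\hat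 b_0(T+1)]^{1/2}},\qquad \theta:=\tfrac{Lb^{3/4}}{P[\hat b_0(T+1)]^{1/4}},\qquad \eta:=\tfrac{2}{L(3+\theta)},$$ and suppose $b\le\hat b_0(T+1)$ and $\hat b_0(T+1)/b^3>L^4/P^4$. **Theorem.** (1) One has $$\mathbb E\|\mathcal G_\eta(\bar x_N)\|^2\le\frac{16P\hat b_0^{1/4}}{S[b(T+1)]^{3/4}}\big[\Psi_0(\tilde x^0)-\Psi_0^\star\big]+\frac{24Q}{[\hat b_0b(T+1)]^{1/2}}.$$ (2) Let $\varepsilon>0$, let $D>0$ be any number with $\Psi_0(\tilde x^0)-\Psi_0^\star\le D$, suppose $1\le b\le48Q/\varepsilon^2$, and take $T=\lfloor48Q/(b\varepsilon^2)\rfloor$, $\hat b_0=\lfloor48Q/\varepsilon^2\rfloor$. Put $s:=\frac{8PD}{\varepsilon\sqrt{3Q}}$ and suppose that the mini-batches are drawn for $\lceil s\rceil$ stages. (a) After $S=\lceil s\rceil$ stages, $\mathbb E\|\mathcal G_\eta(\bar x_N)\|^2\le\varepsilon^2$, with $\mathcal T_J\le\frac{512P\sqrt{3Q}D}{\varepsilon^3}+\frac{192Q}{\varepsilon^2}$,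 and $\mathcal T_F\le c_0\big(\frac{512P\sqrt{3Q}D}{\varepsilon^3}+\frac{192Q}{\varepsilon^2}\big)$. (b) Already for some $S'$ with $1\le S'\le\lceil s\rceil$, after $S'$ stages $\mathbb E\|\mathcal G_\eta(\bar x_N)\|^2\le\varepsilon^2$, with $\mathcal T_J\le\frac{400P\sqrt{3Q}D}{\varepsilon^3}+\frac{192Q}{\varepsilon^2}$ and $\mathcal T_F\le c_0\big(\frac{400P\sqrt{3Q}D}{\varepsilon^3}+\frac{192Q}{\varepsilon^2}\big)$. (c) If $s\ge32$ (that is, $\varepsilon\le\frac{PD}{4\sqrt{3Q}}$), then $\mathbb E\|\mathcal G_\eta(\bar x_N)\|^2\le\varepsilon^2$ also after $\lfloor s\rfloor$ stages, and for some $S'$ with $1\le S'\le\lfloor s\rfloor$ it holds after $S'$ stages with $\mathcal T_J\le\frac{400P\sqrt{3Q}D}{\varepsilon^3}$ and $\mathcal T_F\le\frac{400c_0P\sqrt{3Q}D}{\varepsilon^3}$. -/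

import Mathlib

open MeasureTheory ProbabilityTheory
open scoped ENNReal

/-- Euclidean space `ℝ^n`. -/
abbrev Vec (n : ℕ) := EuclideanSpace ℝ (Fin n)

/-! ### Extended-valued convex functions -/

/-- Convexity of an extended-valued function: its epigraph is convex. -/
def EConvex {n : ℕ} (f : Vec n → EReal) : Prop :=
  Convex ℝ {z : Vec n × ℝ | f z.1 ≤ (z.2 : EReal)}

/-- Proper, closed (lower semicontinuous) and convex `f : ℝ^n → ℝ ∪ {+∞}`. -/
structure ProperClosedConvex {n : ℕ} (f : Vec n → EReal) : Prop where
  ne_bot : ∀ x, f x ≠ ⊥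
  proper : ∃ x, f x ≠ ⊤
  closed : LowerSemicontinuous f
  convex : EConvex f

/-- `f` is `m`-strongly convex: `f - (m/2)‖·‖²` is convex. -/
def EStronglyConvex {n : ℕ} (m : ℝ) (f : Vec n → EReal) : Prop :=
  EConvex (fun y => f y - ((m / 2 * ‖y‖ ^ 2 : ℝ) : EReal))

/-- The proximal point `prox_{ηf}(z)`: the minimizer of `f(w) + ‖w - z‖²/(2η)`
(which exists and is unique if `f` is proper, closed, convex and `η > 0`). -/
noncomputable def prox {n : ℕ} (f : Vec n → EReal) (η : ℝ) (z : Vec n) : Vec n :=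
  Classical.epsilon fun u : Vec n =>
    IsMinOn (fun w => f w + ((‖w - z‖ ^ 2 / (2 * η) : ℝ) : EReal)) Set.univ u

/-- The squared Euclidean (Frobenius) norm of a matrix, given as a linear map. -/
noncomputable def frobSq {p q : ℕ} (A : Vec p →L[ℝ] Vec q) : ℝ :=
  ∑ j : Fin p, ‖A (EuclideanSpace.single j (1 : ℝ))‖ ^ 2

/-! ### The minimax problem -/

/-- The data of `min_x max_y R(x) + E_ξ⟨K y, 𝐅(x,ξ)⟩ - ψ(y)`. -/
structure MinimaxProblem (p q n : ℕ) (Ω : Type*) [MeasurableSpace Ω] where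
  /-- the law of `ξ` -/
  law : Measure Ω
  /-- the stochastic vector function `𝐅(x,ξ)` -/
  stochF : Vec p → Ω → Vec q
  K : Vec n →L[ℝ] Vec q
  psi : Vec n → EReal
  R : Vec p → EReal

namespace MinimaxProblem

variable {p q n : ℕ} {Ω : Type*} [MeasurableSpace Ω] (M : MinimaxProblem p q n Ω)

/-- The Jacobian `𝐅'(x,ξ)` with respect to `x`. -/
noncomputable def stochJ (x : Vec p) (ξ : Ω) : Vec p →L[ℝ] Vec q :=
  fderiv ℝ (fun z => M.stochF z ξ) x

/-- `F(x) = E_ξ[𝐅(x,ξ)]`. -/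
noncomputable def F (x : Vec p) : Vec q := ∫ ξ, M.stochF x ξ ∂M.law

/-- The Jacobian `F'(x)`. -/
noncomputable def J (x : Vec p) : Vec p →L[ℝ] Vec q := fderiv ℝ M.F x

/-- `φ₀(u) = max_y ⟨u, K y⟩ - ψ(y)`. -/
noncomputable def phi0 (u : Vec q) : EReal :=
  ⨆ y : Vec n, ((inner ℝ u (M.K y) : ℝ) : EReal) - M.psi y

/-- `y*₀(u)`: the maximizer of `⟨u, K y⟩ - ψ(y)` (unique if `ψ` is strongly convex). -/
noncomputable def yStar (u : Vec q) : Vec n :=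
  Classical.epsilon fun y : Vec n =>
    IsMaxOn (fun w => ((inner ℝ u (M.K w) : ℝ) : EReal) - M.psi w) Set.univ y

/-- `Φ₀(x) = φ₀(F(x))`; it is finite when `ψ` is proper, closed, with bounded domain. -/
noncomputable def Phi0 (x : Vec p) : ℝ := (M.phi0 (M.F x)).toReal

/-- `Ψ₀(x) = φ₀(F(x)) + R(x)`. -/
noncomputable def Psi0 (x : Vec p) : EReal := M.phi0 (M.F x) + M.R x

/-- `Ψ₀* = inf_x Ψ₀(x)`. -/
noncomputable def Psi0Star : EReal := ⨅ x, M.Psi0 x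

/-- The domain of `Ψ₀`. -/
def domPsi0 : Set (Vec p) := {x | M.Psi0 x < ⊤}

/-- The gradient mapping `G_η(x) = η⁻¹ (x - prox_{ηR}(x - η ∇Φ₀(x)))`. -/
noncomputable def gradMap (η : ℝ) (x : Vec p) : Vec p :=
  η⁻¹ • (x - prox M.R η (x - η • gradient M.Phi0 x))

end MinimaxProblem

/-- The constants occurring in the assumptions. -/
structure Constants where
  LF : ℝ
  MF : ℝ
  sigmaF : ℝ
  sigmaJ : ℝ
  Mpsi : ℝ

section Assumptions

variable {p q n : ℕ} {Ω : Type*} [MeasurableSpace Ω]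

/-- The standing assumptions: `R` is proper, closed, convex and `Ψ₀* > -∞`; `F` is well defined. -/
structure StandingAssumption (M : MinimaxProblem p q n Ω) : Prop where
  prob : IsProbabilityMeasure M.law
  R_pcc : ProperClosedConvex M.R
  bounded_below : ⊥ < M.Psi0Star
  integrable : ∀ x, Integrable (M.stochF x) M.law
  measurable_F : Measurable fun z : M.domPsi0 × Ω => M.stochF z.1 z.2
  measurable_J : Measurable fun z : M.domPsi0 × Ω => M.stochJ z.1 z.2
  differentiable_stochF : ∀ ξ, ∀ x ∈ M.domPsi0, DifferentiableAt ℝ (fun z => M.stochF z ξ) x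
  differentiable_F : ∀ x ∈ M.domPsi0, DifferentiableAt ℝ M.F x

/-- Average smoothness, bounded variance, and average Lipschitz continuity of `𝐅`. -/
structure AssumptionF (M : MinimaxProblem p q n Ω) (c : Constants) : Prop where
  LF_pos : 0 < c.LF
  MF_pos : 0 < c.MF
  sigmaF_pos : 0 < c.sigmaF
  sigmaJ_pos : 0 < c.sigmaJ
  smooth : ∀ x ∈ M.domPsi0, ∀ y ∈ M.domPsi0,
    ∫⁻ ξ, ENNReal.ofReal (frobSq (M.stochJ x ξ - M.stochJ y ξ)) ∂M.law
      ≤ ENNReal.ofReal (c.LF ^ 2 * ‖x - y‖ ^ 2)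
  variance_F : ∀ x ∈ M.domPsi0,
    ∫⁻ ξ, ENNReal.ofReal (‖M.stochF x ξ - M.F x‖ ^ 2) ∂M.law ≤ ENNReal.ofReal (c.sigmaF ^ 2)
  variance_J : ∀ x ∈ M.domPsi0,
    ∫⁻ ξ, ENNReal.ofReal (frobSq (M.stochJ x ξ - M.J x)) ∂M.law ≤ ENNReal.ofReal (c.sigmaJ ^ 2)
  lipschitz : ∀ x ∈ M.domPsi0,
    ∫⁻ ξ, ENNReal.ofReal (frobSq (M.stochJ x ξ)) ∂M.law ≤ ENNReal.ofReal (c.MF ^ 2)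

/-- `ψ` is proper, closed, convex, and its domain is bounded by `M_ψ`. -/
structure AssumptionPsi (M : MinimaxProblem p q n Ω) (c : Constants) : Prop where
  Mpsi_pos : 0 < c.Mpsi
  psi_pcc : ProperClosedConvex M.psi
  bounded : ∀ y, M.psi y ≠ ⊤ → ‖y‖ ≤ c.Mpsi

end Assumptions

/-! ### Mini-batches -/

/-- Mini-batch sizes: `b*` for `F`, `bh*` for the Jacobian; `0` initial, `1` and `2` inner. -/
structure BatchSizes where
  b0 : ℕ
  bh0 : ℕ
  b1 : ℕ
  bh1 : ℕ
  b2 : ℕ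
  bh2 : ℕ

/-- Random mini-batches. Stages are numbered from `0` here; the first index of every field is the
stage, the second one (for the inner batches) the iteration. -/
structure MiniBatches (W Ω : Type*) (sz : BatchSizes) where
  B0 : ℕ → Fin sz.b0 → W → Ω
  Bh0 : ℕ → Fin sz.bh0 → W → Ω
  B1 : ℕ → ℕ → Fin sz.b1 → W → Ω
  Bh1 : ℕ → ℕ → Fin sz.bh1 → W → Ω
  B2 : ℕ → ℕ → Fin sz.b2 → W → Ω
  Bh2 : ℕ → ℕ → Fin sz.bh2 → W → Ω

section Sampling

variable {W Ω : Type*} [MeasurableSpace W] [MeasurableSpace Ω] {sz : BatchSizes}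

/-- `X` is an i.i.d. sample from `law`. -/
structure IsIIDSample {k : ℕ} (X : Fin k → W → Ω) (μ : Measure W) (law : Measure Ω) : Prop where
  measurable : ∀ i, Measurable (X i)
  map_eq : ∀ i, μ.map (X i) = law
  indep : iIndepFun X μ

/-- The σ-algebra generated by the sample `X`. -/
@[reducible] def sampleSigma {k : ℕ} (X : Fin k → W → Ω) : MeasurableSpace W :=
  ⨆ i, MeasurableSpace.comap (X i) inferInstance

/-- The σ-algebra generated by all mini-batches drawn at iteration `t` of stage `s`. -/
@[reducible] def MiniBatches.iterSigma (B : MiniBatches W Ω sz) (s : ℕ) : ℕ → MeasurableSpace W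
  | 0 => sampleSigma (B.B0 s) ⊔ sampleSigma (B.Bh0 s)
  | t + 1 => (sampleSigma (B.B1 s (t + 1)) ⊔ sampleSigma (B.B2 s (t + 1))) ⊔
      (sampleSigma (B.Bh1 s (t + 1)) ⊔ sampleSigma (B.Bh2 s (t + 1)))

/-- Every mini-batch used in `S` stages of `T` iterations is an i.i.d. sample, and what is drawn at
different iterations is independent. Nothing is required on the joint law of the different
mini-batches drawn at the same iteration. -/
structure MiniBatches.IsSampling (B : MiniBatches W Ω sz) (μ : Measure W) (law : Measure Ω)
    (S T : ℕ) : Prop where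
  iid_B0 : ∀ s < S, IsIIDSample (B.B0 s) μ law
  iid_Bh0 : ∀ s < S, IsIIDSample (B.Bh0 s) μ law
  iid_B1 : ∀ s < S, ∀ t ∈ Finset.Icc 1 T, IsIIDSample (B.B1 s t) μ law
  iid_Bh1 : ∀ s < S, ∀ t ∈ Finset.Icc 1 T, IsIIDSample (B.Bh1 s t) μ law
  iid_B2 : ∀ s < S, ∀ t ∈ Finset.Icc 1 T, IsIIDSample (B.B2 s t) μ law
  iid_Bh2 : ∀ s < S, ∀ t ∈ Finset.Icc 1 T, IsIIDSample (B.Bh2 s t) μ law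
  indep : iIndep (fun i : Fin S × Fin (T + 1) => B.iterSigma i.1 i.2) μ

/-- `κ = 1` if always `B¹_t` is independent of `B²_t`, and `κ = 2` otherwise. -/
noncomputable def MiniBatches.kappa (B : MiniBatches W Ω sz) (μ : Measure W) (S T : ℕ) : ℝ :=
  open Classical in
  if ∀ s < S, ∀ t ∈ Finset.Icc 1 T,
      IndepFun (fun ω i => B.B1 s t i ω) (fun ω i => B.B2 s t i ω) μ then 1 else 2

/-- The same for the mini-batches of the Jacobian. -/
noncomputable def MiniBatches.kappaHat (B : MiniBatches W Ω sz) (μ : Measure W) (S T : ℕ) : ℝ :=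
  open Classical in
  if ∀ s < S, ∀ t ∈ Finset.Icc 1 T,
      IndepFun (fun ω i => B.Bh1 s t i ω) (fun ω i => B.Bh2 s t i ω) μ then 1 else 2

end Sampling

/-! ### The algorithms -/

/-- Constant parameters `β = β̂`, `θ`, `η`. -/
structure StepParams where
  beta : ℝ
  theta : ℝ
  eta : ℝ

/-- Starting data of a stage: the point, and the numbers of evaluations of `𝐅(·,ξ)` and of
`𝐅'(·,ξ)` made so far. -/
structure StageStart (p : ℕ) where
  x : Vec p
  evalF : ℕ
  evalJ : ℕ

/-- State of the inner loop: `x_t`, the estimators of `F(x_t)` and `F'(x_t)`, and the numbers of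
evaluations made so far. -/
structure InnerState (p q : ℕ) where
  x : Vec p
  Ft : Vec q
  Jt : Vec p →L[ℝ] Vec q
  evalF : ℕ
  evalJ : ℕ

section Algorithm

variable {p q n : ℕ} {W Ω : Type*} [MeasurableSpace Ω] {sz : BatchSizes}

/-- `v_t = J̃_tᵀ K y*₀(F̃_t)`, `x̂_{t+1} = prox_{ηR}(x_t - η v_t)` and
`x_{t+1} = (1-θ) x_t + θ x̂_{t+1}`. -/
noncomputable def nextPoint (M : MinimaxProblem p q n Ω) (par : StepParams)
    (st : InnerState p q) : Vec p :=
  let v := ContinuousLinearMap.adjoint st.Jt (M.K (M.yStar st.Ft))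
  (1 - par.theta) • st.x + par.theta • prox M.R par.eta (st.x - par.eta • v)

/-- Initial mini-batch estimators of stage `s`. -/
noncomputable def initState (M : MinimaxProblem p q n Ω) (B : MiniBatches W Ω sz) (s : ℕ) (ω : W)
    (start : StageStart p) : InnerState p q where
  x := start.x
  Ft := (1 / (sz.b0 : ℝ)) • ∑ i, M.stochF start.x (B.B0 s i ω)
  Jt := (1 / (sz.bh0 : ℝ)) • ∑ i, M.stochJ start.x (B.Bh0 s i ω)
  evalF := start.evalF + sz.b0
  evalJ := start.evalJ + sz.bh0

/-- From iteration `t - 1` to iteration `t` of stage `s`: the new point, and the hybrid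
estimators at it. -/
noncomputable def innerStep (M : MinimaxProblem p q n Ω) (par : StepParams)
    (B : MiniBatches W Ω sz) (s t : ℕ) (ω : W) (st : InnerState p q) : InnerState p q :=
  let x' := nextPoint M par st
  { x := x'
    Ft := par.beta • st.Ft
      + (par.beta / (sz.b1 : ℝ)) •
          ∑ i, (M.stochF x' (B.B1 s t i ω) - M.stochF st.x (B.B1 s t i ω))
      + ((1 - par.beta) / (sz.b2 : ℝ)) • ∑ i, M.stochF x' (B.B2 s t i ω)
    Jt := par.beta • st.Jt
      + (par.beta / (sz.bh1 : ℝ)) •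
          ∑ i, (M.stochJ x' (B.Bh1 s t i ω) - M.stochJ st.x (B.Bh1 s t i ω))
      + ((1 - par.beta) / (sz.bh2 : ℝ)) • ∑ i, M.stochJ x' (B.Bh2 s t i ω)
    evalF := st.evalF + (2 * sz.b1 + sz.b2)
    evalJ := st.evalJ + (2 * sz.bh1 + sz.bh2) }

/-- The state at iteration `t` of stage `s`, when the stage begins with `start`. -/
noncomputable def innerRun (M : MinimaxProblem p q n Ω) (par : StepParams)
    (B : MiniBatches W Ω sz) (s : ℕ) (ω : W) (start : StageStart p) : ℕ → InnerState p q
  | 0 => initState M B s ω start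
  | t + 1 => innerStep M par B s (t + 1) ω (innerRun M par B s ω start t)

/-- The restarting algorithm: after `s` stages, the point `x̃ˢ` and the numbers of evaluations. Each
stage runs iterations `0, …, T` and hands over its last iterate `x_{T+1}`. -/
noncomputable def restartRun (M : MinimaxProblem p q n Ω) (par : StepParams)
    (B : MiniBatches W Ω sz) (T : ℕ) (x0 : Vec p) (ω : W) : ℕ → StageStart p
  | 0 => ⟨x0, 0, 0⟩
  | s + 1 =>
    let st := innerRun M par B s ω (restartRun M par B T x0 ω s) T
    ⟨nextPoint M par st, st.evalF, st.evalJ⟩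

/-- The iterate `x_t` of stage `s`. -/
noncomputable def restartIterate (M : MinimaxProblem p q n Ω) (par : StepParams)
    (B : MiniBatches W Ω sz) (T : ℕ) (x0 : Vec p) (s t : ℕ) (ω : W) : Vec p :=
  (innerRun M par B s ω (restartRun M par B T x0 ω s) t).x

/-- `E‖G_η(x̄_N)‖²`, where `x̄_N` is chosen uniformly, and independently of all mini-batches, among
the `S (T+1)` iterates of the first `S` stages. -/
noncomputable def expSqGradMap [MeasurableSpace W] (M : MinimaxProblem p q n Ω) (par : StepParams)
    (B : MiniBatches W Ω sz) (μ : Measure W) (T : ℕ) (x0 : Vec p) (S : ℕ) : ℝ≥0∞ :=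
  ∫⁻ z : W × (Fin S × Fin (T + 1)),
    ENNReal.ofReal (‖M.gradMap par.eta (restartIterate M par B T x0 z.2.1 z.2.2 z.1)‖ ^ 2)
    ∂(μ.prod (uniformOn (Set.univ : Set (Fin S × Fin (T + 1)))))

end Algorithm

/-! ### The constants of the theorem -/

/-- `P = (√26 ‖K‖ / (3√c₀)) √(κ M_F⁴ ‖K‖² + c₀ κ̂ L_F² M_ψ²)`. -/
noncomputable def constP (c : Constants) (normK c0 κ κh : ℝ) : ℝ :=
  Real.sqrt 26 * normK / (3 * Real.sqrt c0) *
    Real.sqrt (κ * c.MF ^ 4 * normK ^ 2 + c0 * κh * c.LF ^ 2 * c.Mpsi ^ 2)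

/-- `Q = (26 / (9c₀)) ‖K‖² (κ M_F² ‖K‖² σ_F² + c₀ κ̂ M_ψ² σ_J²)`. -/
noncomputable def constQ (c : Constants) (normK c0 κ κh : ℝ) : ℝ :=
  26 / (9 * c0) * normK ^ 2 *
    (κ * c.MF ^ 2 * normK ^ 2 * c.sigmaF ^ 2 + c0 * κh * c.Mpsi ^ 2 * c.sigmaJ ^ 2)

/-- `L_{Φ₀} = L_F M_ψ ‖K‖ + M_F² ‖K‖²`. -/
noncomputable def constL (c : Constants) (normK : ℝ) : ℝ :=
  c.LF * c.Mpsi * normK + c.MF ^ 2 * normK ^ 2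

/-- `β = 1 - b^{1/2}/[b̂₀(T+1)]^{1/2}`, `θ = L b^{3/4}/(P [b̂₀(T+1)]^{1/4})`, `η = 2/(L(3+θ))`. -/
noncomputable def stepParams (L P : ℝ) (b bh0 T : ℕ) : StepParams where
  beta := 1 - (b : ℝ) ^ (1 / 2 : ℝ) / ((bh0 : ℝ) * (T + 1)) ^ (1 / 2 : ℝ)
  theta := L * (b : ℝ) ^ (3 / 4 : ℝ) / (P * ((bh0 : ℝ) * (T + 1)) ^ (1 / 4 : ℝ))
  eta := 2 / (L * (3 + L * (b : ℝ) ^ (3 / 4 : ℝ) / (P * ((bh0 : ℝ) * (T + 1)) ^ (1 / 4 : ℝ))))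

/-! The proof is a Lyapunov argument on expectations, run inside a stage and then telescoped over
the stages.

Descent. Strong convexity of ψ makes the dual maximizer a proximal point (`yStar_eq_prox`), hence
‖K‖-Lipschitz, so φ₀ is finite and has a quadratic upper bound with constant ‖K‖². Together with the
averaged smoothness of 𝐅 this gives the descent inequality `Phi0_le` with constant L. Testing the
proximal step with it (`step_descent`), Ψ₀ drops by θ/(16L)·‖G_η(x_t)‖² + L/(2θ)·‖x_{t+1} - x_t‖²,
up to a multiple of the squared error of v_t, and that error is controlled by the weighted estimator
error `estError`.

Variance. The error of a hybrid estimator is β times the previous error plus centered noise from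
fresh batches. Averaging with the past frozen (`lintegral_comp_of_indepFun`) kills the cross terms
with the past, so the mean error a_t satisfies a_{t+1} ≤ β² a_t + β²P²/(2b)·E‖x_{t+1} - x_t‖² +
(1-β)²Q/(2b) (`lintegral_estError_succ_le`).

Combination. For E[Ψ₀(x_t) - Ψ₀*] + w·a_t with w = θ/(L(1-β)), the contraction absorbs the estimator
error of the descent step, and θ is such that the decrease in ‖x_{t+1} - x_t‖² covers the
displacement term (`sum_le_of_lyapunov`). A stage ends where the next one begins, so the sums
telescope (`sum_lintegral_gradMap_le`). The choice of β balances the error of the initial batches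
against the noise accumulated in a stage.

The domain of Ψ₀ may have empty interior. Then F'(x) and the mean Jacobian need only agree along
directions of the domain; everything is done with the mean Jacobian, and `prox_congr` shows that the
gradient mapping does not notice.

Complexity. The noise constant obtained is 16Q, not 24Q. With the stated parameters and no rounding,
the two terms are then ε²/2 and ε²/3, and the missing sixth pays for rounding batch sizes and stage
numbers and for stopping early. -/

set_option linter.unusedSectionVars false

/-! ### Extended-valued convex functions and proximal points -/

namespace ProperClosedConvex

variable {n : ℕ} {f : Vec n → EReal}

theorem coe_toReal (hf : ProperClosedConvex f) {x : Vec n} (hx : f x ≠ ⊤) :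
    (((f x).toReal : ℝ) : EReal) = f x :=
  EReal.coe_toReal hx (hf.ne_bot x)

/-- Convexity along a segment, with a real upper bound. -/
theorem segment_le (hf : ProperClosedConvex f) {x y : Vec n} (hx : f x ≠ ⊤) (hy : f y ≠ ⊤)
    {t : ℝ} (h0 : 0 ≤ t) (h1 : t ≤ 1) :
    f ((1 - t) • x + t • y) ≤ (((1 - t) * (f x).toReal + t * (f y).toReal : ℝ) : EReal) := by
  have hx' : (x, (f x).toReal) ∈ {z : Vec n × ℝ | f z.1 ≤ (z.2 : EReal)} := by
    simp [hf.coe_toReal hx]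
  have hy' : (y, (f y).toReal) ∈ {z : Vec n × ℝ | f z.1 ≤ (z.2 : EReal)} := by
    simp [hf.coe_toReal hy]
  have := hf.convex hx' hy' (sub_nonneg.2 h1) h0 (by ring)
  simpa using this

theorem segment_ne_top (hf : ProperClosedConvex f) {x y : Vec n} (hx : f x ≠ ⊤) (hy : f y ≠ ⊤)
    {t : ℝ} (h0 : 0 ≤ t) (h1 : t ≤ 1) : f ((1 - t) • x + t • y) ≠ ⊤ :=
  ne_top_of_le_ne_top (EReal.coe_ne_top _) (hf.segment_le hx hy h0 h1)

theorem toReal_segment_le (hf : ProperClosedConvex f) {x y : Vec n} (hx : f x ≠ ⊤) (hy : f y ≠ ⊤)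
    {t : ℝ} (h0 : 0 ≤ t) (h1 : t ≤ 1) :
    (f ((1 - t) • x + t • y)).toReal ≤ (1 - t) * (f x).toReal + t * (f y).toReal := by
  have h := hf.segment_le hx hy h0 h1
  rw [← hf.coe_toReal (hf.segment_ne_top hx hy h0 h1)] at h
  exact_mod_cast h

/-- A lower bound of at most linear growth. -/
theorem exists_linear_minorant (hf : ProperClosedConvex f) :
    ∃ (x₀ : Vec n) (C : ℝ), 0 ≤ C ∧ ∀ w, ((-C * (1 + ‖w - x₀‖) : ℝ) : EReal) ≤ f w := by
  obtain ⟨x₀, hx₀⟩ := hf.proper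
  obtain ⟨a, ha, hmin⟩ := (hf.closed.lowerSemicontinuousOn (Metric.closedBall x₀ 1)).exists_isMinOn
    ⟨x₀, Metric.mem_closedBall_self zero_le_one⟩ (isCompact_closedBall x₀ 1)
  have hax : f a ≤ f x₀ := hmin (Metric.mem_closedBall_self zero_le_one)
  have hatop : f a ≠ ⊤ := ne_top_of_le_ne_top hx₀ hax
  set m := (f a).toReal with hm
  set r := (f x₀).toReal with hr
  have hmr : m ≤ r := by
    have := hax
    rw [← hf.coe_toReal hatop, ← hf.coe_toReal hx₀] at this
    exact_mod_cast this
  refine ⟨x₀, |m| + |r|, by positivity, fun w => ?_⟩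
  by_cases hw : f w = ⊤
  · rw [hw]; exact le_top
  rw [← hf.coe_toReal hw]
  norm_cast
  by_cases hn : ‖w - x₀‖ ≤ 1
  · have h1 : f a ≤ f w := hmin (by simpa [dist_eq_norm] using hn)
    rw [← hf.coe_toReal hatop, ← hf.coe_toReal hw] at h1
    have h2 : m ≤ (f w).toReal := by exact_mod_cast h1
    have h3 : 0 ≤ (|m| + |r|) * ‖w - x₀‖ := by positivity
    nlinarith [neg_abs_le m, abs_nonneg r]
  · push Not at hn
    set d := ‖w - x₀‖ with hd
    have hd0 : 0 < d := by linarith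
    have ht1 : d⁻¹ ≤ 1 := inv_le_one_of_one_le₀ hn.le
    have ht0 : 0 ≤ d⁻¹ := by positivity
    -- The point of the segment at distance one from x₀ lies in the ball where f ≥ m. Convexity
    -- carries this bound out to w at the price of a factor d, which gives linear growth.
    have hmem : (1 - d⁻¹) • x₀ + d⁻¹ • w ∈ Metric.closedBall x₀ 1 := by
      have : (1 - d⁻¹) • x₀ + d⁻¹ • w - x₀ = d⁻¹ • (w - x₀) := by module
      rw [mem_closedBall_iff_norm, this, norm_smul, ← hd, Real.norm_of_nonneg ht0,
        inv_mul_cancel₀ hd0.ne']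
    have h1 : f a ≤ f ((1 - d⁻¹) • x₀ + d⁻¹ • w) := hmin hmem
    rw [← hf.coe_toReal hatop, ← hf.coe_toReal (hf.segment_ne_top hx₀ hw ht0 ht1)] at h1
    have h2 : m ≤ (1 - d⁻¹) * r + d⁻¹ * (f w).toReal :=
      le_trans (by exact_mod_cast h1) (hf.toReal_segment_le hx₀ hw ht0 ht1)
    have h3 : d * m ≤ (d - 1) * r + (f w).toReal := by
      have h4 := mul_le_mul_of_nonneg_left h2 hd0.le
      have h5 : d * ((1 - d⁻¹) * r + d⁻¹ * (f w).toReal) = (d - 1) * r + (f w).toReal := by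
        field_simp
      linarith
    nlinarith [neg_abs_le m, le_abs_self r, neg_abs_le r, abs_nonneg m, abs_nonneg r]

theorem lowerSemicontinuous_add_coe (hf : ProperClosedConvex f) {g : Vec n → ℝ}
    (hg : Continuous g) : LowerSemicontinuous fun w => f w + (g w : EReal) := by
  refine hf.closed.add' (continuous_coe_real_ereal.comp hg).lowerSemicontinuous fun x => ?_
  exact EReal.continuousAt_add (Or.inr (EReal.coe_ne_bot _)) (Or.inr (EReal.coe_ne_top _))

/-- Far from z the quadratic beats the linear minorant of f, so a minimizer over a large compact
ball is a global one. -/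
theorem exists_prox (hf : ProperClosedConvex f) {η : ℝ} (hη : 0 < η) (z : Vec n) :
    ∃ u, IsMinOn (fun w => f w + ((‖w - z‖ ^ 2 / (2 * η) : ℝ) : EReal)) Set.univ u := by
  obtain ⟨x₀, C, hC, hmin⟩ := hf.exists_linear_minorant
  obtain ⟨y, hy⟩ := hf.proper
  set g : Vec n → EReal := fun w => f w + ((‖w - z‖ ^ 2 / (2 * η) : ℝ) : EReal) with hg
  set A : ℝ := (f y).toReal + ‖y - z‖ ^ 2 / (2 * η) with hA
  have hgy : g y = (A : EReal) := by
    simp only [hg, hA, EReal.coe_add, hf.coe_toReal hy]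
  set D : ℝ := C * (1 + ‖z - x₀‖) + |A| with hD
  have hD0 : 0 ≤ D := by positivity
  -- The radius ensures d/(2η) ≥ C + D and d ≥ 1 outside the ball, where D collects the constant
  -- terms; the last summand puts the competitor y inside.
  set ρ : ℝ := 2 * η * (C + D) + 1 + ‖y - z‖ with hρ
  have hlsc : LowerSemicontinuous g := hf.lowerSemicontinuous_add_coe (by fun_prop)
  have hρ0 : 0 ≤ 2 * η * (C + D) := by positivity
  have hyB : y ∈ Metric.closedBall z ρ := by
    rw [mem_closedBall_iff_norm]; linarith
  obtain ⟨u, _, hu⟩ := (hlsc.lowerSemicontinuousOn (Metric.closedBall z ρ)).exists_isMinOn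
    ⟨y, hyB⟩ (isCompact_closedBall z ρ)
  refine ⟨u, fun w _ => ?_⟩
  by_cases hw : w ∈ Metric.closedBall z ρ
  · exact hu hw
  refine le_trans (hu hyB) (le_trans (le_of_eq hgy) ?_)
  rw [mem_closedBall_iff_norm] at hw
  push Not at hw
  set d := ‖w - z‖ with hd
  have hd1 : 2 * η * (C + D) + 1 ≤ d := by linarith [norm_nonneg (y - z)]
  have h1 : ‖w - x₀‖ ≤ d + ‖z - x₀‖ := by
    have := norm_add_le (w - z) (z - x₀)
    simpa using this
  have h2 : A ≤ -C * (1 + ‖w - x₀‖) + d ^ 2 / (2 * η) := by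
    have h3 : C + D ≤ d / (2 * η) := by
      rw [le_div_iff₀ (by positivity)]; linarith
    have h4 : (C + D) * d ≤ d ^ 2 / (2 * η) := by
      have := mul_le_mul_of_nonneg_right h3 (show 0 ≤ d by positivity)
      calc _ ≤ _ := this
        _ = _ := by ring
    have h5 : 1 ≤ d := by linarith
    nlinarith [le_abs_self A, mul_le_mul_of_nonneg_left h1 hC, mul_le_mul_of_nonneg_left h5 hD0]
  calc (A : EReal) ≤ ((-C * (1 + ‖w - x₀‖) + d ^ 2 / (2 * η) : ℝ) : EReal) := by exact_mod_cast h2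
    _ = ((-C * (1 + ‖w - x₀‖) : ℝ) : EReal) + ((d ^ 2 / (2 * η) : ℝ) : EReal) :=
        EReal.coe_add _ _
    _ ≤ g w := add_le_add (hmin w) le_rfl

theorem prox_isMinOn (hf : ProperClosedConvex f) {η : ℝ} (hη : 0 < η) (z : Vec n) :
    IsMinOn (fun w => f w + ((‖w - z‖ ^ 2 / (2 * η) : ℝ) : EReal)) Set.univ (prox f η z) :=
  Classical.epsilon_spec (hf.exists_prox hη z)

theorem prox_ne_top (hf : ProperClosedConvex f) {η : ℝ} (hη : 0 < η) (z : Vec n) :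
    f (prox f η z) ≠ ⊤ := by
  obtain ⟨y, hy⟩ := hf.proper
  intro h
  have h1 := hf.prox_isMinOn hη z (Set.mem_univ y)
  simp only [Set.mem_ofPred_eq, h, EReal.top_add_coe, top_le_iff] at h1
  rw [← hf.coe_toReal hy, ← EReal.coe_add] at h1
  exact EReal.coe_ne_top _ h1

/-- The variational inequality of the proximal point. -/
theorem prox_variational (hf : ProperClosedConvex f) {η : ℝ} (hη : 0 < η) (z : Vec n) {w : Vec n}
    (hw : f w ≠ ⊤) :
    (f (prox f η z)).toReal + inner ℝ (z - prox f η z) (w - prox f η z) / η ≤ (f w).toReal := by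
  set u := prox f η z with hu
  have hut : f u ≠ ⊤ := hf.prox_ne_top hη z
  -- Minimality of u against the point at parameter t towards w, with convexity of f and division by
  -- t, leaves an error linear in t; then t → 0.
  have key : ∀ t : ℝ, 0 < t → t ≤ 1 →
      (f u).toReal + inner ℝ (z - u) (w - u) / η ≤ (f w).toReal + t * (‖w - u‖ ^ 2 / (2 * η)) := by
    intro t h0 h1
    have h2 := hf.prox_isMinOn hη z (Set.mem_univ ((1 - t) • u + t • w))
    simp only [Set.mem_ofPred_eq, ← hu] at h2
    have h3 := h2.trans (add_le_add (hf.segment_le hut hw h0.le h1) le_rfl)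
    rw [← hf.coe_toReal hut, ← EReal.coe_add, ← EReal.coe_add, EReal.coe_le_coe_iff] at h3
    have h4 : ‖(1 - t) • u + t • w - z‖ ^ 2
        = ‖u - z‖ ^ 2 - 2 * t * inner ℝ (z - u) (w - u) + t ^ 2 * ‖w - u‖ ^ 2 := by
      have : (1 - t) • u + t • w - z = (u - z) + t • (w - u) := by module
      rw [this, norm_add_sq_real, inner_smul_right, norm_smul, mul_pow, Real.norm_eq_abs, sq_abs,
        ← neg_sub z u, inner_neg_left, norm_neg]
      ring
    rw [h4] at h3
    have h5 : (‖u - z‖ ^ 2 - 2 * t * inner ℝ (z - u) (w - u) + t ^ 2 * ‖w - u‖ ^ 2) / (2 * η)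
        = ‖u - z‖ ^ 2 / (2 * η) - t * (inner ℝ (z - u) (w - u) / η)
          + t * (t * (‖w - u‖ ^ 2 / (2 * η))) := by
      field_simp
    rw [h5] at h3
    have h6 : t * ((f u).toReal + inner ℝ (z - u) (w - u) / η)
        ≤ t * ((f w).toReal + t * (‖w - u‖ ^ 2 / (2 * η))) := by
      simp only [EReal.toReal_coe] at h3
      linarith
    exact le_of_mul_le_mul_left h6 h0
  have hlim : Filter.Tendsto (fun t : ℝ => (f w).toReal + t * (‖w - u‖ ^ 2 / (2 * η)))
      (nhdsWithin 0 (Set.Ioi 0)) (nhds ((f w).toReal + 0 * (‖w - u‖ ^ 2 / (2 * η)))) :=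
    (Continuous.tendsto (by fun_prop) 0).mono_left nhdsWithin_le_nhds
  rw [zero_mul, add_zero] at hlim
  refine ge_of_tendsto hlim ?_
  filter_upwards [Ioc_mem_nhdsGT (zero_lt_one' ℝ)] with t ht using key t ht.1 ht.2

/-- Sum of the two variational inequalities, each tested at the other proximal point. -/
theorem prox_firm (hf : ProperClosedConvex f) {η : ℝ} (hη : 0 < η) (z z' : Vec n) :
    ‖prox f η z - prox f η z'‖ ^ 2 ≤ inner ℝ (z - z') (prox f η z - prox f η z') := by
  have h1 := hf.prox_variational hη z (hf.prox_ne_top hη z')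
  have h2 := hf.prox_variational hη z' (hf.prox_ne_top hη z)
  set u := prox f η z
  set u' := prox f η z'
  have h3 : (inner ℝ (z - u) (u' - u) + inner ℝ (z' - u') (u - u')) / η ≤ 0 := by
    rw [add_div]; linarith
  rw [div_le_iff₀ hη, zero_mul] at h3
  have h4 : (inner ℝ (z - u) (u' - u) : ℝ) + inner ℝ (z' - u') (u - u')
      = ‖u - u'‖ ^ 2 - inner ℝ (z - z') (u - u') := by
    rw [← real_inner_self_eq_norm_sq, ← neg_sub u u', inner_neg_right]
    simp only [inner_sub_left, inner_sub_right]
    ring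
  linarith

theorem prox_nonexpansive (hf : ProperClosedConvex f) {η : ℝ} (hη : 0 < η) (z z' : Vec n) :
    ‖prox f η z - prox f η z'‖ ≤ ‖z - z'‖ := by
  have h := (hf.prox_firm hη z z').trans (real_inner_le_norm _ _)
  rcases (norm_nonneg (prox f η z - prox f η z')).eq_or_lt with h0 | h0
  · rw [← h0]; positivity
  · nlinarith

theorem continuous_prox (hf : ProperClosedConvex f) {η : ℝ} (hη : 0 < η) :
    Continuous (prox f η) :=
  (LipschitzWith.of_dist_le_mul (K := 1) fun z z' => by
    simpa [dist_eq_norm] using hf.prox_nonexpansive hη z z').continuous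

/-- The proximal point does not see the component orthogonal to the domain. -/
theorem prox_congr (hf : ProperClosedConvex f) {η : ℝ} (hη : 0 < η) {z z' : Vec n}
    (h : ∀ w w', f w ≠ ⊤ → f w' ≠ ⊤ → inner ℝ (z - z') (w - w') = 0) :
    prox f η z = prox f η z' := by
  have h1 := hf.prox_firm hη z z'
  rw [h _ _ (hf.prox_ne_top hη z) (hf.prox_ne_top hη z')] at h1
  have : ‖prox f η z - prox f η z'‖ = 0 := by
    nlinarith [norm_nonneg (prox f η z - prox f η z')]
  exact sub_eq_zero.1 (norm_eq_zero.1 this)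

end ProperClosedConvex

/-- A strongly convex function minus its quadratic part. -/
noncomputable def subQuadratic {n : ℕ} (f : Vec n → EReal) : Vec n → EReal :=
  fun y => f y - ((1 / 2 * ‖y‖ ^ 2 : ℝ) : EReal)

theorem subQuadratic_eq_top_iff {n : ℕ} {f : Vec n → EReal} (y : Vec n) :
    subQuadratic f y = ⊤ ↔ f y = ⊤ := by
  unfold subQuadratic
  generalize (1 / 2 * ‖y‖ ^ 2 : ℝ) = r
  induction f y with
  | bot => simp
  | top => simp
  | coe a => simp only [← EReal.coe_sub, EReal.coe_ne_top]

theorem subQuadratic_toReal {n : ℕ} {f : Vec n → EReal} {y : Vec n} (hy : f y ≠ ⊤)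
    (hy' : f y ≠ ⊥) : (subQuadratic f y).toReal = (f y).toReal - 1 / 2 * ‖y‖ ^ 2 := by
  unfold subQuadratic
  generalize (1 / 2 * ‖y‖ ^ 2 : ℝ) = r
  lift f y to ℝ using ⟨hy, hy'⟩ with a
  rw [← EReal.coe_sub, EReal.toReal_coe, EReal.toReal_coe]

/-- This makes the theory of proximal points available for ψ without its quadratic part, which is
how the dual maximizer is analysed. -/
theorem ProperClosedConvex.subQuadratic {n : ℕ} {f : Vec n → EReal} (hf : ProperClosedConvex f)
    (hsc : EStronglyConvex 1 f) : ProperClosedConvex (subQuadratic f) where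
  ne_bot x := by
    have := hf.ne_bot x
    unfold _root_.subQuadratic
    generalize (1 / 2 * ‖x‖ ^ 2 : ℝ) = r
    induction h : f x with
    | bot => exact absurd h this
    | top => simp
    | coe a => rw [← EReal.coe_sub]; exact EReal.coe_ne_bot _
  proper := by
    obtain ⟨x, hx⟩ := hf.proper
    exact ⟨x, fun h => hx ((subQuadratic_eq_top_iff x).1 h)⟩
  closed := by
    have h := hf.lowerSemicontinuous_add_coe (g := fun y => -(1 / 2 * ‖y‖ ^ 2)) (by fun_prop)
    simp only [EReal.coe_neg, ← sub_eq_add_neg] at h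
    exact h
  convex := hsc

/-! ### The dual maximization problem -/

namespace MinimaxProblem

variable {p q n : ℕ} {Ω : Type*} [MeasurableSpace Ω] {M : MinimaxProblem p q n Ω}

theorem inner_K_eq (M : MinimaxProblem p q n Ω) (u : Vec q) (w : Vec n) :
    (inner ℝ u (M.K w) : ℝ) = inner ℝ (ContinuousLinearMap.adjoint M.K u) w :=
  (ContinuousLinearMap.adjoint_inner_left M.K w u).symm

/-- The maximizer of the dual problem is a proximal point. -/
theorem yStar_eq_prox (hψ : ProperClosedConvex M.psi) (u : Vec q) :
    M.yStar u = prox (subQuadratic M.psi) 1 (ContinuousLinearMap.adjoint M.K u) := by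
  set a := ContinuousLinearMap.adjoint M.K u with ha
  unfold yStar prox
  congr 1
  funext y
  rw [eq_iff_iff, isMaxOn_univ_iff, isMinOn_univ_iff]
  refine forall_congr' fun w => ?_
  -- Completing the square: with proximal parameter 1, the quadratic taken out of ψ by strong
  -- convexity is exactly the one put back by the proximal term, and the linear term appears.
  have hexp : ∀ w : Vec n, (‖w - a‖ ^ 2 / (2 * 1) : ℝ)
      = 1 / 2 * ‖w‖ ^ 2 - inner ℝ u (M.K w) + 1 / 2 * ‖a‖ ^ 2 := fun w => by
    rw [M.inner_K_eq, ← ha, norm_sub_sq_real, real_inner_comm]; ring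
  unfold subQuadratic
  simp only [hexp]
  generalize (1 / 2 * ‖w‖ ^ 2 : ℝ) = r
  generalize (1 / 2 * ‖y‖ ^ 2 : ℝ) = r'
  generalize (1 / 2 * ‖a‖ ^ 2 : ℝ) = r''
  generalize (inner ℝ u (M.K w) : ℝ) = i
  generalize (inner ℝ u (M.K y) : ℝ) = i'
  have hw := hψ.ne_bot w
  have hy := hψ.ne_bot y
  generalize M.psi w = c at hw ⊢
  generalize M.psi y = d at hy ⊢
  induction c with
  | bot => exact absurd rfl hw
  | top =>
    rw [EReal.top_sub_coe, EReal.top_add_coe, EReal.sub_top]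
    simp
  | coe c =>
    induction d with
    | bot => exact absurd rfl hy
    | top =>
      simp only [← EReal.coe_sub, EReal.sub_top, EReal.top_sub_coe, EReal.top_add_coe,
        ← EReal.coe_add, top_le_iff, EReal.coe_ne_top, le_bot_iff, EReal.coe_ne_bot]
    | coe d =>
      simp only [← EReal.coe_sub, ← EReal.coe_add, EReal.coe_le_coe_iff]
      constructor <;> intro h <;> linarith

theorem psi_yStar_ne_top (hψ : ProperClosedConvex M.psi) (hsc : EStronglyConvex 1 M.psi)
    (u : Vec q) : M.psi (M.yStar u) ≠ ⊤ := by
  rw [yStar_eq_prox hψ, Ne, ← subQuadratic_eq_top_iff]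
  exact (hψ.subQuadratic hsc).prox_ne_top one_pos _

/-- Quadratic growth of the dual objective around its maximizer. -/
theorem dual_objective_le (hψ : ProperClosedConvex M.psi) (hsc : EStronglyConvex 1 M.psi)
    (u : Vec q) {y : Vec n} (hy : M.psi y ≠ ⊤) :
    inner ℝ u (M.K y) - (M.psi y).toReal + 1 / 2 * ‖y - M.yStar u‖ ^ 2
      ≤ inner ℝ u (M.K (M.yStar u)) - (M.psi (M.yStar u)).toReal := by
  have h := (hψ.subQuadratic hsc).prox_variational one_pos (ContinuousLinearMap.adjoint M.K u)
    (w := y) (by rwa [Ne, subQuadratic_eq_top_iff])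
  rw [← yStar_eq_prox hψ, div_one, subQuadratic_toReal hy (hψ.ne_bot _),
    subQuadratic_toReal (psi_yStar_ne_top hψ hsc u) (hψ.ne_bot _), inner_sub_left, inner_sub_right,
    ← M.inner_K_eq, ← M.inner_K_eq, inner_sub_right, real_inner_self_eq_norm_sq] at h
  have h2 := norm_sub_sq_real y (M.yStar u)
  rw [real_inner_comm] at h2
  linarith

/-- The maximizer is a nonexpansive map of Kᵀu. -/
theorem norm_yStar_sub_le (hψ : ProperClosedConvex M.psi) (hsc : EStronglyConvex 1 M.psi)
    (u u' : Vec q) : ‖M.yStar u - M.yStar u'‖ ≤ ‖M.K‖ * ‖u - u'‖ := by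
  rw [yStar_eq_prox hψ, yStar_eq_prox hψ]
  refine ((hψ.subQuadratic hsc).prox_nonexpansive one_pos _ _).trans ?_
  rw [← map_sub]
  exact (ContinuousLinearMap.le_opNorm _ _).trans_eq (by simp)

theorem continuous_yStar (hψ : ProperClosedConvex M.psi) (hsc : EStronglyConvex 1 M.psi) :
    Continuous M.yStar :=
  (LipschitzWith.of_dist_le_mul (K := ‖M.K‖₊) fun z z' => by
    simpa [dist_eq_norm] using norm_yStar_sub_le hψ hsc z z').continuous

theorem phi0_eq (hψ : ProperClosedConvex M.psi) (hsc : EStronglyConvex 1 M.psi) (u : Vec q) :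
    M.phi0 u = ((inner ℝ u (M.K (M.yStar u)) - (M.psi (M.yStar u)).toReal : ℝ) : EReal) := by
  apply le_antisymm
  · refine iSup_le fun y => ?_
    by_cases hy : M.psi y = ⊤
    · simp [hy]
    · rw [← hψ.coe_toReal hy, ← EReal.coe_sub, EReal.coe_le_coe_iff]
      have := dual_objective_le hψ hsc u hy
      nlinarith [sq_nonneg ‖y - M.yStar u‖]
  · rw [EReal.coe_sub, hψ.coe_toReal (psi_yStar_ne_top hψ hsc u)]
    exact le_iSup (fun y => ((inner ℝ u (M.K y) : ℝ) : EReal) - M.psi y) _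

theorem coe_phi0_toReal (hψ : ProperClosedConvex M.psi) (hsc : EStronglyConvex 1 M.psi)
    (u : Vec q) : (((M.phi0 u).toReal : ℝ) : EReal) = M.phi0 u := by
  rw [phi0_eq hψ hsc, EReal.toReal_coe]

/-- The maximizer for u is an admissible competitor for u', so K y*₀(u) is a subgradient of φ₀. -/
theorem le_phi0_toReal (hψ : ProperClosedConvex M.psi) (hsc : EStronglyConvex 1 M.psi)
    (u u' : Vec q) :
    (M.phi0 u).toReal + inner ℝ (u' - u) (M.K (M.yStar u)) ≤ (M.phi0 u').toReal := by
  rw [phi0_eq hψ hsc, phi0_eq hψ hsc, EReal.toReal_coe, EReal.toReal_coe, inner_sub_left]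
  have h := dual_objective_le hψ hsc u' (psi_yStar_ne_top hψ hsc u)
  nlinarith [sq_nonneg ‖M.yStar u - M.yStar u'‖]

/-- Replacing the maximizer for u' by the one for u costs ⟨u' - u, K(y' - y)⟩, and Young's
inequality absorbs this into the quadratic growth term ½‖y' - y‖². -/
theorem phi0_toReal_le (hψ : ProperClosedConvex M.psi) (hsc : EStronglyConvex 1 M.psi)
    (u u' : Vec q) :
    (M.phi0 u').toReal ≤ (M.phi0 u).toReal + inner ℝ (u' - u) (M.K (M.yStar u))
      + ‖M.K‖ ^ 2 / 2 * ‖u' - u‖ ^ 2 := by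
  rw [phi0_eq hψ hsc, phi0_eq hψ hsc, EReal.toReal_coe, EReal.toReal_coe]
  have h := dual_objective_le hψ hsc u (psi_yStar_ne_top hψ hsc u')
  have h1 : (inner ℝ (u' - u) (M.K (M.yStar u' - M.yStar u)) : ℝ)
      ≤ ‖u' - u‖ * (‖M.K‖ * ‖M.yStar u' - M.yStar u‖) :=
    (real_inner_le_norm _ _).trans (by gcongr; exact M.K.le_opNorm _)
  simp only [map_sub, inner_sub_left, inner_sub_right] at h1 ⊢
  nlinarith [sq_nonneg (‖M.K‖ * ‖u' - u‖ - ‖M.yStar u' - M.yStar u‖)]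

/-- The lower and the upper bound above pinch the first-order remainder to O(‖v - u‖²), which gives
differentiability without an envelope theorem. -/
theorem hasFDerivAt_phi0_toReal (hψ : ProperClosedConvex M.psi) (hsc : EStronglyConvex 1 M.psi)
    (u : Vec q) :
    HasFDerivAt (fun v => (M.phi0 v).toReal) (innerSL ℝ (M.K (M.yStar u))) u := by
  have h : (fun v => (M.phi0 v).toReal - innerSL ℝ (M.K (M.yStar u)) (v - u) - (M.phi0 u).toReal)
      =O[nhds u] fun v => ‖v - u‖ ^ 2 := by
    refine Asymptotics.IsBigO.of_bound (‖M.K‖ ^ 2 / 2) (Filter.Eventually.of_forall fun v => ?_)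
    have h1 := le_phi0_toReal hψ hsc u v
    have h2 := phi0_toReal_le hψ hsc u v
    rw [innerSL_apply_apply, real_inner_comm, Real.norm_eq_abs, Real.norm_of_nonneg (by positivity),
      abs_le]
    constructor <;> nlinarith [sq_nonneg (‖M.K‖ * ‖v - u‖)]
  have h2 := (h.hasFDerivAt (by norm_num)).add
    (((innerSL ℝ (M.K (M.yStar u))).hasFDerivAt.comp u
      ((hasFDerivAt_id u).sub_const u)).add_const (M.phi0 u).toReal)
  refine (h2.congr_fderiv (by ext; simp)).congr_of_eventuallyEq (Filter.Eventually.of_forall fun v => ?_)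
  simp

end MinimaxProblem

/-! ### The primal function -/

namespace StandingAssumption

open MinimaxProblem

variable {p q n : ℕ} {Ω : Type*} [MeasurableSpace Ω] {M : MinimaxProblem p q n Ω}

/-- φ₀ is finite everywhere, so only R restricts the domain, and the domain is convex. -/
theorem mem_domPsi0 (hM : StandingAssumption M) (hψ : ProperClosedConvex M.psi)
    (hsc : EStronglyConvex 1 M.psi) {x : Vec p} : x ∈ M.domPsi0 ↔ M.R x ≠ ⊤ := by
  unfold domPsi0 Psi0
  rw [Set.mem_ofPred_eq, phi0_eq hψ hsc, lt_top_iff_ne_top, not_iff_not]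
  constructor
  · intro h
    by_contra hR
    rw [← hM.R_pcc.coe_toReal hR, ← EReal.coe_add] at h
    exact EReal.coe_ne_top _ h
  · intro h
    rw [h, EReal.coe_add_top]

theorem segment_mem (hM : StandingAssumption M) (hψ : ProperClosedConvex M.psi)
    (hsc : EStronglyConvex 1 M.psi) {x y : Vec p} (hx : x ∈ M.domPsi0) (hy : y ∈ M.domPsi0)
    {t : ℝ} (h0 : 0 ≤ t) (h1 : t ≤ 1) : (1 - t) • x + t • y ∈ M.domPsi0 := by
  rw [hM.mem_domPsi0 hψ hsc] at *
  exact hM.R_pcc.segment_ne_top hx hy h0 h1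

theorem prox_mem (hM : StandingAssumption M) (hψ : ProperClosedConvex M.psi)
    (hsc : EStronglyConvex 1 M.psi) {η : ℝ} (hη : 0 < η) (z : Vec p) :
    prox M.R η z ∈ M.domPsi0 := by
  rw [hM.mem_domPsi0 hψ hsc]
  exact hM.R_pcc.prox_ne_top hη z

theorem coe_Psi0 (hM : StandingAssumption M) (hψ : ProperClosedConvex M.psi)
    (hsc : EStronglyConvex 1 M.psi) {x : Vec p} (hx : x ∈ M.domPsi0) :
    M.Psi0 x = ((M.Phi0 x + (M.R x).toReal : ℝ) : EReal) := by
  rw [EReal.coe_add, hM.R_pcc.coe_toReal ((hM.mem_domPsi0 hψ hsc).1 hx), Phi0,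
    coe_phi0_toReal hψ hsc]
  rfl

theorem Psi0_toReal (hM : StandingAssumption M) (hψ : ProperClosedConvex M.psi)
    (hsc : EStronglyConvex 1 M.psi) {x : Vec p} (hx : x ∈ M.domPsi0) :
    (M.Psi0 x).toReal = M.Phi0 x + (M.R x).toReal := by
  rw [hM.coe_Psi0 hψ hsc hx, EReal.toReal_coe]

theorem Psi0Star_le (hM : StandingAssumption M) (hψ : ProperClosedConvex M.psi)
    (hsc : EStronglyConvex 1 M.psi) {x : Vec p} (hx : x ∈ M.domPsi0) :
    M.Psi0Star.toReal ≤ (M.Psi0 x).toReal := by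
  refine EReal.toReal_le_toReal (iInf_le _ x) hM.bounded_below.ne' ?_
  rw [hM.coe_Psi0 hψ hsc hx]
  exact EReal.coe_ne_top _

theorem gradient_Phi0 (hM : StandingAssumption M) (hψ : ProperClosedConvex M.psi)
    (hsc : EStronglyConvex 1 M.psi) {x : Vec p} (hx : x ∈ M.domPsi0) :
    gradient M.Phi0 x = ContinuousLinearMap.adjoint (M.J x) (M.K (M.yStar (M.F x))) := by
  have h : HasFDerivAt M.Phi0 ((innerSL ℝ (M.K (M.yStar (M.F x)))).comp (M.J x)) x :=
    (hasFDerivAt_phi0_toReal hψ hsc (M.F x)).comp x (hM.differentiable_F x hx).hasFDerivAt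
  refine HasGradientAt.gradient ?_
  rw [hasGradientAt_iff_hasFDerivAt]
  refine h.congr_fderiv ?_
  ext v
  simp [ContinuousLinearMap.adjoint_inner_left]

end StandingAssumption

/-! ### Second moments of Hilbert-space valued random variables -/

section SecondMoments

variable {W Ω H : Type*} [MeasurableSpace W] [MeasurableSpace Ω]
  [NormedAddCommGroup H] {μ : Measure W}

theorem ofReal_norm_sq (x : H) : ENNReal.ofReal (‖x‖ ^ 2) = ‖x‖ₑ ^ 2 := by
  rw [ENNReal.ofReal_pow (norm_nonneg _), ofReal_norm]

theorem memLp_two_of_lintegral_lt_top {X : W → H} (hX : AEStronglyMeasurable X μ)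
    (h : ∫⁻ ω, ‖X ω‖ₑ ^ 2 ∂μ < ⊤) : MemLp X 2 μ := by
  rw [memLp_two_iff_integrable_sq_norm hX]
  refine ⟨(hX.norm.pow 2), ?_⟩
  simpa [HasFiniteIntegral, enorm_pow] using h

theorem MeasureTheory.MemLp.lintegral_enorm_sq {X : W → H} (hX : MemLp X 2 μ) :
    ∫⁻ ω, ‖X ω‖ₑ ^ 2 ∂μ = ENNReal.ofReal (∫ ω, ‖X ω‖ ^ 2 ∂μ) := by
  rw [ofReal_integral_eq_lintegral_ofReal
    ((memLp_two_iff_integrable_sq_norm hX.1).1 hX) (ae_of_all _ fun _ => by positivity)]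
  simp only [ofReal_norm_sq]

theorem MeasureTheory.MemLp.integral_norm_sq_le {X : W → H} (hX : MemLp X 2 μ) {c : ℝ}
    (hc : 0 ≤ c) (h : ∫⁻ ω, ‖X ω‖ₑ ^ 2 ∂μ ≤ ENNReal.ofReal c) : ∫ ω, ‖X ω‖ ^ 2 ∂μ ≤ c := by
  rw [hX.lintegral_enorm_sq] at h
  exact (ENNReal.ofReal_le_ofReal_iff hc).1 h

/-- The first moment is controlled by the second one. -/
theorem sq_lintegral_le [IsProbabilityMeasure μ] {g : W → ℝ≥0∞} (hg : AEMeasurable g μ) :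
    (∫⁻ ω, g ω ∂μ) ^ 2 ≤ ∫⁻ ω, g ω ^ 2 ∂μ := by
  have h := ENNReal.lintegral_mul_le_Lp_mul_Lq μ Real.HolderConjugate.two_two hg
    (aemeasurable_const (b := (1 : ℝ≥0∞)))
  simp only [Pi.mul_apply, mul_one, ENNReal.rpow_two, one_pow, ENNReal.one_rpow, lintegral_const,
    measure_univ] at h
  calc (∫⁻ ω, g ω ∂μ) ^ 2 ≤ ((∫⁻ ω, g ω ^ 2 ∂μ) ^ (1 / 2 : ℝ)) ^ 2 := by gcongr
    _ = _ := by rw [← ENNReal.rpow_two, ← ENNReal.rpow_mul]; norm_num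

variable [InnerProductSpace ℝ H]

theorem MeasureTheory.MemLp.integrable_real_inner {X Y : W → H} (hX : MemLp X 2 μ)
    (hY : MemLp Y 2 μ) : Integrable (fun ω => (inner ℝ (X ω) (Y ω) : ℝ)) μ := by
  have h1 := (memLp_two_iff_integrable_sq_norm hX.1).1 hX
  have h2 := (memLp_two_iff_integrable_sq_norm hY.1).1 hY
  refine (h1.add h2).mono' (hX.1.inner hY.1) (ae_of_all _ fun ω => ?_)
  refine (norm_inner_le_norm (𝕜 := ℝ) _ _).trans ?_
  simp only [Pi.add_apply]
  nlinarith [sq_nonneg (‖X ω‖ - ‖Y ω‖), sq_nonneg ‖X ω‖, sq_nonneg ‖Y ω‖]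

theorem integral_norm_add_sq {X Y : W → H} (hX : MemLp X 2 μ) (hY : MemLp Y 2 μ) :
    ∫ ω, ‖X ω + Y ω‖ ^ 2 ∂μ
      = ∫ ω, ‖X ω‖ ^ 2 ∂μ + 2 * ∫ ω, inner ℝ (X ω) (Y ω) ∂μ + ∫ ω, ‖Y ω‖ ^ 2 ∂μ := by
  have h1 := (memLp_two_iff_integrable_sq_norm hX.1).1 hX
  have h2 := (memLp_two_iff_integrable_sq_norm hY.1).1 hY
  have h3 := (hX.integrable_real_inner hY).const_mul 2
  simp only [norm_add_sq_real]
  have h4 := integral_add (h1.add h3) h2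
  simp only [Pi.add_apply] at h4
  rw [h4, integral_add h1 h3, integral_const_mul]

variable [CompleteSpace H]

theorem integral_norm_const_add_sq [IsProbabilityMeasure μ] (e : H) {Y : W → H} (hY : MemLp Y 2 μ)
    (hY0 : ∫ ω, Y ω ∂μ = 0) :
    ∫ ω, ‖e + Y ω‖ ^ 2 ∂μ = ‖e‖ ^ 2 + ∫ ω, ‖Y ω‖ ^ 2 ∂μ := by
  rw [integral_norm_add_sq (memLp_const e) hY, integral_inner (hY.integrable one_le_two), hY0]
  simp

/-- The mean minimizes the mean squared deviation. -/
theorem lintegral_sub_integral_sq_le [IsProbabilityMeasure μ] {X : W → H} (hX : MemLp X 2 μ)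
    (c : H) :
    ∫⁻ ω, ‖X ω - ∫ ω', X ω' ∂μ‖ₑ ^ 2 ∂μ ≤ ∫⁻ ω, ‖X ω - c‖ₑ ^ 2 ∂μ := by
  set m := ∫ ω', X ω' ∂μ with hm
  have h1 : MemLp (fun ω => X ω - m) 2 μ := hX.sub (memLp_const m)
  have h2 : MemLp (fun ω => X ω - c) 2 μ := hX.sub (memLp_const c)
  have h0 : ∫ ω, (X ω - m) ∂μ = 0 := by
    rw [integral_sub (hX.integrable one_le_two) (integrable_const m)]
    simp [hm]
  rw [h1.lintegral_enorm_sq, h2.lintegral_enorm_sq]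
  refine ENNReal.ofReal_le_ofReal ?_
  have h3 := integral_norm_const_add_sq (m - c) h1 h0
  have h4 : ∀ ω, m - c + (X ω - m) = X ω - c := fun ω => by abel
  simp only [h4] at h3
  rw [h3]
  linarith [sq_nonneg ‖m - c‖]

variable [MeasurableSpace H] [BorelSpace H]

theorem integral_inner_eq_zero_of_indepFun [IsProbabilityMeasure μ] {X Y : W → H}
    (hX : MemLp X 2 μ) (hY : MemLp Y 2 μ) (h : IndepFun X Y μ) (hY0 : ∫ ω, Y ω ∂μ = 0) :
    ∫ ω, inner ℝ (X ω) (Y ω) ∂μ = 0 := by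
  have := h.integral_bilin (hX.integrable one_le_two) (hY.integrable one_le_two) (innerSL ℝ)
  rw [hY0, map_zero] at this
  exact this

/-- Expanding the square, every mixed term is the inner product of two independent centered
variables and vanishes. -/
theorem integral_norm_sum_sq [IsProbabilityMeasure μ] {ι : Type*} {X : ι → W → H} (s : Finset ι)
    (hX : ∀ i, MemLp (X i) 2 μ) (h0 : ∀ i, ∫ ω, X i ω ∂μ = 0)
    (hind : Pairwise fun i j => IndepFun (X i) (X j) μ) :
    ∫ ω, ‖∑ i ∈ s, X i ω‖ ^ 2 ∂μ = ∑ i ∈ s, ∫ ω, ‖X i ω‖ ^ 2 ∂μ := by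
  classical
  induction s using Finset.induction_on with
  | empty => simp
  | insert a s ha ih =>
    have hs : MemLp (fun ω => ∑ i ∈ s, X i ω) 2 μ := memLp_finsetSum s fun i _ => hX i
    simp only [Finset.sum_insert ha]
    rw [integral_norm_add_sq (hX a) hs, ih]
    have : ∫ ω, inner ℝ (X a ω) (∑ i ∈ s, X i ω) ∂μ = 0 := by
      simp only [inner_sum]
      rw [integral_finsetSum s fun i _ => (hX a).integrable_real_inner (hX i)]
      refine Finset.sum_eq_zero fun i hi => ?_
      exact integral_inner_eq_zero_of_indepFun (hX a) (hX i)
        (hind fun h => ha (h ▸ hi)) (h0 i)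
    rw [this]
    ring

/-! ### Averages over one i.i.d. mini-batch -/

section Batch

variable {law : Measure Ω} {k : ℕ} {B : Fin k → W → Ω}

theorem IsIIDSample.lintegral_comp (hB : IsIIDSample B μ law) (i : Fin k) {f : Ω → ℝ≥0∞}
    (hf : Measurable f) : ∫⁻ ω, f (B i ω) ∂μ = ∫⁻ ξ, f ξ ∂law := by
  rw [← hB.map_eq i, lintegral_map hf (hB.measurable i)]

theorem IsIIDSample.memLp_comp (hB : IsIIDSample B μ law) (i : Fin k) {h : Ω → H}
    (hh : MemLp h 2 law) : MemLp (fun ω => h (B i ω)) 2 μ :=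
  hh.comp_measurePreserving ⟨hB.measurable i, hB.map_eq i⟩

theorem IsIIDSample.memLp_avg (hB : IsIIDSample B μ law) {h : Ω → H} (hh : MemLp h 2 law) :
    MemLp (fun ω => (1 / (k : ℝ)) • ∑ i, h (B i ω)) 2 μ := by
  have h1 : MemLp (fun ω => ∑ i, h (B i ω)) 2 μ :=
    memLp_finsetSum Finset.univ fun i _ => hB.memLp_comp i hh
  exact h1.const_smul (1 / (k : ℝ))

variable [IsProbabilityMeasure μ]

theorem IsIIDSample.integral_avg (hB : IsIIDSample B μ law) {h : Ω → H} (hh : MemLp h 2 law)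
    (h0 : ∫ ξ, h ξ ∂law = 0) : ∫ ω, (1 / (k : ℝ)) • ∑ i, h (B i ω) ∂μ = 0 := by
  rw [integral_smul, integral_finsetSum _ fun i _ => (hB.memLp_comp i hh).integrable one_le_two,
    Finset.sum_eq_zero, smul_zero]
  intro i _
  rw [← h0, ← hB.map_eq i, integral_map (hB.measurable i).aemeasurable]
  rw [hB.map_eq i]
  exact hh.1

/-- The k second moments add up by independence, and the prefactor 1/k² leaves one factor 1/k. -/
theorem IsIIDSample.integral_norm_avg_sq_le (hB : IsIIDSample B μ law) (hk : 0 < k) {h : Ω → H}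
    (hm : Measurable h) (hh : MemLp h 2 law) (h0 : ∫ ξ, h ξ ∂law = 0) {v : ℝ} (hv0 : 0 ≤ v)
    (hv : ∫⁻ ξ, ‖h ξ‖ₑ ^ 2 ∂law ≤ ENNReal.ofReal v) :
    ∫ ω, ‖(1 / (k : ℝ)) • ∑ i, h (B i ω)‖ ^ 2 ∂μ ≤ v / k := by
  have hX : ∀ i, MemLp (fun ω => h (B i ω)) 2 μ := fun i => hB.memLp_comp i hh
  have hX0 : ∀ i, ∫ ω, h (B i ω) ∂μ = 0 := fun i => by
    rw [← h0, ← hB.map_eq i, integral_map (hB.measurable i).aemeasurable]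
    rw [hB.map_eq i]
    exact hh.1
  have hind : Pairwise fun i j => IndepFun (fun ω => h (B i ω)) (fun ω => h (B j ω)) μ :=
    fun i j hij => (hB.indep.indepFun hij).comp hm hm
  have hbound : ∀ i, ∫ ω, ‖h (B i ω)‖ ^ 2 ∂μ ≤ v := fun i => by
    refine (hX i).integral_norm_sq_le hv0 (le_trans (le_of_eq ?_) hv)
    exact hB.lintegral_comp i (f := fun ξ => ‖h ξ‖ₑ ^ 2) (hm.enorm.pow_const 2)
  have hk' : (0 : ℝ) < k := by exact_mod_cast hk
  simp only [norm_smul, mul_pow]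
  rw [integral_const_mul, integral_norm_sum_sq Finset.univ hX hX0 hind]
  have h1 : ∑ i, ∫ ω, ‖h (B i ω)‖ ^ 2 ∂μ ≤ k * v :=
    (Finset.sum_le_sum fun i _ => hbound i).trans_eq (by simp)
  rw [Real.norm_of_nonneg (by positivity)]
  calc (1 / (k : ℝ)) ^ 2 * ∑ i, ∫ ω, ‖h (B i ω)‖ ^ 2 ∂μ ≤ (1 / (k : ℝ)) ^ 2 * (k * v) := by gcongr
    _ = v / k := by field_simp

/-- The second moment of a constant plus two centered variables, which are independent (`κ = 1`) or
not (`κ = 2`). -/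
theorem lintegral_norm_const_add_add_sq_le (e : H) {U V : W → H} (hU : MemLp U 2 μ)
    (hV : MemLp V 2 μ) (hU0 : ∫ ω, U ω ∂μ = 0) (hV0 : ∫ ω, V ω ∂μ = 0) {u v κ : ℝ}
    (hu : ∫ ω, ‖U ω‖ ^ 2 ∂μ ≤ u) (hv : ∫ ω, ‖V ω‖ ^ 2 ∂μ ≤ v)
    (hκ : κ = 1 ∧ IndepFun U V μ ∨ κ = 2) :
    ∫⁻ ω, ‖e + (U ω + V ω)‖ₑ ^ 2 ∂μ ≤ ENNReal.ofReal (‖e‖ ^ 2 + κ * (u + v)) := by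
  have hUV : MemLp (fun ω => U ω + V ω) 2 μ := hU.add hV
  have h0 : ∫ ω, (U ω + V ω) ∂μ = 0 := by
    rw [integral_add (hU.integrable one_le_two) (hV.integrable one_le_two), hU0, hV0, add_zero]
  have heUV : MemLp (fun ω => e + (U ω + V ω)) 2 μ := (memLp_const e).add hUV
  rw [heUV.lintegral_enorm_sq, integral_norm_const_add_sq e hUV h0]
  refine ENNReal.ofReal_le_ofReal ?_
  rcases hκ with ⟨rfl, hind⟩ | rfl
  · rw [integral_norm_add_sq hU hV, integral_inner_eq_zero_of_indepFun hU hV hind hV0]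
    linarith
  · have h1 := (memLp_two_iff_integrable_sq_norm hU.1).1 hU
    have h2 := (memLp_two_iff_integrable_sq_norm hV.1).1 hV
    -- Without independence the mixed term is only bounded, by the parallelogram law; this is where
    -- κ = 2 comes from.
    have h3 : ∫ ω, ‖U ω + V ω‖ ^ 2 ∂μ ≤ ∫ ω, (2 * ‖U ω‖ ^ 2 + 2 * ‖V ω‖ ^ 2) ∂μ := by
      refine integral_mono ((memLp_two_iff_integrable_sq_norm hUV.1).1 hUV)
        ((h1.const_mul 2).add (h2.const_mul 2)) fun ω => ?_
      have := parallelogram_law_with_norm ℝ (U ω) (V ω)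
      simp only
      nlinarith [mul_self_nonneg ‖U ω - V ω‖]
    rw [integral_add (h1.const_mul 2) (h2.const_mul 2), integral_const_mul, integral_const_mul] at h3
    linarith

end Batch

end SecondMoments

/-! ### Averages over the mini-batches, conditionally on the past -/

section Decoupling

variable {W A C : Type*} [mW : MeasurableSpace W] [MeasurableSpace A] [MeasurableSpace C]
  {μ : Measure W} [IsProbabilityMeasure μ]

/-- The joint law is a product, so Tonelli allows freezing Z (the past) while averaging over Y (the
fresh batch). It takes the place of conditional expectations. -/
theorem lintegral_comp_of_indepFun {Z : W → A} {Y : W → C} (hZ : Measurable Z) (hY : Measurable Y)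
    (h : IndepFun Z Y μ) {f : A × C → ℝ≥0∞} (hf : Measurable f) :
    ∫⁻ ω, f (Z ω, Y ω) ∂μ = ∫⁻ ω', ∫⁻ ω, f (Z ω', Y ω) ∂μ ∂μ := by
  have h1 : ∫⁻ ω, f (Z ω, Y ω) ∂μ = ∫⁻ z, f z ∂(μ.map fun ω => (Z ω, Y ω)) :=
    (lintegral_map hf (hZ.prodMk hY)).symm
  have : IsProbabilityMeasure (μ.map Y) := Measure.isProbabilityMeasure_map hY.aemeasurable
  rw [h1, (indepFun_iff_map_prod_eq_prod_map_map hZ.aemeasurable hY.aemeasurable).1 h,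
    lintegral_prod _ hf.aemeasurable, lintegral_map hf.lintegral_prod_right' hZ]
  refine lintegral_congr fun ω' => ?_
  exact lintegral_map (f := fun y => f (Z ω', y)) (hf.comp measurable_prodMk_left) hY

theorem indepFun_of_indep {m₁ m₂ : MeasurableSpace W} (h : Indep m₁ m₂ μ) {Z : W → A} {Y : W → C}
    (hZ : Measurable[m₁] Z) (hY : Measurable[m₂] Y) : IndepFun Z Y μ := by
  rw [IndepFun_iff_Indep]
  exact indep_of_indep_of_le_left (indep_of_indep_of_le_right h hY.comap_le) hZ.comap_le

end Decoupling

/-! ### Mean squared errors of the plain and of the hybrid estimator -/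

section HybridEstimator

theorem measurable_sampleSigma {W Ω : Type*} [MeasurableSpace Ω] {k : ℕ} (B : Fin k → W → Ω) :
    Measurable[sampleSigma B] fun ω i => B i ω := by
  refine @measurable_pi_lambda _ _ _ (sampleSigma B) _ _ fun i => ?_
  exact (comap_measurable (B i)).mono (le_iSup (fun i => MeasurableSpace.comap (B i) _) i) le_rfl

theorem IsIIDSample.sampleSigma_le {W Ω : Type*} [mW : MeasurableSpace W] [MeasurableSpace Ω]
    {k : ℕ} {B : Fin k → W → Ω} {μ : Measure W} {law : Measure Ω} (hB : IsIIDSample B μ law) :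
    sampleSigma B ≤ mW :=
  iSup_le fun i => (hB.measurable i).comap_le

variable {W Ω H D : Type*} {𝓗 : MeasurableSpace W} [mW : MeasurableSpace W] [MeasurableSpace Ω] [MeasurableSpace D]
  [NormedAddCommGroup H] [InnerProductSpace ℝ H] [CompleteSpace H] [MeasurableSpace H]
  [BorelSpace H] [SecondCountableTopology H]
  {μ : Measure W} [IsProbabilityMeasure μ] {law : Measure Ω} [IsProbabilityMeasure law]

/-- A family of square integrable `H`-valued random variables `G(x,ξ)` with the variance bound `σ²`,
and the mean squared increments bounded by `d(x,y)`. -/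
structure IsStochasticOracle (law : Measure Ω) (G : D → Ω → H) (g : D → H) (σsq : ℝ)
    (d : D → D → ℝ) : Prop where
  measurable : Measurable fun z : D × Ω => G z.1 z.2
  measurable_mean : Measurable g
  nonneg : 0 ≤ σsq
  dist_nonneg : ∀ x y, 0 ≤ d x y
  integrable : ∀ x, Integrable (G x) law
  mean : ∀ x, ∫ ξ, G x ξ ∂law = g x
  variance : ∀ x, ∫⁻ ξ, ‖G x ξ - g x‖ₑ ^ 2 ∂law ≤ ENNReal.ofReal σsq
  increment : ∀ x y, ∫⁻ ξ, ‖G x ξ - G y ξ‖ₑ ^ 2 ∂law ≤ ENNReal.ofReal (d x y)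

namespace IsStochasticOracle

variable {G : D → Ω → H} {g : D → H} {σsq : ℝ} {d : D → D → ℝ}
  (hG : IsStochasticOracle law G g σsq d)
include hG

theorem measurable_apply (x : D) : Measurable (G x) := hG.measurable.comp measurable_prodMk_left

theorem memLp_noise (x : D) : MemLp (fun ξ => G x ξ - g x) 2 law :=
  memLp_two_of_lintegral_lt_top ((hG.measurable_apply x).sub_const _).aestronglyMeasurable
    ((hG.variance x).trans_lt ENNReal.ofReal_lt_top)

theorem integral_noise (x : D) : ∫ ξ, (G x ξ - g x) ∂law = 0 := by
  rw [integral_sub (hG.integrable x) (integrable_const _), hG.mean]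
  simp

/-- Centering a variable at its mean cannot increase its second moment, so the bound on raw
increments survives. -/
theorem lintegral_centered_increment_le (x y : D) :
    ∫⁻ ξ, ‖(G x ξ - g x) - (G y ξ - g y)‖ₑ ^ 2 ∂law ≤ ENNReal.ofReal (d x y) := by
  have h1 : MemLp (fun ξ => G x ξ - G y ξ) 2 law :=
    memLp_two_of_lintegral_lt_top
      ((hG.measurable_apply x).sub (hG.measurable_apply y)).aestronglyMeasurable
      ((hG.increment x y).trans_lt ENNReal.ofReal_lt_top)
  have h2 := lintegral_sub_integral_sq_le h1 0
  rw [integral_sub (hG.integrable x) (hG.integrable y), hG.mean, hG.mean] at h2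
  simp only [sub_zero] at h2
  refine le_trans (le_of_eq (lintegral_congr fun ξ => ?_)) (h2.trans (hG.increment x y))
  congr 2
  abel

variable {k₁ k₂ : ℕ} {B₁ : Fin k₁ → W → Ω} {B₂ : Fin k₂ → W → Ω}

/-- Mean squared error of a plain mini-batch estimator at a point depending on the past. -/
theorem lintegral_batch_error_le (h𝓗 : 𝓗 ≤ mW) (hk : 0 < k₁) (hB : IsIIDSample B₁ μ law)
    (hind : Indep 𝓗 (sampleSigma B₁) μ) {X : W → D} (hX : Measurable[𝓗] X) :
    ∫⁻ ω, ‖(1 / (k₁ : ℝ)) • ∑ i, G (X ω) (B₁ i ω) - g (X ω)‖ₑ ^ 2 ∂μ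
      ≤ ENNReal.ofReal (σsq / k₁) := by
  have hk' : (0 : ℝ) < k₁ := by exact_mod_cast hk
  have hf : Measurable fun z : D × (Fin k₁ → Ω) =>
      ‖(1 / (k₁ : ℝ)) • ∑ i, G z.1 (z.2 i) - g z.1‖ₑ ^ 2 := by
    refine (Measurable.enorm (Measurable.sub ?_ (hG.measurable_mean.comp measurable_fst))).pow_const 2
    refine (Finset.measurable_fun_sum Finset.univ fun i _ => ?_).const_smul (1 / (k₁ : ℝ))
    exact hG.measurable.comp (measurable_fst.prodMk ((measurable_pi_apply i).comp measurable_snd))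
  have hY : Measurable[sampleSigma B₁] fun ω i => B₁ i ω := measurable_sampleSigma B₁
  have hdec := lintegral_comp_of_indepFun (μ := μ) (hX.mono h𝓗 le_rfl)
    (hY.mono hB.sampleSigma_le le_rfl) (indepFun_of_indep hind hX hY) hf
  rw [hdec]
  refine (lintegral_mono (g := fun _ => ENNReal.ofReal (σsq / k₁)) fun ω' => ?_).trans_eq (by simp)
  have h1 := hB.integral_norm_avg_sq_le hk ((hG.measurable_apply (X ω')).sub_const _)
    (hG.memLp_noise (X ω')) (hG.integral_noise _) hG.nonneg (hG.variance (X ω'))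
  refine le_trans (le_of_eq ?_) (ENNReal.ofReal_le_ofReal h1)
  rw [← (hB.memLp_avg (hG.memLp_noise (X ω'))).lintegral_enorm_sq]
  refine lintegral_congr fun ω => ?_
  congr 2
  simp only [Finset.sum_sub_distrib, Finset.sum_const, Finset.card_univ, Fintype.card_fin, smul_sub,
    ← Nat.cast_smul_eq_nsmul ℝ, smul_smul]
  rw [one_div_mul_cancel hk'.ne', one_smul]

/-- Mean squared error of the hybrid estimator. -/
theorem lintegral_hybrid_error_le (h𝓗 : 𝓗 ≤ mW) (hk₁ : 0 < k₁) (hk₂ : 0 < k₂)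
    (hB₁ : IsIIDSample B₁ μ law) (hB₂ : IsIIDSample B₂ μ law)
    (hind : Indep 𝓗 (sampleSigma B₁ ⊔ sampleSigma B₂) μ)
    {κ : ℝ} (hκ : κ = 1 ∧ IndepFun (fun ω i => B₁ i ω) (fun ω i => B₂ i ω) μ ∨ κ = 2)
    {X X' : W → D} {E : W → H} (hX : Measurable[𝓗] X) (hX' : Measurable[𝓗] X')
    (hE : Measurable[𝓗] E) (β : ℝ) :
    ∫⁻ ω, ‖β • E ω + (β / (k₁ : ℝ)) • ∑ i, (G (X' ω) (B₁ i ω) - G (X ω) (B₁ i ω))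
        + ((1 - β) / (k₂ : ℝ)) • ∑ i, G (X' ω) (B₂ i ω) - g (X' ω)‖ₑ ^ 2 ∂μ
      ≤ ∫⁻ ω, ENNReal.ofReal (β ^ 2 * ‖E ω - g (X ω)‖ ^ 2
          + κ * (β ^ 2 * d (X' ω) (X ω) / k₁ + (1 - β) ^ 2 * σsq / k₂)) ∂μ := by
  have hk₁' : (0 : ℝ) < k₁ := by exact_mod_cast hk₁
  have hk₂' : (0 : ℝ) < k₂ := by exact_mod_cast hk₂
  have hf : Measurable fun z : (D × D × H) × ((Fin k₁ → Ω) × (Fin k₂ → Ω)) =>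
      ‖β • z.1.2.2 + (β / (k₁ : ℝ)) • ∑ i, (G z.1.2.1 (z.2.1 i) - G z.1.1 (z.2.1 i))
        + ((1 - β) / (k₂ : ℝ)) • ∑ i, G z.1.2.1 (z.2.2 i) - g z.1.2.1‖ₑ ^ 2 := by
    have hx : Measurable fun z : (D × D × H) × ((Fin k₁ → Ω) × (Fin k₂ → Ω)) => z.1.1 := by fun_prop
    have hx' : Measurable fun z : (D × D × H) × ((Fin k₁ → Ω) × (Fin k₂ → Ω)) => z.1.2.1 := by
      fun_prop
    have he : Measurable fun z : (D × D × H) × ((Fin k₁ → Ω) × (Fin k₂ → Ω)) => z.1.2.2 := by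
      fun_prop
    have hb₁ : ∀ i, Measurable fun z : (D × D × H) × ((Fin k₁ → Ω) × (Fin k₂ → Ω)) => z.2.1 i :=
      fun i => by fun_prop
    have hb₂ : ∀ i, Measurable fun z : (D × D × H) × ((Fin k₁ → Ω) × (Fin k₂ → Ω)) => z.2.2 i :=
      fun i => by fun_prop
    refine (Measurable.enorm (Measurable.sub (Measurable.add (Measurable.add (he.const_smul β) ?_) ?_)
      (hG.measurable_mean.comp hx'))).pow_const 2
    · exact (Finset.measurable_fun_sum Finset.univ fun i _ =>
        (hG.measurable.comp (hx'.prodMk (hb₁ i))).sub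
          (hG.measurable.comp (hx.prodMk (hb₁ i)))).const_smul (β / (k₁ : ℝ))
    · exact (Finset.measurable_fun_sum Finset.univ fun i _ =>
        hG.measurable.comp (hx'.prodMk (hb₂ i))).const_smul ((1 - β) / (k₂ : ℝ))
  have hY₁ : Measurable[sampleSigma B₁] fun ω i => B₁ i ω := measurable_sampleSigma B₁
  have hY₂ : Measurable[sampleSigma B₂] fun ω i => B₂ i ω := measurable_sampleSigma B₂
  have hY : Measurable[sampleSigma B₁ ⊔ sampleSigma B₂]
      fun ω => ((fun i => B₁ i ω), (fun i => B₂ i ω)) :=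
    (hY₁.mono le_sup_left le_rfl).prodMk (hY₂.mono le_sup_right le_rfl)
  have hZ : Measurable[𝓗] fun ω => (X ω, X' ω, E ω) := hX.prodMk (hX'.prodMk hE)
  -- From here the two points and the old estimate are frozen, and only the two batches are random.
  have hdec := lintegral_comp_of_indepFun (μ := μ) (hZ.mono h𝓗 le_rfl)
    (hY.mono (sup_le hB₁.sampleSigma_le hB₂.sampleSigma_le) le_rfl) (indepFun_of_indep hind hZ hY) hf
  rw [hdec]
  refine lintegral_mono fun ω' => ?_
  simp only
  set x := X ω'
  set x' := X' ω'
  set e := E ω'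
  -- The new error is β(e - g x) plus the batch averages of h₁ and h₂, both of mean zero: the
  -- deterministic parts β(g x' - g x) and (1-β) g x' cancel against g x'.
  set h₁ : Ω → H := fun ξ => β • ((G x' ξ - g x') - (G x ξ - g x)) with hh₁
  set h₂ : Ω → H := fun ξ => (1 - β) • (G x' ξ - g x') with hh₂
  have m₁ : Measurable h₁ := (((hG.measurable_apply x').sub_const _).sub
    ((hG.measurable_apply x).sub_const _)).const_smul β
  have m₂ : Measurable h₂ := ((hG.measurable_apply x').sub_const _).const_smul (1 - β)
  have l₁ : MemLp h₁ 2 law := ((hG.memLp_noise x').sub (hG.memLp_noise x)).const_smul β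
  have l₂ : MemLp h₂ 2 law := (hG.memLp_noise x').const_smul (1 - β)
  have z₁ : ∫ ξ, h₁ ξ ∂law = 0 := by
    rw [hh₁, integral_smul, integral_sub ((hG.memLp_noise x').integrable one_le_two)
      ((hG.memLp_noise x).integrable one_le_two), hG.integral_noise, hG.integral_noise]
    simp
  have z₂ : ∫ ξ, h₂ ξ ∂law = 0 := by
    rw [hh₂, integral_smul, hG.integral_noise, smul_zero]
  have scale : ∀ (a : ℝ) (r : ℝ) (f : Ω → H), Measurable f →
      ∫⁻ ξ, ‖f ξ‖ₑ ^ 2 ∂law ≤ ENNReal.ofReal r →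
      ∫⁻ ξ, ‖a • f ξ‖ₑ ^ 2 ∂law ≤ ENNReal.ofReal (a ^ 2 * r) := fun a r f hfm hr => by
    simp only [enorm_smul, mul_pow]
    rw [lintegral_const_mul _ (hfm.enorm.pow_const 2), ENNReal.ofReal_mul (sq_nonneg a),
      ← ofReal_norm_sq a, Real.norm_eq_abs, sq_abs]
    gcongr
  have v₁ := scale β _ _ (((hG.measurable_apply x').sub_const _).sub
    ((hG.measurable_apply x).sub_const _)) (hG.lintegral_centered_increment_le x' x)
  have v₂ := scale (1 - β) _ _ ((hG.measurable_apply x').sub_const _) (hG.variance x')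
  have u₁ := hB₁.integral_norm_avg_sq_le hk₁ m₁ l₁ z₁
    (mul_nonneg (sq_nonneg β) (hG.dist_nonneg x' x)) v₁
  have u₂ := hB₂.integral_norm_avg_sq_le hk₂ m₂ l₂ z₂
    (mul_nonneg (sq_nonneg (1 - β)) hG.nonneg) v₂
  have hUV : κ = 1 ∧ IndepFun (fun ω => (1 / (k₁ : ℝ)) • ∑ i, h₁ (B₁ i ω))
      (fun ω => (1 / (k₂ : ℝ)) • ∑ i, h₂ (B₂ i ω)) μ ∨ κ = 2 := by
    refine hκ.imp (fun h => ⟨h.1, ?_⟩) id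
    refine h.2.comp (φ := fun b : Fin k₁ → Ω => (1 / (k₁ : ℝ)) • ∑ i, h₁ (b i))
      (ψ := fun b : Fin k₂ → Ω => (1 / (k₂ : ℝ)) • ∑ i, h₂ (b i)) ?_ ?_
    · exact (Finset.measurable_fun_sum Finset.univ fun i _ =>
        m₁.comp (measurable_pi_apply i)).const_smul (1 / (k₁ : ℝ))
    · exact (Finset.measurable_fun_sum Finset.univ fun i _ =>
        m₂.comp (measurable_pi_apply i)).const_smul (1 / (k₂ : ℝ))
  have key := lintegral_norm_const_add_add_sq_le (β • (e - g x)) (hB₁.memLp_avg l₁)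
    (hB₂.memLp_avg l₂) (hB₁.integral_avg l₁ z₁) (hB₂.integral_avg l₂ z₂) u₁ u₂ hUV
  rw [norm_smul, mul_pow, Real.norm_eq_abs, sq_abs] at key
  refine le_trans (le_of_eq (lintegral_congr fun ω => ?_)) key
  congr 2
  simp only [hh₁, hh₂, ← Finset.smul_sum, Finset.sum_sub_distrib, Finset.sum_const,
    Finset.card_univ, Fintype.card_fin, ← Nat.cast_smul_eq_nsmul ℝ]
  match_scalars <;> field_simp <;> ring

end IsStochasticOracle

end HybridEstimator

/-! ### The Frobenius norm as a Euclidean norm of columns -/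

section Frobenius

variable {p q : ℕ}

/-- The columns of a matrix, given as a linear map. -/
noncomputable def columns (p q : ℕ) :
    (Vec p →L[ℝ] Vec q) →L[ℝ] PiLp 2 (fun _ : Fin p => Vec q) :=
  ((PiLp.continuousLinearEquiv 2 ℝ (fun _ : Fin p => Vec q)).symm :
      (Fin p → Vec q) →L[ℝ] PiLp 2 (fun _ : Fin p => Vec q)).comp
    (ContinuousLinearMap.pi fun j =>
      ContinuousLinearMap.apply ℝ (Vec q) (EuclideanSpace.single j (1 : ℝ)))

/-- The operator norm is not Hilbertian in general; passing to columns puts Jacobians into a Hilbert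
space, where the second moment lemmas apply. -/
theorem frobSq_eq (A : Vec p →L[ℝ] Vec q) : frobSq A = ‖columns p q A‖ ^ 2 := by
  rw [PiLp.norm_sq_eq_of_L2]
  rfl

theorem ofReal_frobSq (A : Vec p →L[ℝ] Vec q) :
    ENNReal.ofReal (frobSq A) = ‖columns p q A‖ₑ ^ 2 := by
  rw [frobSq_eq, ofReal_norm_sq]

/-- Cauchy–Schwarz over the columns. -/
theorem opNorm_le_norm_columns (A : Vec p →L[ℝ] Vec q) : ‖A‖ ≤ ‖columns p q A‖ := by
  refine A.opNorm_le_bound (norm_nonneg _) fun v => ?_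
  have h1 : A v = ∑ j, v j • A (EuclideanSpace.single j (1 : ℝ)) := by
    conv_lhs => rw [← (EuclideanSpace.basisFun (Fin p) ℝ).sum_repr v]
    simp
  have h2 : ‖A v‖ ^ 2 ≤ (‖columns p q A‖ * ‖v‖) ^ 2 := by
    have h3 : ‖A v‖ ≤ ∑ j, ‖A (EuclideanSpace.single j (1 : ℝ))‖ * ‖v j‖ := by
      rw [h1]
      refine (norm_sum_le _ _).trans (Finset.sum_le_sum fun j _ => ?_)
      rw [norm_smul, mul_comm]
    calc ‖A v‖ ^ 2 ≤ (∑ j, ‖A (EuclideanSpace.single j (1 : ℝ))‖ * ‖v j‖) ^ 2 := by gcongr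
      _ ≤ (∑ j, ‖A (EuclideanSpace.single j (1 : ℝ))‖ ^ 2) * ∑ j, ‖v j‖ ^ 2 :=
          Finset.sum_mul_sq_le_sq_mul_sq _ _ _
      _ = _ := by rw [mul_pow, ← frobSq_eq, EuclideanSpace.norm_sq_eq v]; rfl
  exact le_of_sq_le_sq h2 (by positivity)

theorem opENorm_le_enorm_columns (A : Vec p →L[ℝ] Vec q) : ‖A‖ₑ ≤ ‖columns p q A‖ₑ := by
  rw [← ofReal_norm, ← ofReal_norm]
  exact ENNReal.ofReal_le_ofReal (opNorm_le_norm_columns A)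

end Frobenius

/-- The mean value inequality for a function that is differentiable on `[0,1]`, its derivative
being only measurable. -/
theorem enorm_sub_le_lintegral_of_hasDerivAt {E : Type*} [NormedAddCommGroup E] [NormedSpace ℝ E]
    [CompleteSpace E] {f f' : ℝ → E} (h : ∀ t ∈ Set.Icc (0 : ℝ) 1, HasDerivAt f (f' t) t)
    (hm : AEStronglyMeasurable f' (volume.restrict (Set.Icc 0 1))) :
    ‖f 1 - f 0‖ₑ ≤ ∫⁻ t in Set.Icc (0 : ℝ) 1, ‖f' t‖ₑ := by
  -- An infinite right side needs no proof; a finite one makes f' integrable, which the fundamental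
  -- theorem of calculus requires.
  by_cases hfin : ∫⁻ t in Set.Icc (0 : ℝ) 1, ‖f' t‖ₑ = ⊤
  · rw [hfin]; exact le_top
  have hint : IntegrableOn f' (Set.Icc 0 1) := ⟨hm, lt_top_iff_ne_top.2 hfin⟩
  have hint' : IntervalIntegrable f' volume 0 1 :=
    (intervalIntegrable_iff_integrableOn_Icc_of_le zero_le_one).2 hint
  have h1 := intervalIntegral.integral_eq_sub_of_hasDerivAt
    (fun t ht => h t (by rwa [Set.uIcc_of_le zero_le_one] at ht)) hint'
  rw [← h1, intervalIntegral.integral_of_le zero_le_one, ← integral_Icc_eq_integral_Ioc]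
  exact enorm_integral_le_lintegral_enorm _

/-! ### The mean Jacobian -/

namespace MinimaxProblem

variable {p q n : ℕ} {Ω : Type*} [MeasurableSpace Ω] {M : MinimaxProblem p q n Ω}

/-- The mean `E_ξ[𝐅'(x,ξ)]`. It agrees with `F'(x)` along the directions of the domain only. -/
noncomputable def meanJ (M : MinimaxProblem p q n Ω) (x : Vec p) : Vec p →L[ℝ] Vec q :=
  ∫ ξ, M.stochJ x ξ ∂M.law

/-- The gradient of `Φ₀`, with the mean Jacobian. -/
noncomputable def meanGrad (M : MinimaxProblem p q n Ω) (x : Vec p) : Vec p :=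
  ContinuousLinearMap.adjoint (M.meanJ x) (M.K (M.yStar (M.F x)))

/-- The point of the segment `[x,y]` with parameter `t`, clamped to `[0,1]`. -/
noncomputable def segPoint (x y : Vec p) (t : ℝ) : Vec p :=
  (1 - max 0 (min t 1)) • x + max 0 (min t 1) • y

theorem segPoint_eq {x y : Vec p} {t : ℝ} (ht : t ∈ Set.Icc (0 : ℝ) 1) :
    segPoint x y t = x + t • (y - x) := by
  rw [segPoint, min_eq_left ht.2, max_eq_right ht.1]
  module

theorem continuous_segPoint (x y : Vec p) : Continuous (segPoint x y) := by
  unfold segPoint; fun_prop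

end MinimaxProblem

namespace StandingAssumption

open MinimaxProblem

variable {p q n : ℕ} {Ω : Type*} [MeasurableSpace Ω] {M : MinimaxProblem p q n Ω} {c : Constants}

theorem segPoint_mem (hM : StandingAssumption M) (hψ : ProperClosedConvex M.psi)
    (hsc : EStronglyConvex 1 M.psi) {x y : Vec p} (hx : x ∈ M.domPsi0) (hy : y ∈ M.domPsi0)
    (t : ℝ) : segPoint x y t ∈ M.domPsi0 :=
  hM.segment_mem hψ hsc hx hy (le_max_left _ _) (max_le zero_le_one (min_le_right _ _))

theorem measurable_stochF_apply (hM : StandingAssumption M) {x : Vec p} (hx : x ∈ M.domPsi0) :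
    Measurable (M.stochF x) :=
  hM.measurable_F.comp (measurable_prodMk_left (x := (⟨x, hx⟩ : M.domPsi0)))

theorem measurable_stochJ_apply (hM : StandingAssumption M) {x : Vec p} (hx : x ∈ M.domPsi0) :
    Measurable (M.stochJ x) :=
  hM.measurable_J.comp (measurable_prodMk_left (x := (⟨x, hx⟩ : M.domPsi0)))

/-- Joint measurability is assumed on the domain only. The clamped parameter keeps the point in the
domain for every real t. -/
theorem measurable_stochJ_segPoint (hM : StandingAssumption M) (hψ : ProperClosedConvex M.psi)
    (hsc : EStronglyConvex 1 M.psi) {x y : Vec p} (hx : x ∈ M.domPsi0) (hy : y ∈ M.domPsi0) :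
    Measurable fun z : ℝ × Ω => M.stochJ (segPoint x y z.1) z.2 := by
  have h : Measurable fun t : ℝ => (⟨segPoint x y t, hM.segPoint_mem hψ hsc hx hy t⟩ : M.domPsi0) :=
    (continuous_segPoint x y).measurable.subtype_mk
  exact hM.measurable_J.comp ((h.comp measurable_fst).prodMk measurable_snd)

/-- Mean value inequality along a segment, for one realization. -/
theorem enorm_stochF_sub_le (hM : StandingAssumption M) (hψ : ProperClosedConvex M.psi)
    (hsc : EStronglyConvex 1 M.psi) {x y : Vec p} (hx : x ∈ M.domPsi0) (hy : y ∈ M.domPsi0)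
    (ξ : Ω) (A : Vec p →L[ℝ] Vec q) :
    ‖M.stochF y ξ - M.stochF x ξ - A (y - x)‖ₑ
      ≤ (∫⁻ t in Set.Icc (0 : ℝ) 1, ‖M.stochJ (segPoint x y t) ξ - A‖ₑ) * ‖y - x‖ₑ := by
  have hmJ : Measurable fun t : ℝ => M.stochJ (segPoint x y t) ξ :=
    (hM.measurable_stochJ_segPoint hψ hsc hx hy).comp (measurable_id.prodMk measurable_const)
  -- The linear map A is free: A = 0 serves the Lipschitz bound, A = 𝐅'(x,ξ) the first-order
  -- expansion.
  have hder : ∀ t ∈ Set.Icc (0 : ℝ) 1,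
      HasDerivAt (fun s : ℝ => M.stochF (x + s • (y - x)) ξ - A (s • (y - x)))
        ((M.stochJ (segPoint x y t) ξ - A) (y - x)) t := fun t ht => by
    have h1 : HasDerivAt (fun s : ℝ => s • (y - x)) (y - x) t := by
      simpa using (hasDerivAt_id t).smul_const (y - x)
    have h2 : HasFDerivAt (fun z => M.stochF z ξ) (M.stochJ (x + t • (y - x)) ξ)
        (x + t • (y - x)) := by
      rw [← segPoint_eq ht]
      exact (hM.differentiable_stochF ξ _ (hM.segPoint_mem hψ hsc hx hy t)).hasFDerivAt
    have h3 := (h2.comp_hasDerivAt t (h1.const_add x)).sub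
      (A.hasFDerivAt.comp_hasDerivAt t h1)
    rw [segPoint_eq ht, sub_apply]
    exact h3
  have h := enorm_sub_le_lintegral_of_hasDerivAt hder
    (((hmJ.sub_const A).aestronglyMeasurable.restrict).apply_continuousLinearMap (y - x))
  simp only [one_smul, zero_smul, add_zero, map_zero, sub_zero, add_sub_cancel] at h
  rw [sub_right_comm]
  refine h.trans ?_
  rw [← lintegral_mul_const _ (hmJ.sub_const A).enorm]
  exact lintegral_mono fun t => ContinuousLinearMap.le_opENorm _ _

theorem memLp_stochJ (hM : StandingAssumption M) (hF : AssumptionF M c) {x : Vec p}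
    (hx : x ∈ M.domPsi0) : MemLp (M.stochJ x) 2 M.law := by
  refine memLp_two_of_lintegral_lt_top (hM.measurable_stochJ_apply hx).aestronglyMeasurable ?_
  refine lt_of_le_of_lt (lintegral_mono fun ξ => ?_)
    ((hF.lipschitz x hx).trans_lt ENNReal.ofReal_lt_top)
  rw [ofReal_frobSq]
  gcongr
  exact opENorm_le_enorm_columns _

theorem lintegral_opENorm_sq_le (hF : AssumptionF M c) {x : Vec p} (hx : x ∈ M.domPsi0) :
    ∫⁻ ξ, ‖M.stochJ x ξ‖ₑ ^ 2 ∂M.law ≤ ENNReal.ofReal (c.MF ^ 2) := by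
  refine le_trans (lintegral_mono fun ξ => ?_) (hF.lipschitz x hx)
  rw [ofReal_frobSq]
  gcongr
  exact opENorm_le_enorm_columns _

/-- Average Lipschitz continuity of `𝐅`. -/
theorem lintegral_stochF_sub_sq_le (hM : StandingAssumption M) (hF : AssumptionF M c)
    (hψ : ProperClosedConvex M.psi) (hsc : EStronglyConvex 1 M.psi) {x y : Vec p}
    (hx : x ∈ M.domPsi0) (hy : y ∈ M.domPsi0) :
    ∫⁻ ξ, ‖M.stochF y ξ - M.stochF x ξ‖ₑ ^ 2 ∂M.law
      ≤ ENNReal.ofReal (c.MF ^ 2 * ‖y - x‖ ^ 2) := by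
  have := hM.prob
  have hmJ := hM.measurable_stochJ_segPoint hψ hsc hx hy
  have hpr : IsProbabilityMeasure (volume.restrict (Set.Icc (0 : ℝ) 1)) := ⟨by simp⟩
  have h1 : ∀ ξ, ‖M.stochF y ξ - M.stochF x ξ‖ₑ ^ 2
      ≤ (∫⁻ t in Set.Icc (0 : ℝ) 1, ‖M.stochJ (segPoint x y t) ξ‖ₑ ^ 2) * ‖y - x‖ₑ ^ 2 := fun ξ => by
    have h2 := hM.enorm_stochF_sub_le hψ hsc hx hy ξ 0
    simp only [zero_apply, sub_zero] at h2
    have hm : Measurable fun t : ℝ => ‖M.stochJ (segPoint x y t) ξ‖ₑ :=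
      (hmJ.comp (measurable_id.prodMk measurable_const)).enorm
    calc _ ≤ ((∫⁻ t in Set.Icc (0 : ℝ) 1, ‖M.stochJ (segPoint x y t) ξ‖ₑ) * ‖y - x‖ₑ) ^ 2 := by
          gcongr
      _ ≤ _ := by
          rw [mul_pow]
          gcongr
          exact sq_lintegral_le hm.aemeasurable
  refine (lintegral_mono h1).trans ?_
  have hm2 : Measurable fun z : ℝ × Ω => ‖M.stochJ (segPoint x y z.1) z.2‖ₑ ^ 2 :=
    hmJ.enorm.pow_const 2
  have hm3 : Measurable fun ξ => ∫⁻ t in Set.Icc (0 : ℝ) 1, ‖M.stochJ (segPoint x y t) ξ‖ₑ ^ 2 :=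
    Measurable.lintegral_prod_left' hm2
  -- After the exchange of integrals the mean over ξ is taken first, at a fixed point of the
  -- segment, where the bound M_F² holds.
  rw [lintegral_mul_const _ hm3, ENNReal.ofReal_mul (sq_nonneg _), ofReal_norm_sq,
    lintegral_lintegral_swap (μ := M.law) (ν := volume.restrict (Set.Icc (0 : ℝ) 1))
      (f := fun ξ t => ‖M.stochJ (segPoint x y t) ξ‖ₑ ^ 2) (hm2.comp measurable_swap).aemeasurable]
  gcongr
  refine (lintegral_mono (g := fun _ => ENNReal.ofReal (c.MF ^ 2)) fun t =>
    lintegral_opENorm_sq_le hF (hM.segPoint_mem hψ hsc hx hy t)).trans_eq ?_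
  simp

theorem lintegral_stochJ_sub_le (hM : StandingAssumption M) (hF : AssumptionF M c) {x y : Vec p}
    (hx : x ∈ M.domPsi0) (hy : y ∈ M.domPsi0) :
    ∫⁻ ξ, ‖M.stochJ x ξ - M.stochJ y ξ‖ₑ ∂M.law ≤ ENNReal.ofReal (c.LF * ‖x - y‖) := by
  have := hM.prob
  have hm : Measurable fun ξ => ‖M.stochJ x ξ - M.stochJ y ξ‖ₑ :=
    ((hM.measurable_stochJ_apply hx).sub (hM.measurable_stochJ_apply hy)).enorm
  have h1 := sq_lintegral_le (μ := M.law) hm.aemeasurable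
  have h2 : (∫⁻ ξ, ‖M.stochJ x ξ - M.stochJ y ξ‖ₑ ∂M.law) ^ 2
      ≤ ENNReal.ofReal (c.LF * ‖x - y‖) ^ 2 := by
    rw [← ENNReal.ofReal_pow (mul_nonneg hF.LF_pos.le (norm_nonneg _)), mul_pow]
    refine h1.trans (le_trans (lintegral_mono fun ξ => ?_) (hF.smooth x hx y hy))
    rw [ofReal_frobSq]
    gcongr
    exact opENorm_le_enorm_columns _
  exact (ENNReal.pow_le_pow_left_iff two_ne_zero).1 h2

theorem norm_meanJ_le (hM : StandingAssumption M) (hF : AssumptionF M c) {x : Vec p}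
    (hx : x ∈ M.domPsi0) : ‖M.meanJ x‖ ≤ c.MF := by
  have := hM.prob
  have h1 : ‖M.meanJ x‖ₑ ^ 2 ≤ ENNReal.ofReal c.MF ^ 2 := by
    rw [← ENNReal.ofReal_pow hF.MF_pos.le]
    refine le_trans ?_ (lintegral_opENorm_sq_le hF hx)
    refine le_trans ?_ (sq_lintegral_le (hM.measurable_stochJ_apply hx).enorm.aemeasurable)
    gcongr
    exact enorm_integral_le_lintegral_enorm _
  have h2 := (ENNReal.pow_le_pow_left_iff two_ne_zero).1 h1
  rw [← ofReal_norm] at h2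
  exact (ENNReal.ofReal_le_ofReal_iff hF.MF_pos.le).1 h2

theorem norm_meanJ_sub_le (hM : StandingAssumption M) (hF : AssumptionF M c) {x y : Vec p}
    (hx : x ∈ M.domPsi0) (hy : y ∈ M.domPsi0) :
    ‖M.meanJ x - M.meanJ y‖ ≤ c.LF * ‖x - y‖ := by
  have := hM.prob
  rw [meanJ, meanJ, ← integral_sub ((hM.memLp_stochJ hF hx).integrable one_le_two)
    ((hM.memLp_stochJ hF hy).integrable one_le_two)]
  have h := (enorm_integral_le_lintegral_enorm (μ := M.law)
    (fun ξ => M.stochJ x ξ - M.stochJ y ξ)).trans (hM.lintegral_stochJ_sub_le hF hx hy)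
  rw [← ofReal_norm] at h
  exact (ENNReal.ofReal_le_ofReal_iff (mul_nonneg hF.LF_pos.le (norm_nonneg _))).1 h

theorem norm_F_sub_le (hM : StandingAssumption M) (hF : AssumptionF M c)
    (hψ : ProperClosedConvex M.psi) (hsc : EStronglyConvex 1 M.psi) {x y : Vec p}
    (hx : x ∈ M.domPsi0) (hy : y ∈ M.domPsi0) : ‖M.F y - M.F x‖ ≤ c.MF * ‖y - x‖ := by
  have := hM.prob
  have hm : Measurable fun ξ => ‖M.stochF y ξ - M.stochF x ξ‖ₑ :=
    ((hM.measurable_stochF_apply hy).sub (hM.measurable_stochF_apply hx)).enorm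
  have h1 : ‖M.F y - M.F x‖ₑ ^ 2 ≤ ENNReal.ofReal (c.MF * ‖y - x‖) ^ 2 := by
    rw [← ENNReal.ofReal_pow (mul_nonneg hF.MF_pos.le (norm_nonneg _)), mul_pow]
    refine le_trans ?_ (hM.lintegral_stochF_sub_sq_le hF hψ hsc hx hy)
    refine le_trans ?_ (sq_lintegral_le hm.aemeasurable)
    rw [F, F, ← integral_sub (hM.integrable y) (hM.integrable x)]
    gcongr
    exact enorm_integral_le_lintegral_enorm _
  have h2 := (ENNReal.pow_le_pow_left_iff two_ne_zero).1 h1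
  rw [← ofReal_norm] at h2
  exact (ENNReal.ofReal_le_ofReal_iff (mul_nonneg hF.MF_pos.le (norm_nonneg _))).1 h2

/-- First order expansion of `F` with the mean Jacobian. -/
theorem norm_F_sub_sub_meanJ_le (hM : StandingAssumption M) (hF : AssumptionF M c)
    (hψ : ProperClosedConvex M.psi) (hsc : EStronglyConvex 1 M.psi) {x y : Vec p}
    (hx : x ∈ M.domPsi0) (hy : y ∈ M.domPsi0) :
    ‖M.F y - M.F x - M.meanJ x (y - x)‖ ≤ c.LF / 2 * ‖y - x‖ ^ 2 := by
  have := hM.prob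
  have hJ := (hM.memLp_stochJ hF hx).integrable one_le_two
  have hmJ := hM.measurable_stochJ_segPoint hψ hsc hx hy
  have hmd : Measurable fun z : ℝ × Ω => ‖M.stochJ (segPoint x y z.1) z.2 - M.stochJ x z.2‖ₑ :=
    (hmJ.sub ((hM.measurable_stochJ_apply hx).comp measurable_snd)).enorm
  have e1 : M.F y - M.F x - M.meanJ x (y - x)
      = ∫ ξ, (M.stochF y ξ - M.stochF x ξ - M.stochJ x ξ (y - x)) ∂M.law := by
    have e2 := integral_sub ((hM.integrable y).sub (hM.integrable x)) (hJ.apply_continuousLinearMap (y - x))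
    simp only [Pi.sub_apply] at e2
    rw [e2, integral_sub (hM.integrable y) (hM.integrable x),
      ← ContinuousLinearMap.integral_apply hJ]
    rfl
  have h0 : 0 ≤ c.LF / 2 * ‖y - x‖ ^ 2 := mul_nonneg (by linarith [hF.LF_pos]) (sq_nonneg _)
  have h1 : ‖M.F y - M.F x - M.meanJ x (y - x)‖ₑ ≤ ENNReal.ofReal (c.LF / 2 * ‖y - x‖ ^ 2) := by
    rw [e1]
    refine (enorm_integral_le_lintegral_enorm _).trans ?_
    refine (lintegral_mono fun ξ =>
      hM.enorm_stochF_sub_le hψ hsc hx hy ξ (M.stochJ x ξ)).trans ?_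
    have hm3 : Measurable fun ξ =>
        ∫⁻ t in Set.Icc (0 : ℝ) 1, ‖M.stochJ (segPoint x y t) ξ - M.stochJ x ξ‖ₑ :=
      Measurable.lintegral_prod_left' hmd
    rw [lintegral_mul_const _ hm3,
      lintegral_lintegral_swap (μ := M.law) (ν := volume.restrict (Set.Icc (0 : ℝ) 1))
        (f := fun ξ t => ‖M.stochJ (segPoint x y t) ξ - M.stochJ x ξ‖ₑ)
        (hmd.comp measurable_swap).aemeasurable]
    have h2 : ∫⁻ t in Set.Icc (0 : ℝ) 1, ∫⁻ ξ, ‖M.stochJ (segPoint x y t) ξ - M.stochJ x ξ‖ₑ ∂M.law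
        ≤ ∫⁻ t in Set.Icc (0 : ℝ) 1, ENNReal.ofReal (c.LF * ‖y - x‖ * t) := by
      refine setLIntegral_mono' measurableSet_Icc fun t ht => ?_
      refine (hM.lintegral_stochJ_sub_le hF (hM.segPoint_mem hψ hsc hx hy t) hx).trans_eq ?_
      rw [segPoint_eq ht, add_sub_cancel_left, norm_smul, Real.norm_of_nonneg ht.1]
      congr 1
      ring
    -- The factor 1/2 of the expansion is the integral of t over [0,1].
    have h3 : ∫⁻ t in Set.Icc (0 : ℝ) 1, ENNReal.ofReal (c.LF * ‖y - x‖ * t)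
        = ENNReal.ofReal (c.LF / 2 * ‖y - x‖) := by
      rw [← ofReal_integral_eq_lintegral_ofReal, integral_Icc_eq_integral_Ioc,
        ← intervalIntegral.integral_of_le zero_le_one, intervalIntegral.integral_const_mul,
        integral_id]
      · congr 1; ring
      · exact (Continuous.integrableOn_Icc (by fun_prop))
      · filter_upwards [ae_restrict_mem measurableSet_Icc] with t ht
        exact mul_nonneg (mul_nonneg hF.LF_pos.le (norm_nonneg _)) ht.1
    calc _ ≤ ENNReal.ofReal (c.LF / 2 * ‖y - x‖) * ‖y - x‖ₑ := by
          gcongr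
          exact h2.trans_eq h3
      _ = _ := by
          rw [← ofReal_norm, ← ENNReal.ofReal_mul
            (mul_nonneg (by linarith [hF.LF_pos]) (norm_nonneg _))]
          congr 1
          ring
  rw [← ofReal_norm] at h1
  exact (ENNReal.ofReal_le_ofReal_iff h0).1 h1

/-- The Jacobian of the mean is the mean Jacobian, along the directions of the domain. -/
theorem J_apply_eq_meanJ_apply (hM : StandingAssumption M) (hF : AssumptionF M c)
    (hψ : ProperClosedConvex M.psi) (hsc : EStronglyConvex 1 M.psi) {x y : Vec p}
    (hx : x ∈ M.domPsi0) (hy : y ∈ M.domPsi0) : M.J x (y - x) = M.meanJ x (y - x) := by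
  have h1 : Filter.Tendsto (fun t : ℝ => t⁻¹ • (M.F (x + t • (y - x)) - M.F x))
      (nhdsWithin 0 (Set.Ioi 0)) (nhds (M.J x (y - x))) :=
    ((hM.differentiable_F x hx).hasFDerivAt.hasLineDerivAt (y - x)).tendsto_slope_zero_right
  -- Along the segment, which stays in the domain, the expansion with the mean Jacobian leaves an
  -- error of order t in the difference quotient. The two limits must coincide.
  have h2 : Filter.Tendsto (fun t : ℝ => t⁻¹ • (M.F (x + t • (y - x)) - M.F x))
      (nhdsWithin 0 (Set.Ioi 0)) (nhds (M.meanJ x (y - x))) := by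
    rw [tendsto_iff_norm_sub_tendsto_zero]
    have h3 : Filter.Tendsto (fun t : ℝ => t * (c.LF / 2 * ‖y - x‖ ^ 2))
        (nhdsWithin 0 (Set.Ioi 0)) (nhds 0) := by
      have : Filter.Tendsto (fun t : ℝ => t * (c.LF / 2 * ‖y - x‖ ^ 2)) (nhds 0)
          (nhds (0 * (c.LF / 2 * ‖y - x‖ ^ 2))) := Continuous.tendsto (by fun_prop) 0
      rw [zero_mul] at this
      exact this.mono_left nhdsWithin_le_nhds
    refine squeeze_zero' (Filter.Eventually.of_forall fun _ => norm_nonneg _) ?_ h3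
    filter_upwards [Ioc_mem_nhdsGT (zero_lt_one' ℝ)] with t ht
    have hz := hM.segPoint_mem hψ hsc hx hy t
    rw [segPoint_eq ⟨ht.1.le, ht.2⟩] at hz
    have h4 := hM.norm_F_sub_sub_meanJ_le hF hψ hsc hx hz
    rw [add_sub_cancel_left, map_smul, norm_smul, Real.norm_of_nonneg ht.1.le] at h4
    have h5 : t⁻¹ • (M.F (x + t • (y - x)) - M.F x) - M.meanJ x (y - x)
        = t⁻¹ • (M.F (x + t • (y - x)) - M.F x - t • M.meanJ x (y - x)) := by
      rw [smul_sub _ _ (t • _), smul_smul, inv_mul_cancel₀ ht.1.ne', one_smul]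
    rw [h5, norm_smul, Real.norm_of_nonneg (by have := ht.1; positivity), inv_mul_le_iff₀ ht.1]
    refine h4.trans_eq ?_
    ring
  exact tendsto_nhds_unique h1 h2

/-- The gradient mapping can be computed with the mean Jacobian. -/
theorem gradMap_eq (hM : StandingAssumption M) (hF : AssumptionF M c)
    (hψ : ProperClosedConvex M.psi) (hsc : EStronglyConvex 1 M.psi) {η : ℝ} (hη : 0 < η) {x : Vec p}
    (hx : x ∈ M.domPsi0) :
    M.gradMap η x = η⁻¹ • (x - prox M.R η (x - η • M.meanGrad x)) := by
  unfold gradMap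
  rw [hM.gradient_Phi0 hψ hsc hx, hM.R_pcc.prox_congr hη (z' := x - η • M.meanGrad x)]
  -- The two candidate gradients differ by a vector orthogonal to every difference of domain points,
  -- since both Jacobians agree on w - x and w' - x.
  intro w w' hw hw'
  rw [← hM.mem_domPsi0 hψ hsc] at hw hw'
  have h1 := hM.J_apply_eq_meanJ_apply hF hψ hsc hx hw
  have h2 := hM.J_apply_eq_meanJ_apply hF hψ hsc hx hw'
  have h3 : M.J x (w - w') = M.meanJ x (w - w') := by
    rw [← sub_sub_sub_cancel_right w w' x, map_sub (M.J x), map_sub (M.meanJ x), h1, h2]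
  rw [sub_sub_sub_cancel_left, ← smul_sub, inner_smul_left, meanGrad, inner_sub_left,
    ContinuousLinearMap.adjoint_inner_left, ContinuousLinearMap.adjoint_inner_left, h3, sub_self,
    mul_zero]

/-- The descent inequality for `Φ₀`. -/
theorem Phi0_le (hM : StandingAssumption M) (hF : AssumptionF M c) (hpsi : AssumptionPsi M c)
    (hsc : EStronglyConvex 1 M.psi) {x y : Vec p} (hx : x ∈ M.domPsi0) (hy : y ∈ M.domPsi0) :
    M.Phi0 y ≤ M.Phi0 x + inner ℝ (M.meanGrad x) (y - x) + constL c ‖M.K‖ / 2 * ‖y - x‖ ^ 2 := by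
  have hψ := hpsi.psi_pcc
  have h1 := phi0_toReal_le hψ hsc (M.F x) (M.F y)
  have h2 := hM.norm_F_sub_sub_meanJ_le hF hψ hsc hx hy
  have h3 := hM.norm_F_sub_le hF hψ hsc hx hy
  set k := M.K (M.yStar (M.F x)) with hk
  have hkn : ‖k‖ ≤ ‖M.K‖ * c.Mpsi :=
    (M.K.le_opNorm _).trans (by gcongr; exact hpsi.bounded _ (psi_yStar_ne_top hψ hsc _))
  -- The linear part of F(y) - F(x) produces the gradient term. The remainder contributes L_F
  -- M_ψ‖K‖/2, and the curvature of φ₀ contributes ‖K‖²M_F²/2: together L/2.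
  have h4 : (inner ℝ (M.F y - M.F x) k : ℝ)
      = inner ℝ (M.meanGrad x) (y - x) + inner ℝ (M.F y - M.F x - M.meanJ x (y - x)) k := by
    rw [meanGrad, ContinuousLinearMap.adjoint_inner_left, ← hk, inner_sub_left _ (M.meanJ x (y - x)),
      real_inner_comm k (M.meanJ x (y - x))]
    ring
  have h5 : (inner ℝ (M.F y - M.F x - M.meanJ x (y - x)) k : ℝ)
      ≤ c.LF / 2 * ‖y - x‖ ^ 2 * (‖M.K‖ * c.Mpsi) := by
    refine (real_inner_le_norm _ _).trans (mul_le_mul h2 hkn (norm_nonneg _) ?_)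
    exact mul_nonneg (by linarith [hF.LF_pos]) (sq_nonneg _)
  have h6 : ‖M.K‖ ^ 2 / 2 * ‖M.F y - M.F x‖ ^ 2 ≤ ‖M.K‖ ^ 2 / 2 * (c.MF * ‖y - x‖) ^ 2 := by
    gcongr
  unfold constL
  unfold Phi0
  nlinarith

/-- The error of a gradient estimator in terms of the errors of its ingredients. -/
theorem norm_estimator_sub_meanGrad_sq_le (hM : StandingAssumption M) (hF : AssumptionF M c)
    (hpsi : AssumptionPsi M c) (hsc : EStronglyConvex 1 M.psi) {x : Vec p} (hx : x ∈ M.domPsi0)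
    (u : Vec q) (A : Vec p →L[ℝ] Vec q) :
    ‖ContinuousLinearMap.adjoint A (M.K (M.yStar u)) - M.meanGrad x‖ ^ 2
      ≤ 2 * (c.MF ^ 2 * ‖M.K‖ ^ 4 * ‖u - M.F x‖ ^ 2
        + c.Mpsi ^ 2 * ‖M.K‖ ^ 2 * ‖columns p q A - columns p q (M.meanJ x)‖ ^ 2) := by
  have hψ := hpsi.psi_pcc
  -- The Jacobian error meets the maximizer, bounded by M_ψ; the error of the maximizer meets the
  -- mean Jacobian, bounded by M_F.
  have e1 : ContinuousLinearMap.adjoint A (M.K (M.yStar u)) - M.meanGrad x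
      = ContinuousLinearMap.adjoint (A - M.meanJ x) (M.K (M.yStar u))
        + ContinuousLinearMap.adjoint (M.meanJ x) (M.K (M.yStar u - M.yStar (M.F x))) := by
    simp only [map_sub, sub_apply, meanGrad]
    abel
  have h1 : ‖ContinuousLinearMap.adjoint (A - M.meanJ x) (M.K (M.yStar u))‖
      ≤ ‖columns p q A - columns p q (M.meanJ x)‖ * (‖M.K‖ * c.Mpsi) := by
    refine (ContinuousLinearMap.le_opNorm _ _).trans ?_
    rw [LinearIsometryEquiv.norm_map, ← map_sub]
    refine mul_le_mul (opNorm_le_norm_columns _) ?_ (norm_nonneg _) (norm_nonneg _)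
    exact (M.K.le_opNorm _).trans (by gcongr; exact hpsi.bounded _ (psi_yStar_ne_top hψ hsc _))
  have h2 : ‖ContinuousLinearMap.adjoint (M.meanJ x) (M.K (M.yStar u - M.yStar (M.F x)))‖
      ≤ c.MF * (‖M.K‖ * (‖M.K‖ * ‖u - M.F x‖)) := by
    refine (ContinuousLinearMap.le_opNorm _ _).trans ?_
    rw [LinearIsometryEquiv.norm_map]
    refine mul_le_mul (hM.norm_meanJ_le hF hx) ?_ (norm_nonneg _) hF.MF_pos.le
    exact (M.K.le_opNorm _).trans (by gcongr; exact norm_yStar_sub_le hψ hsc _ _)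
  rw [e1]
  have h3 := (norm_add_le _ _).trans (add_le_add h1 h2)
  have h4 := pow_le_pow_left₀ (norm_nonneg _) h3 2
  refine h4.trans ?_
  nlinarith [sq_nonneg (‖columns p q A - columns p q (M.meanJ x)‖ * (‖M.K‖ * c.Mpsi)
    - c.MF * (‖M.K‖ * (‖M.K‖ * ‖u - M.F x‖)))]

end StandingAssumption

/-! ### One step of the method -/

/-- The scalar core of the step. Here d = ‖x̂ - x‖, r is the norm of the gradient error, G that of
the gradient mapping, ig and iv are the inner products of the true gradient and of its estimate with
x̂ - x, and Ru is the value of R at x̂. The step size gives 1/2 ≤ ηL ≤ 2/3, from which all the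
constants follow. -/
theorem step_descent_arith {L θ η d r G ig iv Φ Φ' R R' Ru : ℝ} (hL0 : 0 < L) (hθ0 : 0 < θ)
    (hθ1 : θ ≤ 1) (hη : η = 2 / (L * (3 + θ))) (hG0 : 0 ≤ G)
    (h6 : η * G ≤ d + η * r) (h5 : ig - iv ≤ r * d)
    (h3 : Ru + (L * (3 + θ) / 2 * d ^ 2 + iv) ≤ R) (h2 : R' ≤ (1 - θ) * R + θ * Ru)
    (h1 : Φ' ≤ Φ + θ * ig + L / 2 * (θ * d) ^ 2) :
    Φ' + R' + θ / (16 * L) * G ^ 2 + L / (2 * θ) * (θ * d) ^ 2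
      ≤ Φ + R + 13 * θ / (18 * L) * r ^ 2 := by
  have hη0 : 0 < η := by rw [hη]; positivity
  have hηL1 : 1 / 2 ≤ η * L := by
    rw [hη]
    rw [show 2 / (L * (3 + θ)) * L = 2 / (3 + θ) by field_simp, div_le_div_iff₀ (by norm_num)
      (by linarith)]
    linarith
  have hηL2 : η * L ≤ 2 / 3 := by
    rw [hη]
    rw [show 2 / (L * (3 + θ)) * L = 2 / (3 + θ) by field_simp, div_le_div_iff₀ (by linarith)
      (by norm_num)]
    linarith
  have h9 : (η * G) ^ 2 ≤ 2 * (d ^ 2 + (η * r) ^ 2) := by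
    have : (η * G) ^ 2 ≤ (d + η * r) ^ 2 := pow_le_pow_left₀ (by positivity) h6 2
    nlinarith [sq_nonneg (d - η * r)]
  have h10 : 1 / 4 * G ^ 2 ≤ (η * L * G) ^ 2 := by
    rw [mul_pow]
    have : 1 / 4 ≤ (η * L) ^ 2 := by nlinarith
    exact mul_le_mul_of_nonneg_right this (sq_nonneg G)
  have h11 : (η * L * r) ^ 2 ≤ 4 / 9 * r ^ 2 := by
    rw [mul_pow]
    have : (η * L) ^ 2 ≤ 4 / 9 := by nlinarith
    exact mul_le_mul_of_nonneg_right this (sq_nonneg r)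
  -- This prices G² in d² and r²: θ/(16L)·G² uses θL/2·d² and 2θ/(9L)·r². Young's inequality for rd
  -- adds θ/(2L)·r², and 1/2 + 2/9 = 13/18.
  have h12 : G ^ 2 ≤ 8 * (L * d) ^ 2 + 32 / 9 * r ^ 2 := by
    have : (η * L * G) ^ 2 = L ^ 2 * (η * G) ^ 2 := by ring
    have h13 := mul_le_mul_of_nonneg_left h9 (sq_nonneg L)
    nlinarith
  have h14 : θ / (16 * L) * G ^ 2 ≤ θ * (L / 2 * d ^ 2 + 2 / (9 * L) * r ^ 2) := by
    calc θ / (16 * L) * G ^ 2 ≤ θ / (16 * L) * (8 * (L * d) ^ 2 + 32 / 9 * r ^ 2) := by gcongr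
      _ = _ := by field_simp; ring
  have h15 : r * d ≤ 1 / (2 * L) * r ^ 2 + L / 2 * d ^ 2 := by
    have : 0 ≤ 1 / (2 * L) * (r - L * d) ^ 2 := by positivity
    have e : 1 / (2 * L) * (r - L * d) ^ 2 = 1 / (2 * L) * r ^ 2 + L / 2 * d ^ 2 - r * d := by
      field_simp; ring
    linarith
  have h16 : L / (2 * θ) * (θ * d) ^ 2 = θ * (L / 2 * d ^ 2) := by field_simp
  have h17 : 13 * θ / (18 * L) * r ^ 2 = θ * (1 / (2 * L) * r ^ 2 + 2 / (9 * L) * r ^ 2) := by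
    field_simp; ring
  rw [h16, h17]
  have h18 := mul_le_mul_of_nonneg_left h15 hθ0.le
  have h19 := mul_le_mul_of_nonneg_left h5 hθ0.le
  have h20 := mul_le_mul_of_nonneg_left h3 hθ0.le
  -- The budget θ d²/η: one share θL/2·d² each for the gradient mapping, for Young's inequality and
  -- for the term in ‖x' - x‖², and the rest L/2·(θd)² for the smoothness of Φ₀.
  have h21 : θ * (L * (3 + θ) / 2 * d ^ 2)
      = θ * (L / 2 * d ^ 2) + θ * (L / 2 * d ^ 2) + θ * (L / 2 * d ^ 2) + L / 2 * (θ * d) ^ 2 := by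
    ring
  linarith

namespace StandingAssumption

open MinimaxProblem

variable {p q n : ℕ} {Ω : Type*} [MeasurableSpace Ω] {M : MinimaxProblem p q n Ω} {c : Constants}

/-- Progress of one step with an inexact gradient `v`. -/
theorem step_descent (hM : StandingAssumption M) (hF : AssumptionF M c) (hpsi : AssumptionPsi M c)
    (hsc : EStronglyConvex 1 M.psi) {x : Vec p} (hx : x ∈ M.domPsi0) (v : Vec p) {L θ η : ℝ}
    (hL : L = constL c ‖M.K‖) (hL0 : 0 < L) (hθ0 : 0 < θ) (hθ1 : θ ≤ 1)
    (hη : η = 2 / (L * (3 + θ))) {x' : Vec p}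
    (hx' : x' = (1 - θ) • x + θ • prox M.R η (x - η • v)) :
    (M.Psi0 x').toReal + θ / (16 * L) * ‖M.gradMap η x‖ ^ 2 + L / (2 * θ) * ‖x' - x‖ ^ 2
      ≤ (M.Psi0 x).toReal + 13 * θ / (18 * L) * ‖v - M.meanGrad x‖ ^ 2 := by
  have hψ := hpsi.psi_pcc
  have hη0 : 0 < η := by rw [hη]; positivity
  set u := prox M.R η (x - η • v) with hu
  have huD : u ∈ M.domPsi0 := hM.prox_mem hψ hsc hη0 _
  have hx'D : x' ∈ M.domPsi0 := hx' ▸ hM.segment_mem hψ hsc hx huD hθ0.le hθ1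
  rw [hM.Psi0_toReal hψ hsc hx, hM.Psi0_toReal hψ hsc hx'D]
  have hxR := (hM.mem_domPsi0 hψ hsc).1 hx
  have huR := (hM.mem_domPsi0 hψ hsc).1 huD
  have hdiff : x' - x = θ • (u - x) := by rw [hx']; module
  have h1 := hM.Phi0_le hF hpsi hsc hx hx'D
  rw [← hL, hdiff, inner_smul_right, norm_smul, Real.norm_of_nonneg hθ0.le] at h1
  have h2 : (M.R x').toReal ≤ (1 - θ) * (M.R x).toReal + θ * (M.R u).toReal :=
    hx' ▸ hM.R_pcc.toReal_segment_le hxR huR hθ0.le hθ1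
  have h3 := hM.R_pcc.prox_variational hη0 (x - η • v) hxR
  rw [← hu] at h3
  have h4 : (inner ℝ (x - η • v - u) (x - u) : ℝ) / η
      = ‖u - x‖ ^ 2 / η + inner ℝ v (u - x) := by
    have e : x - η • v - u = -(u - x) - η • v := by abel
    rw [e, ← neg_sub u x, inner_neg_right, inner_sub_left, inner_neg_left,
      real_inner_self_eq_norm_sq, inner_smul_left]
    simp only [conj_trivial]
    field_simp
    ring
  rw [h4] at h3
  have hηinv : ‖u - x‖ ^ 2 / η = L * (3 + θ) / 2 * ‖u - x‖ ^ 2 := by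
    rw [hη]; field_simp
  rw [hηinv] at h3
  have h5 : (inner ℝ (M.meanGrad x) (u - x) - inner ℝ v (u - x) : ℝ)
      ≤ ‖v - M.meanGrad x‖ * ‖u - x‖ := by
    rw [← inner_sub_left, norm_sub_rev]
    exact real_inner_le_norm _ _
  -- The exact and the inexact proximal point differ by at most η‖v - ∇Φ₀‖, by nonexpansiveness.
  have h6 : η * ‖M.gradMap η x‖ ≤ ‖u - x‖ + η * ‖v - M.meanGrad x‖ := by
    rw [hM.gradMap_eq hF hψ hsc hη0 hx, norm_smul, Real.norm_of_nonneg (by positivity),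
      ← mul_assoc, mul_inv_cancel₀ hη0.ne', one_mul]
    have h7 := hM.R_pcc.prox_nonexpansive hη0 (x - η • v) (x - η • M.meanGrad x)
    have e : x - η • v - (x - η • M.meanGrad x) = -(η • (v - M.meanGrad x)) := by module
    rw [e, norm_neg, norm_smul, Real.norm_of_nonneg hη0.le, ← hu] at h7
    have h8 := norm_add_le (x - u) (u - prox M.R η (x - η • M.meanGrad x))
    rw [sub_add_sub_cancel, norm_sub_rev x u] at h8
    linarith
  rw [hdiff, norm_smul, Real.norm_of_nonneg hθ0.le]
  exact step_descent_arith hL0 hθ0 hθ1 hη (norm_nonneg _) h6 h5 h3 h2 h1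

/-! ### Measurability on the domain, and the two oracles -/

/-- The mean Jacobian is Lipschitz on the domain, hence continuous there. -/
theorem measurable_meanJ (hM : StandingAssumption M) (hF : AssumptionF M c) :
    Measurable fun x : M.domPsi0 => M.meanJ x :=
  (LipschitzWith.of_dist_le_mul (K := c.LF.toNNReal) fun x y => by
    rw [dist_eq_norm, Subtype.dist_eq, dist_eq_norm, Real.coe_toNNReal _ hF.LF_pos.le]
    exact hM.norm_meanJ_sub_le hF x.2 y.2).continuous.measurable

theorem measurable_F_dom (hM : StandingAssumption M) (hF : AssumptionF M c)
    (hψ : ProperClosedConvex M.psi) (hsc : EStronglyConvex 1 M.psi) :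
    Measurable fun x : M.domPsi0 => M.F x :=
  (LipschitzWith.of_dist_le_mul (K := c.MF.toNNReal) fun x y => by
    rw [dist_eq_norm, Subtype.dist_eq, dist_eq_norm, Real.coe_toNNReal _ hF.MF_pos.le]
    exact hM.norm_F_sub_le hF hψ hsc y.2 x.2).continuous.measurable

theorem _root_.Measurable.clm_apply_var {α : Type*} {m : MeasurableSpace α} {E F : Type*}
    [NormedAddCommGroup E] [NormedSpace ℝ E] [NormedAddCommGroup F] [NormedSpace ℝ F]
    [FiniteDimensional ℝ E] [FiniteDimensional ℝ F]
    [MeasurableSpace E] [BorelSpace E] [MeasurableSpace F] [BorelSpace F]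
    {A : α → E →L[ℝ] F} {v : α → E} (hA : Measurable A) (hv : Measurable v) :
    Measurable fun a => A a (v a) := by
  have : SecondCountableTopology E := by
    have := FiniteDimensional.proper ℝ E
    infer_instance
  have h : Continuous fun z : (E →L[ℝ] F) × E => z.1 z.2 := isBoundedBilinearMap_apply.continuous
  exact h.measurable2 hA hv

theorem measurable_gradMap (hM : StandingAssumption M) (hF : AssumptionF M c)
    (hψ : ProperClosedConvex M.psi) (hsc : EStronglyConvex 1 M.psi) {η : ℝ} (hη : 0 < η) :
    Measurable fun x : M.domPsi0 => M.gradMap η x := by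
  have h1 : Measurable fun x : M.domPsi0 => M.meanGrad x := by
    refine Measurable.clm_apply_var ?_ ?_
    · exact (LinearIsometryEquiv.continuous _).measurable.comp (hM.measurable_meanJ hF)
    · exact (M.K.continuous.comp (continuous_yStar hψ hsc)).measurable.comp
        (hM.measurable_F_dom hF hψ hsc)
  have h2 : Measurable fun x : M.domPsi0 =>
      η⁻¹ • ((x : Vec p) - prox M.R η (x - η • M.meanGrad x)) := by
    refine (measurable_subtype_coe.sub ?_).const_smul η⁻¹
    exact (hM.R_pcc.continuous_prox hη).measurable.comp
      (measurable_subtype_coe.sub (h1.const_smul η))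
  convert h2 using 2 with x
  exact hM.gradMap_eq hF hψ hsc hη x.2

theorem oracleF (hM : StandingAssumption M) (hF : AssumptionF M c)
    (hψ : ProperClosedConvex M.psi) (hsc : EStronglyConvex 1 M.psi) :
    IsStochasticOracle M.law (fun (x : M.domPsi0) ξ => M.stochF x ξ) (fun x => M.F x)
      (c.sigmaF ^ 2) (fun x y => c.MF ^ 2 * ‖(x : Vec p) - y‖ ^ 2) where
  measurable := hM.measurable_F
  measurable_mean := hM.measurable_F_dom hF hψ hsc
  nonneg := sq_nonneg _
  dist_nonneg x y := by positivity
  integrable x := hM.integrable x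
  mean x := rfl
  variance x := by simpa only [ofReal_norm_sq] using hF.variance_F x x.2
  increment x y := hM.lintegral_stochF_sub_sq_le hF hψ hsc y.2 x.2

theorem oracleJ (hM : StandingAssumption M) (hF : AssumptionF M c) :
    IsStochasticOracle M.law (fun (x : M.domPsi0) ξ => columns p q (M.stochJ x ξ))
      (fun x => columns p q (M.meanJ x)) (c.sigmaJ ^ 2)
      (fun x y => c.LF ^ 2 * ‖(x : Vec p) - y‖ ^ 2) where
  measurable := (columns p q).continuous.measurable.comp hM.measurable_J
  measurable_mean := (columns p q).continuous.measurable.comp (hM.measurable_meanJ hF)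
  nonneg := sq_nonneg _
  dist_nonneg x y := by positivity
  integrable x := by
    have := hM.prob
    exact (columns p q).integrable_comp ((hM.memLp_stochJ hF x.2).integrable one_le_two)
  mean x := by
    have := hM.prob
    exact (columns p q).integral_comp_comm ((hM.memLp_stochJ hF x.2).integrable one_le_two)
  variance x := by
    have := hM.prob
    have h1 : MemLp (fun ξ => columns p q (M.stochJ x ξ)) 2 M.law :=
      (columns p q).comp_memLp' (hM.memLp_stochJ hF x.2)
    -- The variance is assumed about F'(x), while the oracle is centered at the mean Jacobian. The
    -- mean minimizes the squared deviation, so σ_J² still bounds it.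
    have h2 := lintegral_sub_integral_sq_le h1 (columns p q (M.J x))
    rw [(columns p q).integral_comp_comm
      ((hM.memLp_stochJ hF x.2).integrable one_le_two)] at h2
    refine h2.trans ?_
    simpa only [ofReal_frobSq, map_sub] using hF.variance_J x x.2
  increment x y := by
    simpa only [ofReal_frobSq, map_sub] using hF.smooth x x.2 y y.2

end StandingAssumption

/-! ### The iterates as random variables -/

section Iterates

open MinimaxProblem

variable {p q n : ℕ} {W Ω : Type*} [MeasurableSpace Ω] {sz : BatchSizes}
  {M : MinimaxProblem p q n Ω} {c : Constants} {par : StepParams} {B : MiniBatches W Ω sz}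

/-- The state at iteration `t` of stage `s`. -/
noncomputable def restartState (M : MinimaxProblem p q n Ω) (par : StepParams)
    (B : MiniBatches W Ω sz) (T : ℕ) (x0 : Vec p) (s t : ℕ) (ω : W) : InnerState p q :=
  innerRun M par B s ω (restartRun M par B T x0 ω s) t

theorem nextPoint_mem (hM : StandingAssumption M) (hψ : ProperClosedConvex M.psi)
    (hsc : EStronglyConvex 1 M.psi) (hη : 0 < par.eta) (hθ0 : 0 ≤ par.theta)
    (hθ1 : par.theta ≤ 1) {st : InnerState p q} (hst : st.x ∈ M.domPsi0) :
    nextPoint M par st ∈ M.domPsi0 :=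
  hM.segment_mem hψ hsc hst (hM.prox_mem hψ hsc hη _) hθ0 hθ1

theorem innerRun_mem (hM : StandingAssumption M) (hψ : ProperClosedConvex M.psi)
    (hsc : EStronglyConvex 1 M.psi) (hη : 0 < par.eta) (hθ0 : 0 ≤ par.theta)
    (hθ1 : par.theta ≤ 1) (s : ℕ) (ω : W) {start : StageStart p} (hst : start.x ∈ M.domPsi0) :
    ∀ t, (innerRun M par B s ω start t).x ∈ M.domPsi0
  | 0 => hst
  | t + 1 => nextPoint_mem hM hψ hsc hη hθ0 hθ1 (innerRun_mem hM hψ hsc hη hθ0 hθ1 s ω hst t)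

theorem restartRun_mem (hM : StandingAssumption M) (hψ : ProperClosedConvex M.psi)
    (hsc : EStronglyConvex 1 M.psi) (hη : 0 < par.eta) (hθ0 : 0 ≤ par.theta)
    (hθ1 : par.theta ≤ 1) (T : ℕ) {x0 : Vec p} (hx0 : x0 ∈ M.domPsi0) (ω : W) :
    ∀ s, (restartRun M par B T x0 ω s).x ∈ M.domPsi0
  | 0 => hx0
  | s + 1 => nextPoint_mem hM hψ hsc hη hθ0 hθ1 (innerRun_mem hM hψ hsc hη hθ0 hθ1 s ω
      (restartRun_mem hM hψ hsc hη hθ0 hθ1 T hx0 ω s) T)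

theorem restartState_mem (hM : StandingAssumption M) (hψ : ProperClosedConvex M.psi)
    (hsc : EStronglyConvex 1 M.psi) (hη : 0 < par.eta) (hθ0 : 0 ≤ par.theta)
    (hθ1 : par.theta ≤ 1) (T : ℕ) {x0 : Vec p} (hx0 : x0 ∈ M.domPsi0) (s t : ℕ) (ω : W) :
    (restartState M par B T x0 s t ω).x ∈ M.domPsi0 :=
  innerRun_mem hM hψ hsc hη hθ0 hθ1 s ω (restartRun_mem hM hψ hsc hη hθ0 hθ1 T hx0 ω s) t

/-- Measurability of a random state. -/
structure MeasurableState (m : MeasurableSpace W) (st : W → InnerState p q) : Prop where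
  x : Measurable[m] fun ω => (st ω).x
  Ft : Measurable[m] fun ω => (st ω).Ft
  Jt : Measurable[m] fun ω => (st ω).Jt

theorem MeasurableState.mono {m m' : MeasurableSpace W} {st : W → InnerState p q}
    (h : MeasurableState m st) (hm : m ≤ m') : MeasurableState m' st :=
  ⟨h.x.mono hm le_rfl, h.Ft.mono hm le_rfl, h.Jt.mono hm le_rfl⟩

/-! ### Measurability of one update, for an arbitrary σ-algebra on the sample space -/

section Generic

variable {m : MeasurableSpace W}

theorem MeasurableState.nextPoint (hM : StandingAssumption M) (hψ : ProperClosedConvex M.psi)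
    (hsc : EStronglyConvex 1 M.psi) (hη : 0 < par.eta) {st : W → InnerState p q}
    (hst : MeasurableState m st) : Measurable fun ω => nextPoint M par (st ω) := by
  obtain ⟨hx, hF, hJ⟩ := hst
  have h1 : Measurable fun ω => ContinuousLinearMap.adjoint (st ω).Jt (M.K (M.yStar (st ω).Ft)) := by
    refine Measurable.clm_apply_var ?_ ?_
    · exact (LinearIsometryEquiv.continuous _).measurable.comp hJ
    · exact (M.K.continuous.comp (continuous_yStar hψ hsc)).measurable.comp hF
  refine (hx.const_smul (1 - par.theta)).add (Measurable.const_smul ?_ par.theta)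
  exact (hM.R_pcc.continuous_prox hη).measurable.comp (hx.sub (h1.const_smul par.eta))

theorem measurable_stochF_comp (hM : StandingAssumption M) {x : W → Vec p} {Y : W → Ω}
    (hxD : ∀ ω, x ω ∈ M.domPsi0) (hx : Measurable x) (hY : Measurable Y) :
    Measurable fun ω => M.stochF (x ω) (Y ω) :=
  hM.measurable_F.comp ((hx.subtype_mk (h := hxD)).prodMk hY)

theorem measurable_stochJ_comp (hM : StandingAssumption M) {x : W → Vec p} {Y : W → Ω}
    (hxD : ∀ ω, x ω ∈ M.domPsi0) (hx : Measurable x) (hY : Measurable Y) :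
    Measurable fun ω => M.stochJ (x ω) (Y ω) :=
  hM.measurable_J.comp ((hx.subtype_mk (h := hxD)).prodMk hY)

theorem measurableState_initState (hM : StandingAssumption M) {s : ℕ} {start : W → StageStart p}
    (hD : ∀ ω, (start ω).x ∈ M.domPsi0) (hx : Measurable fun ω => (start ω).x)
    (hB : ∀ i, Measurable (B.B0 s i)) (hBh : ∀ i, Measurable (B.Bh0 s i)) :
    MeasurableState m fun ω => initState M B s ω (start ω) where
  x := hx
  Ft := (Finset.measurable_fun_sum Finset.univ fun i _ =>
    measurable_stochF_comp hM hD hx (hB i)).const_smul (1 / (sz.b0 : ℝ))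
  Jt := (Finset.measurable_fun_sum Finset.univ fun i _ =>
    measurable_stochJ_comp hM hD hx (hBh i)).const_smul (1 / (sz.bh0 : ℝ))

theorem measurableState_innerStep (hM : StandingAssumption M) (hψ : ProperClosedConvex M.psi)
    (hsc : EStronglyConvex 1 M.psi) (hη : 0 < par.eta) (hθ0 : 0 ≤ par.theta)
    (hθ1 : par.theta ≤ 1) {s t : ℕ} {st : W → InnerState p q} (hst : MeasurableState m st)
    (hD : ∀ ω, (st ω).x ∈ M.domPsi0)
    (hB1 : ∀ i, Measurable (B.B1 s t i)) (hBh1 : ∀ i, Measurable (B.Bh1 s t i))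
    (hB2 : ∀ i, Measurable (B.B2 s t i)) (hBh2 : ∀ i, Measurable (B.Bh2 s t i)) :
    MeasurableState m fun ω => innerStep M par B s t ω (st ω) := by
  have hx' := hst.nextPoint (par := par) hM hψ hsc hη
  have hD' : ∀ ω, nextPoint M par (st ω) ∈ M.domPsi0 := fun ω =>
    nextPoint_mem hM hψ hsc hη hθ0 hθ1 (hD ω)
  refine ⟨hx', ?_, ?_⟩
  · refine ((hst.Ft.const_smul par.beta).add (Measurable.const_smul ?_ (par.beta / (sz.b1 : ℝ)))).add
      (Measurable.const_smul ?_ ((1 - par.beta) / (sz.b2 : ℝ)))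
    · exact Finset.measurable_fun_sum Finset.univ fun i _ =>
        (measurable_stochF_comp hM hD' hx' (hB1 i)).sub
          (measurable_stochF_comp hM hD hst.x (hB1 i))
    · exact Finset.measurable_fun_sum Finset.univ fun i _ =>
        measurable_stochF_comp hM hD' hx' (hB2 i)
  · refine ((hst.Jt.const_smul par.beta).add
      (Measurable.const_smul ?_ (par.beta / (sz.bh1 : ℝ)))).add
      (Measurable.const_smul ?_ ((1 - par.beta) / (sz.bh2 : ℝ)))
    · exact Finset.measurable_fun_sum Finset.univ fun i _ =>
        (measurable_stochJ_comp hM hD' hx' (hBh1 i)).sub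
          (measurable_stochJ_comp hM hD hst.x (hBh1 i))
    · exact Finset.measurable_fun_sum Finset.univ fun i _ =>
        measurable_stochJ_comp hM hD' hx' (hBh2 i)

end Generic

/-! ### The past of an iteration -/

theorem measurable_sampleSigma_apply {k : ℕ} (X : Fin k → W → Ω) (i : Fin k) :
    Measurable[sampleSigma X] (X i) :=
  (comap_measurable (X i)).mono (le_iSup (fun i => MeasurableSpace.comap (X i) _) i) le_rfl

/-- The σ-algebra generated by all mini-batches drawn before iteration `t` of stage `s`, among the
first `S` stages. -/
@[reducible] def MiniBatches.hist (B : MiniBatches W Ω sz) (S T s t : ℕ) : MeasurableSpace W :=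
  ⨆ i ∈ {i : Fin S × Fin (T + 1) | (i.1 : ℕ) < s ∨ (i.1 : ℕ) = s ∧ (i.2 : ℕ) < t},
    B.iterSigma i.1 i.2

theorem MiniBatches.hist_mono (B : MiniBatches W Ω sz) {S T s t s' t' : ℕ}
    (h : ∀ i j : ℕ, j < T + 1 → i < s ∨ i = s ∧ j < t → i < s' ∨ i = s' ∧ j < t') :
    B.hist S T s t ≤ B.hist S T s' t' :=
  biSup_mono fun i hi => h _ _ i.2.2 hi

theorem MiniBatches.iterSigma_le_hist (B : MiniBatches W Ω sz) {S T s t : ℕ} (hs : s < S)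
    (ht : t < T + 1) : B.iterSigma s t ≤ B.hist S T s (t + 1) :=
  le_biSup (fun i : Fin S × Fin (T + 1) => B.iterSigma i.1 i.2)
    (i := ((⟨s, hs⟩, ⟨t, ht⟩) : Fin S × Fin (T + 1))) (Or.inr ⟨rfl, Nat.lt_succ_self t⟩)

/-- Adaptedness within a stage: the state at iteration t uses the batches up to and including t,
whence the index t + 1, as the history counts what was drawn strictly before. -/
theorem measurableState_restart (hM : StandingAssumption M) (hψ : ProperClosedConvex M.psi)
    (hsc : EStronglyConvex 1 M.psi) (hη : 0 < par.eta) (hθ0 : 0 ≤ par.theta)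
    (hθ1 : par.theta ≤ 1) {S T : ℕ} {x0 : Vec p} (hx0 : x0 ∈ M.domPsi0) {s : ℕ} (hs : s < S)
    (hstart : Measurable[B.hist S T s 0] fun ω => (restartRun M par B T x0 ω s).x) :
    ∀ t ≤ T, MeasurableState (B.hist S T s (t + 1)) (restartState M par B T x0 s t)
  | 0, _ => by
    have hle : B.iterSigma s 0 ≤ B.hist S T s 1 := B.iterSigma_le_hist hs (Nat.succ_pos T)
    refine measurableState_initState (m := B.hist S T s (0 + 1)) hM
      (fun ω => restartRun_mem hM hψ hsc hη hθ0 hθ1 T hx0 ω s) (hstart.mono (B.hist_mono ?_) le_rfl)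
      (fun i => (measurable_sampleSigma_apply (B.B0 s) i).mono (le_sup_left.trans hle) le_rfl)
      (fun i => (measurable_sampleSigma_apply (B.Bh0 s) i).mono (le_sup_right.trans hle) le_rfl)
    intro i j _ h
    omega
  | t + 1, ht => by
    have hle : B.iterSigma s (t + 1) ≤ B.hist S T s (t + 1 + 1) :=
      B.iterSigma_le_hist hs (by omega)
    refine measurableState_innerStep (m := B.hist S T s (t + 1 + 1)) hM hψ hsc hη hθ0 hθ1
      ((measurableState_restart hM hψ hsc hη hθ0 hθ1 hx0 hs hstart t (by omega)).mono
        (B.hist_mono ?_))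
      (restartState_mem hM hψ hsc hη hθ0 hθ1 T hx0 s t)
      (fun i => (measurable_sampleSigma_apply (B.B1 s (t + 1)) i).mono
        ((le_sup_left.trans le_sup_left).trans hle) le_rfl)
      (fun i => (measurable_sampleSigma_apply (B.Bh1 s (t + 1)) i).mono
        ((le_sup_left.trans le_sup_right).trans hle) le_rfl)
      (fun i => (measurable_sampleSigma_apply (B.B2 s (t + 1)) i).mono
        ((le_sup_right.trans le_sup_left).trans hle) le_rfl)
      (fun i => (measurable_sampleSigma_apply (B.Bh2 s (t + 1)) i).mono
        ((le_sup_right.trans le_sup_right).trans hle) le_rfl)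
    intro i j _ h
    omega

theorem measurable_restartRun (hM : StandingAssumption M) (hψ : ProperClosedConvex M.psi)
    (hsc : EStronglyConvex 1 M.psi) (hη : 0 < par.eta) (hθ0 : 0 ≤ par.theta)
    (hθ1 : par.theta ≤ 1) {S T : ℕ} {x0 : Vec p} (hx0 : x0 ∈ M.domPsi0) :
    ∀ s ≤ S, Measurable[B.hist S T s 0] fun ω => (restartRun M par B T x0 ω s).x
  | 0, _ => measurable_const
  | s + 1, hs => by
    have h := measurableState_restart hM hψ hsc hη hθ0 hθ1 hx0 hs
      (measurable_restartRun hM hψ hsc hη hθ0 hθ1 hx0 s (by omega)) T le_rfl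
    exact (h.nextPoint hM hψ hsc hη).mono (B.hist_mono fun i j _ h => by omega) le_rfl

theorem measurableState_restartState (hM : StandingAssumption M) (hψ : ProperClosedConvex M.psi)
    (hsc : EStronglyConvex 1 M.psi) (hη : 0 < par.eta) (hθ0 : 0 ≤ par.theta)
    (hθ1 : par.theta ≤ 1) {S T : ℕ} {x0 : Vec p} (hx0 : x0 ∈ M.domPsi0) {s : ℕ} (hs : s < S)
    {t : ℕ} (ht : t ≤ T) :
    MeasurableState (B.hist S T s (t + 1)) (restartState M par B T x0 s t) :=
  measurableState_restart hM hψ hsc hη hθ0 hθ1 hx0 hs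
    (measurable_restartRun hM hψ hsc hη hθ0 hθ1 hx0 s hs.le) t ht

variable [mW : MeasurableSpace W] {μ : Measure W} {law : Measure Ω}

theorem MiniBatches.IsSampling.iterSigma_le {S T : ℕ} (hB : B.IsSampling μ law S T) {s t : ℕ}
    (hs : s < S) (ht : t < T + 1) : B.iterSigma s t ≤ mW := by
  cases t with
  | zero => exact sup_le (hB.iid_B0 s hs).sampleSigma_le (hB.iid_Bh0 s hs).sampleSigma_le
  | succ t =>
    have ht' : t + 1 ∈ Finset.Icc 1 T := Finset.mem_Icc.2 ⟨by omega, by omega⟩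
    exact sup_le
      (sup_le (hB.iid_B1 s hs _ ht').sampleSigma_le (hB.iid_B2 s hs _ ht').sampleSigma_le)
      (sup_le (hB.iid_Bh1 s hs _ ht').sampleSigma_le (hB.iid_Bh2 s hs _ ht').sampleSigma_le)

theorem MiniBatches.IsSampling.hist_le {S T : ℕ} (hB : B.IsSampling μ law S T) (s t : ℕ) :
    B.hist S T s t ≤ mW :=
  iSup₂_le fun i _ => hB.iterSigma_le i.1.2 i.2.2

/-- The past and the present are generated by disjoint index sets of one independent family. -/
theorem MiniBatches.IsSampling.indep_hist {S T : ℕ} (hB : B.IsSampling μ law S T) {s t : ℕ}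
    (hs : s < S) (ht : t < T + 1) : Indep (B.hist S T s t) (B.iterSigma s t) μ := by
  have h := indep_iSup_of_disjoint (fun i : Fin S × Fin (T + 1) => hB.iterSigma_le i.1.2 i.2.2)
    hB.indep (S := {i | (i.1 : ℕ) < s ∨ (i.1 : ℕ) = s ∧ (i.2 : ℕ) < t})
    (T := {(⟨s, hs⟩, ⟨t, ht⟩)}) (by
      rw [Set.disjoint_singleton_right]
      rintro (h | h)
      · exact lt_irrefl _ h
      · exact lt_irrefl _ h.2)
  simpa only [Set.mem_singleton_iff, iSup_iSup_eq_left] using h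

end Iterates

/-! ### The error recursion and the Lyapunov argument -/

section Recursion

open MinimaxProblem

variable {p q n : ℕ} {W Ω : Type*} [mW : MeasurableSpace W] [MeasurableSpace Ω] {sz : BatchSizes}
  {M : MinimaxProblem p q n Ω} {c : Constants} {par : StepParams} {B : MiniBatches W Ω sz}
  {μ : Measure W}

/-- The weighted squared error of the two estimators. -/
noncomputable def estError (M : MinimaxProblem p q n Ω) (c : Constants) (st : InnerState p q) : ℝ :=
  -- The weight 13/9 is 13/18 from `step_descent` times 2 from `norm_estimator_sub_meanGrad_sq_le`,
  -- so that the error term of a step becomes θ/L times this quantity.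
  13 / 9 * (c.MF ^ 2 * ‖M.K‖ ^ 4) * ‖st.Ft - M.F st.x‖ ^ 2
    + 13 / 9 * (c.Mpsi ^ 2 * ‖M.K‖ ^ 2) *
      ‖columns p q st.Jt - columns p q (M.meanJ st.x)‖ ^ 2

theorem estError_nonneg (M : MinimaxProblem p q n Ω) (c : Constants) (st : InnerState p q) :
    0 ≤ estError M c st := by
  unfold estError; positivity

theorem lintegral_ofReal_comb {H H' : Type*} [NormedAddCommGroup H] [NormedAddCommGroup H']
    [MeasurableSpace H] [OpensMeasurableSpace H] [MeasurableSpace H'] [OpensMeasurableSpace H']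
    {f : W → H} {g : W → H'} (hf : Measurable f) (hg : Measurable g) {a b : ℝ} (ha : 0 ≤ a)
    (hb : 0 ≤ b) :
    ∫⁻ ω, ENNReal.ofReal (a * ‖f ω‖ ^ 2 + b * ‖g ω‖ ^ 2) ∂μ
      = ENNReal.ofReal a * ∫⁻ ω, ‖f ω‖ₑ ^ 2 ∂μ + ENNReal.ofReal b * ∫⁻ ω, ‖g ω‖ₑ ^ 2 ∂μ := by
  rw [← lintegral_const_mul _ (hf.enorm.pow_const 2), ← lintegral_const_mul _ (hg.enorm.pow_const 2),
    ← lintegral_add_left ((hf.enorm.pow_const 2).const_mul _)]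
  refine lintegral_congr fun ω => ?_
  rw [ENNReal.ofReal_add (by positivity) (by positivity), ENNReal.ofReal_mul ha,
    ENNReal.ofReal_mul hb, ofReal_norm_sq, ofReal_norm_sq]

theorem MiniBatches.kappa_spec (B : MiniBatches W Ω sz) (μ : Measure W) {S T s t : ℕ} (hs : s < S)
    (ht : t ∈ Finset.Icc 1 T) :
    B.kappa μ S T = 1 ∧ IndepFun (fun ω i => B.B1 s t i ω) (fun ω i => B.B2 s t i ω) μ
      ∨ B.kappa μ S T = 2 := by
  unfold MiniBatches.kappa
  split_ifs with h
  · exact Or.inl ⟨rfl, h s hs t ht⟩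
  · exact Or.inr rfl

theorem MiniBatches.kappaHat_spec (B : MiniBatches W Ω sz) (μ : Measure W) {S T s t : ℕ}
    (hs : s < S) (ht : t ∈ Finset.Icc 1 T) :
    B.kappaHat μ S T = 1 ∧ IndepFun (fun ω i => B.Bh1 s t i ω) (fun ω i => B.Bh2 s t i ω) μ
      ∨ B.kappaHat μ S T = 2 := by
  unfold MiniBatches.kappaHat
  split_ifs with h
  · exact Or.inl ⟨rfl, h s hs t ht⟩
  · exact Or.inr rfl

theorem MiniBatches.one_le_kappa (B : MiniBatches W Ω sz) (μ : Measure W) (S T : ℕ) :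
    1 ≤ B.kappa μ S T := by
  unfold MiniBatches.kappa
  split_ifs <;> norm_num

theorem MiniBatches.one_le_kappaHat (B : MiniBatches W Ω sz) (μ : Measure W) (S T : ℕ) :
    1 ≤ B.kappaHat μ S T := by
  unfold MiniBatches.kappaHat
  split_ifs <;> norm_num

theorem measurable_errF (hM : StandingAssumption M) (hF : AssumptionF M c)
    (hψ : ProperClosedConvex M.psi) (hsc : EStronglyConvex 1 M.psi) {m : MeasurableSpace W}
    {st : W → InnerState p q} (hst : MeasurableState m st) (hD : ∀ ω, (st ω).x ∈ M.domPsi0) :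
    Measurable[m] fun ω => (st ω).Ft - M.F (st ω).x :=
  hst.Ft.sub ((hM.measurable_F_dom hF hψ hsc).comp (hst.x.subtype_mk (h := hD)))

theorem measurable_errJ (hM : StandingAssumption M) (hF : AssumptionF M c)
    {m : MeasurableSpace W} {st : W → InnerState p q} (hst : MeasurableState m st)
    (hD : ∀ ω, (st ω).x ∈ M.domPsi0) :
    Measurable[m] fun ω => columns p q (st ω).Jt - columns p q (M.meanJ (st ω).x) :=
  ((columns p q).continuous.measurable.comp hst.Jt).sub ((columns p q).continuous.measurable.comp
    ((hM.measurable_meanJ hF).comp (hst.x.subtype_mk (h := hD))))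

theorem measurable_estError (hM : StandingAssumption M) (hF : AssumptionF M c)
    (hψ : ProperClosedConvex M.psi) (hsc : EStronglyConvex 1 M.psi) {m : MeasurableSpace W}
    {st : W → InnerState p q} (hst : MeasurableState m st) (hD : ∀ ω, (st ω).x ∈ M.domPsi0) :
    Measurable[m] fun ω => estError M c (st ω) :=
  (((measurable_errF hM hF hψ hsc hst hD).norm.pow_const 2).const_mul _).add
    (((measurable_errJ hM hF hst hD).norm.pow_const 2).const_mul _)

theorem sq_constP (c : Constants) (k : ℝ) {c0 κ κh : ℝ} (hc0 : 0 < c0) (hκ : 0 ≤ κ)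
    (hκh : 0 ≤ κh) : constP c k c0 κ κh ^ 2
      = 26 * k ^ 2 / (9 * c0) * (κ * c.MF ^ 4 * k ^ 2 + c0 * κh * c.LF ^ 2 * c.Mpsi ^ 2) := by
  unfold constP
  rw [mul_pow, div_pow, mul_pow, mul_pow, Real.sq_sqrt (by norm_num), Real.sq_sqrt hc0.le,
    Real.sq_sqrt (by positivity)]
  norm_num

variable [IsProbabilityMeasure μ] {c0 : ℝ} {b bh0 S T : ℕ} {x0 : Vec p}
  (hM : StandingAssumption M) (hF : AssumptionF M c) (hpsi : AssumptionPsi M c)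
  (hsc : EStronglyConvex 1 M.psi) (hx0 : x0 ∈ M.domPsi0) (hc0 : 0 < c0)
  (hB : B.IsSampling μ M.law S T)
  (hη : 0 < par.eta) (hθ0 : 0 ≤ par.theta) (hθ1 : par.theta ≤ 1)

include hM hF hpsi hsc hx0 hc0 hB hη hθ0 hθ1

/-- The starting point of a stage depends only on earlier stages, so the first batches are plain
averages with frozen argument. -/
theorem lintegral_estError_init_le (hbh0 : 1 ≤ bh0) (hsz_b0 : (sz.b0 : ℝ) = c0 * bh0)
    (hsz_bh0 : sz.bh0 = bh0) {s : ℕ} (hs : s < S) :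
    ∫⁻ ω, ENNReal.ofReal (estError M c (restartState M par B T x0 s 0 ω)) ∂μ
      ≤ ENNReal.ofReal
        (constQ c ‖M.K‖ c0 (B.kappa μ S T) (B.kappaHat μ S T) / (2 * bh0)) := by
  have hψ := hpsi.psi_pcc
  have := hM.prob
  have hbh0' : (1 : ℝ) ≤ bh0 := by exact_mod_cast hbh0
  have hb0 : 0 < sz.b0 := by
    have : (0 : ℝ) < sz.b0 := by rw [hsz_b0]; positivity
    exact_mod_cast this
  have hbh0p : 0 < sz.bh0 := by omega
  have hD := restartState_mem (B := B) hM hψ hsc hη hθ0 hθ1 T hx0 s 0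
  have hst := (measurableState_restartState (B := B) hM hψ hsc hη hθ0 hθ1 hx0 hs
    (Nat.zero_le T)).mono (hB.hist_le s (0 + 1))
  have hX : Measurable[B.hist S T s 0]
      fun ω => (⟨(restartState M par B T x0 s 0 ω).x, hD ω⟩ : M.domPsi0) :=
    (measurable_restartRun (B := B) hM hψ hsc hη hθ0 hθ1 hx0 s hs.le).subtype_mk
  have hind := hB.indep_hist hs (Nat.succ_pos T)
  have e1 := (hM.oracleF hF hψ hsc).lintegral_batch_error_le (hB.hist_le s 0) hb0 (hB.iid_B0 s hs)
    (indep_of_indep_of_le_right hind le_sup_left) hX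
  have e2 := (hM.oracleJ hF).lintegral_batch_error_le (hB.hist_le s 0) hbh0p (hB.iid_Bh0 s hs)
    (indep_of_indep_of_le_right hind le_sup_right) hX
  have hκ := B.one_le_kappa μ S T
  have hκh := B.one_le_kappaHat μ S T
  unfold estError
  rw [lintegral_ofReal_comb (measurable_errF hM hF hψ hsc hst hD) (measurable_errJ hM hF hst hD)
    (by positivity) (by positivity)]
  have e2' : ∫⁻ ω, ‖columns p q (restartState M par B T x0 s 0 ω).Jt
      - columns p q (M.meanJ (restartState M par B T x0 s 0 ω).x)‖ₑ ^ 2 ∂μ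
      ≤ ENNReal.ofReal (c.sigmaJ ^ 2 / sz.bh0) := by
    refine le_trans (le_of_eq (lintegral_congr fun ω => ?_)) e2
    congr 3
    exact (map_smul _ _ _).trans (congrArg _ (map_sum _ _ _))
  refine (add_le_add (mul_le_mul' le_rfl e1) (mul_le_mul' le_rfl e2')).trans ?_
  rw [← ENNReal.ofReal_mul (by positivity), ← ENNReal.ofReal_mul (by positivity),
    ← ENNReal.ofReal_add (by positivity) (by positivity), hsz_bh0, hsz_b0]
  refine ENNReal.ofReal_le_ofReal ?_
  unfold constQ
  generalize B.kappa μ S T = κ at hκ ⊢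
  generalize B.kappaHat μ S T = κh at hκh ⊢
  -- The initial error involves no κ; the factors κ, κ̂ ≥ 1 are inserted only to express the bound
  -- by the same Q.
  have h1 : 13 / 9 * (c.MF ^ 2 * ‖M.K‖ ^ 4) * (c.sigmaF ^ 2 / (c0 * bh0)) * 1
      ≤ 13 / 9 * (c.MF ^ 2 * ‖M.K‖ ^ 4) * (c.sigmaF ^ 2 / (c0 * bh0)) * κ := by gcongr
  have h2 : 13 / 9 * (c.Mpsi ^ 2 * ‖M.K‖ ^ 2) * (c.sigmaJ ^ 2 / bh0) * 1
      ≤ 13 / 9 * (c.Mpsi ^ 2 * ‖M.K‖ ^ 2) * (c.sigmaJ ^ 2 / bh0) * κh := by gcongr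
  rw [mul_one] at h1 h2
  refine (add_le_add h1 h2).trans_eq ?_
  field_simp
  ring

/-- Both hybrid estimates, weighted as in `estError`: the increments of the oracles collect into P²,
their variances into Q. The batches for F and for the Jacobian may be dependent, as their errors are
bounded separately and added. -/
theorem lintegral_estError_succ_le (hb : 1 ≤ b) (hsz_b1 : (sz.b1 : ℝ) = c0 * b)
    (hsz_b2 : (sz.b2 : ℝ) = c0 * b) (hsz_bh1 : sz.bh1 = b) (hsz_bh2 : sz.bh2 = b) {s t : ℕ}
    (hs : s < S) (ht : t < T) :
    ∫⁻ ω, ENNReal.ofReal (estError M c (restartState M par B T x0 s (t + 1) ω)) ∂μ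
      ≤ ENNReal.ofReal (par.beta ^ 2)
          * ∫⁻ ω, ENNReal.ofReal (estError M c (restartState M par B T x0 s t ω)) ∂μ
        + ENNReal.ofReal (par.beta ^ 2
            * constP c ‖M.K‖ c0 (B.kappa μ S T) (B.kappaHat μ S T) ^ 2 / (2 * b))
          * ∫⁻ ω, ‖(restartState M par B T x0 s (t + 1) ω).x
              - (restartState M par B T x0 s t ω).x‖ₑ ^ 2 ∂μ
        + ENNReal.ofReal ((1 - par.beta) ^ 2
            * constQ c ‖M.K‖ c0 (B.kappa μ S T) (B.kappaHat μ S T) / (2 * b)) := by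
  have hψ := hpsi.psi_pcc
  have := hM.prob
  have hb' : (1 : ℝ) ≤ b := by exact_mod_cast hb
  have hb1 : 0 < sz.b1 := by
    have : (0 : ℝ) < sz.b1 := by rw [hsz_b1]; positivity
    exact_mod_cast this
  have hb2 : 0 < sz.b2 := by
    have : (0 : ℝ) < sz.b2 := by rw [hsz_b2]; positivity
    exact_mod_cast this
  have hbh1 : 0 < sz.bh1 := by omega
  have hbh2 : 0 < sz.bh2 := by omega
  have htI : t + 1 ∈ Finset.Icc 1 T := Finset.mem_Icc.2 ⟨by omega, ht⟩
  have hD := restartState_mem (B := B) hM hψ hsc hη hθ0 hθ1 T hx0 s t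
  have hD' := restartState_mem (B := B) hM hψ hsc hη hθ0 hθ1 T hx0 s (t + 1)
  have hst := measurableState_restartState (B := B) hM hψ hsc hη hθ0 hθ1 hx0 hs ht.le
  have hst' := measurableState_restartState (B := B) hM hψ hsc hη hθ0 hθ1 hx0 hs (Nat.succ_le_of_lt ht)
  have hX : Measurable[B.hist S T s (t + 1)]
      fun ω => (⟨(restartState M par B T x0 s t ω).x, hD ω⟩ : M.domPsi0) := hst.x.subtype_mk
  have hX' : Measurable[B.hist S T s (t + 1)]
      fun ω => (⟨(restartState M par B T x0 s (t + 1) ω).x, hD' ω⟩ : M.domPsi0) :=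
    (hst.nextPoint (par := par) hM hψ hsc hη).subtype_mk
  have hind := hB.indep_hist hs (Nat.succ_lt_succ ht)
  have e1 := (hM.oracleF hF hψ hsc).lintegral_hybrid_error_le (hB.hist_le s (t + 1)) hb1 hb2
    (hB.iid_B1 s hs _ htI) (hB.iid_B2 s hs _ htI) (indep_of_indep_of_le_right hind le_sup_left)
    (B.kappa_spec μ hs htI) hX hX' hst.Ft par.beta
  have e2 := (hM.oracleJ hF).lintegral_hybrid_error_le (hB.hist_le s (t + 1)) hbh1 hbh2
    (hB.iid_Bh1 s hs _ htI) (hB.iid_Bh2 s hs _ htI) (indep_of_indep_of_le_right hind le_sup_right)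
    (B.kappaHat_spec μ hs htI) hX hX' ((columns p q).continuous.measurable.comp hst.Jt) par.beta
  have e2' := le_trans (le_of_eq (lintegral_congr (μ := μ)
    (f := fun ω => ‖columns p q (restartState M par B T x0 s (t + 1) ω).Jt
      - columns p q (M.meanJ (restartState M par B T x0 s (t + 1) ω).x)‖ₑ ^ 2) fun ω => by
    congr 3
    refine (map_add _ _ _).trans (congrArg₂ _ ((map_add _ _ _).trans (congrArg₂ _ (map_smul _ _ _)
      ((map_smul _ _ _).trans (congrArg _ ((map_sum _ _ _).trans ?_)))))
      ((map_smul _ _ _).trans (congrArg _ (map_sum _ _ _))))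
    exact Finset.sum_congr rfl fun i _ => map_sub _ _ _)) e2
  have hκ := B.one_le_kappa μ S T
  have hκh := B.one_le_kappaHat μ S T
  have hEm : Measurable fun ω => estError M c (restartState M par B T x0 s t ω) :=
    measurable_estError hM hF hψ hsc (hst.mono (hB.hist_le s (t + 1))) hD
  have hΔm : Measurable fun ω => (restartState M par B T x0 s (t + 1) ω).x
      - (restartState M par B T x0 s t ω).x :=
    (hst'.mono (hB.hist_le s _)).x.sub (hst.mono (hB.hist_le s _)).x
  have hsplit : ENNReal.ofReal (par.beta ^ 2)
          * ∫⁻ ω, ENNReal.ofReal (estError M c (restartState M par B T x0 s t ω)) ∂μ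
        + ENNReal.ofReal (par.beta ^ 2
            * constP c ‖M.K‖ c0 (B.kappa μ S T) (B.kappaHat μ S T) ^ 2 / (2 * b))
          * ∫⁻ ω, ‖(restartState M par B T x0 s (t + 1) ω).x
              - (restartState M par B T x0 s t ω).x‖ₑ ^ 2 ∂μ
        + ENNReal.ofReal ((1 - par.beta) ^ 2
            * constQ c ‖M.K‖ c0 (B.kappa μ S T) (B.kappaHat μ S T) / (2 * b))
      = ∫⁻ ω, ENNReal.ofReal (par.beta ^ 2 * estError M c (restartState M par B T x0 s t ω)
          + par.beta ^ 2
            * constP c ‖M.K‖ c0 (B.kappa μ S T) (B.kappaHat μ S T) ^ 2 / (2 * b)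
            * ‖(restartState M par B T x0 s (t + 1) ω).x
              - (restartState M par B T x0 s t ω).x‖ ^ 2
          + (1 - par.beta) ^ 2
            * constQ c ‖M.K‖ c0 (B.kappa μ S T) (B.kappaHat μ S T) / (2 * b)) ∂μ := by
    have hQ0 : 0 ≤ constQ c ‖M.K‖ c0 (B.kappa μ S T) (B.kappaHat μ S T) := by
      unfold constQ; positivity
    rw [← lintegral_const_mul _ hEm.ennreal_ofReal,
      ← lintegral_const_mul _ (hΔm.enorm.pow_const 2),
      ← lintegral_add_left (hEm.ennreal_ofReal.const_mul _)]
    have hconst : ENNReal.ofReal ((1 - par.beta) ^ 2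
        * constQ c ‖M.K‖ c0 (B.kappa μ S T) (B.kappaHat μ S T) / (2 * b))
        = ∫⁻ _, ENNReal.ofReal ((1 - par.beta) ^ 2
        * constQ c ‖M.K‖ c0 (B.kappa μ S T) (B.kappaHat μ S T) / (2 * b)) ∂μ := by simp
    rw [hconst, ← lintegral_add_right _ measurable_const]
    refine lintegral_congr fun ω => ?_
    have hE0 := estError_nonneg M c (restartState M par B T x0 s t ω)
    rw [ENNReal.ofReal_add (by positivity) (by positivity),
      ENNReal.ofReal_add (by positivity) (by positivity), ENNReal.ofReal_mul (sq_nonneg _),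
      ENNReal.ofReal_mul (p := par.beta ^ 2 * _ ^ 2 / _) (by positivity), ofReal_norm_sq]
  rw [hsplit]
  have hlhs : ∫⁻ ω, ENNReal.ofReal (estError M c (restartState M par B T x0 s (t + 1) ω)) ∂μ = _ :=
    lintegral_ofReal_comb
      (measurable_errF hM hF hψ hsc (hst'.mono (hB.hist_le s _)) hD')
      (measurable_errJ hM hF (hst'.mono (hB.hist_le s _)) hD')
      (a := 13 / 9 * (c.MF ^ 2 * ‖M.K‖ ^ 4)) (b := 13 / 9 * (c.Mpsi ^ 2 * ‖M.K‖ ^ 2))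
      (by positivity) (by positivity)
  rw [hlhs]
  refine (add_le_add (mul_le_mul' le_rfl e1) (mul_le_mul' le_rfl e2')).trans ?_
  refine (add_le_add (lintegral_const_mul_le _ _) (lintegral_const_mul_le _ _)).trans ?_
  refine (le_lintegral_add _ _).trans (lintegral_mono fun ω => ?_)
  have hP2 := sq_constP c ‖M.K‖ hc0 (zero_le_one.trans hκ) (zero_le_one.trans hκh)
  generalize B.kappa μ S T = κ at hκ hP2 ⊢
  generalize B.kappaHat μ S T = κh at hκh hP2 ⊢
  simp only
  rw [← ENNReal.ofReal_mul (by positivity), ← ENNReal.ofReal_mul (by positivity),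
    ← ENNReal.ofReal_add (by positivity) (by positivity), hsz_bh1, hsz_bh2, hsz_b1, hsz_b2, hP2]
  -- An equality: the factor 26/9 in P² and Q is twice the weight 13/9, which explains the
  -- denominators 2b.
  refine ENNReal.ofReal_le_ofReal (le_of_eq ?_)
  unfold estError constQ
  simp only [Function.comp_apply]
  field_simp
  ring

/-- Expected progress of one step. -/
theorem lintegral_step_descent {L : ℝ} (hL : L = constL c ‖M.K‖) (hL0 : 0 < L)
    (hθ0' : 0 < par.theta) (hη' : par.eta = 2 / (L * (3 + par.theta))) {s t : ℕ} (hs : s < S)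
    (ht : t ≤ T) :
    ∫⁻ ω, ENNReal.ofReal ((M.Psi0 (restartState M par B T x0 s (t + 1) ω).x).toReal
          - M.Psi0Star.toReal) ∂μ
        + ENNReal.ofReal (par.theta / (16 * L)) * ∫⁻ ω, ENNReal.ofReal
          (‖M.gradMap par.eta (restartState M par B T x0 s t ω).x‖ ^ 2) ∂μ
        + ENNReal.ofReal (L / (2 * par.theta)) * ∫⁻ ω,
          ‖(restartState M par B T x0 s (t + 1) ω).x - (restartState M par B T x0 s t ω).x‖ₑ ^ 2 ∂μ
      ≤ ∫⁻ ω, ENNReal.ofReal ((M.Psi0 (restartState M par B T x0 s t ω).x).toReal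
          - M.Psi0Star.toReal) ∂μ
        + ENNReal.ofReal (par.theta / L)
          * ∫⁻ ω, ENNReal.ofReal (estError M c (restartState M par B T x0 s t ω)) ∂μ := by
  have hψ := hpsi.psi_pcc
  have hD := restartState_mem (B := B) hM hψ hsc hη hθ0 hθ1 T hx0 s t
  have hD' := restartState_mem (B := B) hM hψ hsc hη hθ0 hθ1 T hx0 s (t + 1)
  have hst := measurableState_restartState (B := B) hM hψ hsc hη hθ0 hθ1 hx0 hs ht
  have hEm : Measurable fun ω => estError M c (restartState M par B T x0 s t ω) :=
    measurable_estError hM hF hψ hsc (hst.mono (hB.hist_le s (t + 1))) hD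
  rw [← lintegral_const_mul _ hEm.ennreal_ofReal,
    ← lintegral_add_right _ (hEm.ennreal_ofReal.const_mul _)]
  -- The left side is gathered under one integral by inequalities valid for arbitrary integrands, so
  -- measurability of Ψ₀ along the iterates is not needed.
  refine (add_le_add (add_le_add le_rfl (lintegral_const_mul_le _ _))
    (lintegral_const_mul_le _ _)).trans ?_
  refine (add_le_add (le_lintegral_add _ _) le_rfl).trans ?_
  refine (le_lintegral_add _ _).trans (lintegral_mono fun ω => ?_)
  have h1 := hM.step_descent hF hpsi hsc (hD ω)
    (ContinuousLinearMap.adjoint (restartState M par B T x0 s t ω).Jt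
      (M.K (M.yStar (restartState M par B T x0 s t ω).Ft))) hL hL0 hθ0' hθ1 hη'
    (x' := (restartState M par B T x0 s (t + 1) ω).x) rfl
  have h2 := hM.norm_estimator_sub_meanGrad_sq_le hF hpsi hsc (hD ω)
    (restartState M par B T x0 s t ω).Ft (restartState M par B T x0 s t ω).Jt
  have h3 := hM.Psi0Star_le hψ hsc (hD ω)
  have h4 := hM.Psi0Star_le hψ hsc (hD' ω)
  have hE0 := estError_nonneg M c (restartState M par B T x0 s t ω)
  simp only
  rw [← ofReal_norm_sq, ← ENNReal.ofReal_mul (by positivity), ← ENNReal.ofReal_mul (by positivity),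
    ← ENNReal.ofReal_mul (by positivity),
    ← ENNReal.ofReal_add (sub_nonneg.2 h4) (by positivity),
    ← ENNReal.ofReal_add (add_nonneg (sub_nonneg.2 h4) (by positivity)) (by positivity),
    ← ENNReal.ofReal_add (sub_nonneg.2 h3) (by positivity)]
  refine ENNReal.ofReal_le_ofReal ?_
  have h5 : 13 * par.theta / (18 * L) * (2 * (c.MF ^ 2 * ‖M.K‖ ^ 4
        * ‖(restartState M par B T x0 s t ω).Ft - M.F (restartState M par B T x0 s t ω).x‖ ^ 2
        + c.Mpsi ^ 2 * ‖M.K‖ ^ 2 * ‖columns p q (restartState M par B T x0 s t ω).Jt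
          - columns p q (M.meanJ (restartState M par B T x0 s t ω).x)‖ ^ 2))
      = par.theta / L * estError M c (restartState M par B T x0 s t ω) := by
    unfold estError
    field_simp
    ring
  have h6 := mul_le_mul_of_nonneg_left h2 (show 0 ≤ 13 * par.theta / (18 * L) by positivity)
  rw [h5] at h6
  linarith

end Recursion

/-- Summation of the one step estimates over a stage, by a Lyapunov function. -/
theorem sum_le_of_lyapunov {D a G Δ : ℕ → ℝ≥0∞} {c₁ c₂ c₃ c₄ c₅ c₆ β₂ w : ℝ≥0∞} {T : ℕ}
    (h1 : ∀ t ≤ T, D (t + 1) + c₁ * G t + c₂ * Δ t ≤ D t + c₃ * a t)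
    (h2 : ∀ t < T, a (t + 1) ≤ β₂ * a t + c₄ * Δ t + c₅) (h0 : a 0 ≤ c₆)
    (hw1 : c₃ + w * β₂ ≤ w) (hw2 : w * c₄ ≤ c₂) :
    D (T + 1) + c₁ * ∑ t ∈ Finset.range (T + 1), G t ≤ D 0 + w * (c₆ + T * c₅) := by
  -- The Lyapunov function is D + w·a: the drop of w·a under β₂ pays for c₃·a, and the decrease c₂·Δ
  -- pays for w·c₄·Δ. Keeping all terms additive avoids subtraction of possibly infinite quantities.
  have key : ∀ k ≤ T, D k + w * a k + c₁ * ∑ t ∈ Finset.range k, G t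
      ≤ D 0 + w * (c₆ + k * c₅) := by
    intro k
    induction k with
    | zero => intro _; simpa using add_le_add le_rfl (mul_le_mul' le_rfl h0)
    | succ k ih =>
      intro hk
      have ih' := ih (by omega)
      have h3 : D (k + 1) + w * a (k + 1) + c₁ * G k ≤ D k + w * a k + w * c₅ := by
        calc D (k + 1) + w * a (k + 1) + c₁ * G k
            ≤ D (k + 1) + w * (β₂ * a k + c₄ * Δ k + c₅) + c₁ * G k := by
              gcongr; exact h2 k (by omega)
          _ = D (k + 1) + c₁ * G k + w * c₄ * Δ k + w * β₂ * a k + w * c₅ := by ring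
          _ ≤ D (k + 1) + c₁ * G k + c₂ * Δ k + w * β₂ * a k + w * c₅ := by gcongr
          _ ≤ D k + c₃ * a k + w * β₂ * a k + w * c₅ :=
              add_le_add (add_le_add (h1 k (by omega)) le_rfl) le_rfl
          _ = D k + (c₃ + w * β₂) * a k + w * c₅ := by ring
          _ ≤ D k + w * a k + w * c₅ := by gcongr
      rw [Finset.sum_range_succ]
      calc D (k + 1) + w * a (k + 1) + c₁ * (∑ t ∈ Finset.range k, G t + G k)
          = D (k + 1) + w * a (k + 1) + c₁ * G k + c₁ * ∑ t ∈ Finset.range k, G t := by ring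
        _ ≤ D k + w * a k + w * c₅ + c₁ * ∑ t ∈ Finset.range k, G t := by gcongr
        _ = D k + w * a k + c₁ * ∑ t ∈ Finset.range k, G t + w * c₅ := by ring
        _ ≤ D 0 + w * (c₆ + k * c₅) + w * c₅ := by gcongr
        _ = _ := by push_cast; ring
  rw [Finset.sum_range_succ]
  -- The last step T is followed by no new estimator, so c₃ ≤ w is enough, and the noise c₅ is
  -- counted T times instead of T + 1.
  have hw3 : c₃ ≤ w := le_trans le_self_add hw1
  calc D (T + 1) + c₁ * (∑ t ∈ Finset.range T, G t + G T)
      = D (T + 1) + c₁ * G T + c₁ * ∑ t ∈ Finset.range T, G t := by ring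
    _ ≤ D (T + 1) + c₁ * G T + c₂ * Δ T + c₁ * ∑ t ∈ Finset.range T, G t :=
        add_le_add le_self_add le_rfl
    _ ≤ D T + c₃ * a T + c₁ * ∑ t ∈ Finset.range T, G t :=
        add_le_add (h1 T le_rfl) le_rfl
    _ ≤ D T + w * a T + c₁ * ∑ t ∈ Finset.range T, G t := by gcongr
    _ ≤ _ := key T le_rfl

/-! ### Summation over the stages -/

section Output

open MinimaxProblem

theorem lintegral_prod_uniformOn {W ι : Type*} [MeasurableSpace W] {μ : Measure W}
    [IsProbabilityMeasure μ] [Fintype ι] [Nonempty ι] [MeasurableSpace ι]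
    [MeasurableSingletonClass ι] {f : W → ι → ℝ≥0∞} (hf : ∀ i, Measurable fun ω => f ω i) :
    ∫⁻ z : W × ι, f z.1 z.2 ∂(μ.prod (uniformOn (Set.univ : Set ι)))
      = (Fintype.card ι : ℝ≥0∞)⁻¹ * ∑ i, ∫⁻ ω, f ω i ∂μ := by
  have hm : Measurable fun z : W × ι => f z.1 z.2 := measurable_from_prod_countable_left hf
  have : IsProbabilityMeasure (uniformOn (Set.univ : Set ι)) :=
    isProbabilityMeasure_uniformOn Set.finite_univ Set.univ_nonempty
  rw [lintegral_prod_symm _ hm.aemeasurable]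
  have : uniformOn (Set.univ : Set ι) = (Fintype.card ι : ℝ≥0∞)⁻¹ • Measure.count := by
    rw [uniformOn, ProbabilityTheory.cond, Measure.restrict_univ]
    congr 2
    rw [← Finset.coe_univ, Measure.count_apply_finset, Finset.card_univ]
  rw [this, lintegral_smul_measure, lintegral_count, tsum_fintype, smul_eq_mul]

variable {p q n : ℕ} {W Ω : Type*} [mW : MeasurableSpace W] [MeasurableSpace Ω] {sz : BatchSizes}
  {M : MinimaxProblem p q n Ω} {c : Constants} {par : StepParams} {B : MiniBatches W Ω sz}
  {μ : Measure W} [IsProbabilityMeasure μ] {c0 : ℝ} {b bh0 S T : ℕ} {x0 : Vec p}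

theorem expSqGradMap_eq (hM : StandingAssumption M) (hF : AssumptionF M c)
    (hpsi : AssumptionPsi M c) (hsc : EStronglyConvex 1 M.psi) (hx0 : x0 ∈ M.domPsi0)
    (hB : B.IsSampling μ M.law S T) (hη : 0 < par.eta) (hθ0 : 0 ≤ par.theta)
    (hθ1 : par.theta ≤ 1) {S' : ℕ} (hS'1 : 1 ≤ S') (hS' : S' ≤ S) :
    expSqGradMap M par B μ T x0 S' = ((S' : ℝ≥0∞) * (T + 1))⁻¹
      * ∑ s ∈ Finset.range S', ∑ t ∈ Finset.range (T + 1), ∫⁻ ω, ENNReal.ofReal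
          (‖M.gradMap par.eta (restartState M par B T x0 s t ω).x‖ ^ 2) ∂μ := by
  have hψ := hpsi.psi_pcc
  have : Nonempty (Fin S' × Fin (T + 1)) := ⟨(⟨0, hS'1⟩, 0)⟩
  unfold expSqGradMap
  refine (lintegral_prod_uniformOn (f := fun ω (i : Fin S' × Fin (T + 1)) => ENNReal.ofReal
    (‖M.gradMap par.eta (restartState M par B T x0 i.1 i.2 ω).x‖ ^ 2)) fun i => ?_).trans ?_
  · have hst := measurableState_restartState (B := B) hM hψ hsc hη hθ0 hθ1 hx0
      (lt_of_lt_of_le i.1.2 hS') (Nat.lt_succ_iff.1 i.2.2)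
    have hX : Measurable fun ω => (⟨(restartState M par B T x0 i.1 i.2 ω).x,
        restartState_mem hM hψ hsc hη hθ0 hθ1 T hx0 i.1 i.2 ω⟩ : M.domPsi0) :=
      (hst.mono (hB.hist_le _ _)).x.subtype_mk
    exact (((hM.measurable_gradMap hF hψ hsc hη).comp hX).norm.pow_const 2).ennreal_ofReal
  · rw [Fintype.sum_prod_type, Finset.sum_range fun s => ∑ t ∈ Finset.range (T + 1), ∫⁻ ω,
      ENNReal.ofReal (‖M.gradMap par.eta (restartState M par B T x0 s t ω).x‖ ^ 2) ∂μ]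
    congr 1
    · simp
    · exact Finset.sum_congr rfl fun s _ => (Finset.sum_range fun t => ∫⁻ ω,
        ENNReal.ofReal (‖M.gradMap par.eta (restartState M par B T x0 s t ω).x‖ ^ 2) ∂μ).symm

/-- Each stage loses at most the constant C through estimation noise, while the objective gap
telescopes from stage to stage. The weight w is left open under the two conditions of the Lyapunov
argument. -/
theorem sum_lintegral_gradMap_le (hM : StandingAssumption M) (hF : AssumptionF M c)
    (hpsi : AssumptionPsi M c) (hsc : EStronglyConvex 1 M.psi) (hx0 : x0 ∈ M.domPsi0)
    (hc0 : 0 < c0) (hB : B.IsSampling μ M.law S T) (hb : 1 ≤ b) (hbh0 : 1 ≤ bh0)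
    (hsz_b0 : (sz.b0 : ℝ) = c0 * bh0) (hsz_bh0 : sz.bh0 = bh0)
    (hsz_b1 : (sz.b1 : ℝ) = c0 * b) (hsz_b2 : (sz.b2 : ℝ) = c0 * b)
    (hsz_bh1 : sz.bh1 = b) (hsz_bh2 : sz.bh2 = b) {P Q L w : ℝ}
    (hP : P = constP c ‖M.K‖ c0 (B.kappa μ S T) (B.kappaHat μ S T))
    (hQ : Q = constQ c ‖M.K‖ c0 (B.kappa μ S T) (B.kappaHat μ S T))
    (hL : L = constL c ‖M.K‖) (hL0 : 0 < L) (hθ0 : 0 < par.theta) (hθ1 : par.theta ≤ 1)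
    (hη' : par.eta = 2 / (L * (3 + par.theta))) (hw0 : 0 ≤ w)
    (hw1 : par.theta / L + w * par.beta ^ 2 ≤ w)
    (hw2 : w * (par.beta ^ 2 * P ^ 2 / (2 * b)) ≤ L / (2 * par.theta)) {S' : ℕ} (hS' : S' ≤ S) :
    ENNReal.ofReal (par.theta / (16 * L)) * ∑ s ∈ Finset.range S', ∑ t ∈ Finset.range (T + 1),
        ∫⁻ ω, ENNReal.ofReal (‖M.gradMap par.eta (restartState M par B T x0 s t ω).x‖ ^ 2) ∂μ
      ≤ ENNReal.ofReal ((M.Psi0 x0).toReal - M.Psi0Star.toReal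
        + S' * (w * (Q / (2 * bh0) + T * ((1 - par.beta) ^ 2 * Q / (2 * b))))) := by
  have hη : 0 < par.eta := by rw [hη']; positivity
  have hψ := hpsi.psi_pcc
  have hQ0 : 0 ≤ Q := by
    have h1 := B.one_le_kappa μ S T
    have h2 := B.one_le_kappaHat μ S T
    rw [hQ]; unfold constQ; positivity
  have hgap := hM.Psi0Star_le hψ hsc hx0
  set D : ℕ → ℕ → ℝ≥0∞ := fun s t => ∫⁻ ω, ENNReal.ofReal
    ((M.Psi0 (restartState M par B T x0 s t ω).x).toReal - M.Psi0Star.toReal) ∂μ with hD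
  set G : ℕ → ℕ → ℝ≥0∞ := fun s t => ∫⁻ ω, ENNReal.ofReal
    (‖M.gradMap par.eta (restartState M par B T x0 s t ω).x‖ ^ 2) ∂μ with hG
  set C : ℝ := w * (Q / (2 * bh0) + T * ((1 - par.beta) ^ 2 * Q / (2 * b))) with hC
  have hC0 : 0 ≤ C := by positivity
  have stage : ∀ s < S, D s (T + 1) + ENNReal.ofReal (par.theta / (16 * L))
      * ∑ t ∈ Finset.range (T + 1), G s t ≤ D s 0 + ENNReal.ofReal C := by
    intro s hs
    have hsum := sum_le_of_lyapunov (D := D s) (G := G s) (T := T)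
      (w := ENNReal.ofReal w)
      (fun t ht => lintegral_step_descent hM hF hpsi hsc hx0 hc0 hB hη hθ0.le hθ1 hL hL0 hθ0 hη'
        hs ht)
      (fun t ht => lintegral_estError_succ_le hM hF hpsi hsc hx0 hc0 hB hη hθ0.le hθ1 hb hsz_b1
        hsz_b2 hsz_bh1 hsz_bh2 hs ht)
      (lintegral_estError_init_le hM hF hpsi hsc hx0 hc0 hB hη hθ0.le hθ1 hbh0 hsz_b0 hsz_bh0 hs)
      (by
        rw [← ENNReal.ofReal_mul hw0, ← ENNReal.ofReal_add (by positivity) (by positivity)]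
        exact ENNReal.ofReal_le_ofReal hw1)
      (by
        rw [← ENNReal.ofReal_mul hw0, ← hP]
        exact ENNReal.ofReal_le_ofReal hw2)
    refine hsum.trans (le_of_eq ?_)
    rw [← hQ, ← ENNReal.ofReal_natCast T, ← ENNReal.ofReal_mul (by positivity),
      ← ENNReal.ofReal_add (by positivity) (by positivity), ← ENNReal.ofReal_mul hw0]
  have total : ∀ k ≤ S, D k 0 + ENNReal.ofReal (par.theta / (16 * L))
      * ∑ s ∈ Finset.range k, ∑ t ∈ Finset.range (T + 1), G s t
      ≤ D 0 0 + k * ENNReal.ofReal C := by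
    intro k
    induction k with
    | zero => intro _; simp
    | succ k ih =>
      intro hk
      -- Only the point of the state enters D, and x_{T+1} is determined by the state at T; no batch
      -- is drawn at iteration T + 1.
      have hDk : D (k + 1) 0 = D k (T + 1) := rfl
      rw [Finset.sum_range_succ, hDk]
      calc _ = (D k (T + 1) + ENNReal.ofReal (par.theta / (16 * L))
              * ∑ t ∈ Finset.range (T + 1), G k t) + ENNReal.ofReal (par.theta / (16 * L))
              * ∑ s ∈ Finset.range k, ∑ t ∈ Finset.range (T + 1), G s t := by ring
        _ ≤ (D k 0 + ENNReal.ofReal C) + ENNReal.ofReal (par.theta / (16 * L))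
              * ∑ s ∈ Finset.range k, ∑ t ∈ Finset.range (T + 1), G s t :=
            add_le_add (stage k (by omega)) le_rfl
        _ = (D k 0 + ENNReal.ofReal (par.theta / (16 * L))
              * ∑ s ∈ Finset.range k, ∑ t ∈ Finset.range (T + 1), G s t) + ENNReal.ofReal C := by
            ring
        _ ≤ (D 0 0 + k * ENNReal.ofReal C) + ENNReal.ofReal C := add_le_add (ih (by omega)) le_rfl
        _ = _ := by push_cast; ring
  have hD0 : D 0 0 = ENNReal.ofReal ((M.Psi0 x0).toReal - M.Psi0Star.toReal) := by
    have : ∀ ω, (restartState M par B T x0 0 0 ω).x = x0 := fun ω => rfl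
    simp only [hD, this]
    simp
  refine (le_trans le_add_self (total S' hS')).trans (le_of_eq ?_)
  rw [hD0, ← ENNReal.ofReal_natCast S', ← ENNReal.ofReal_mul (by positivity),
    ← ENNReal.ofReal_add (sub_nonneg.2 hgap) (by positivity)]

/-! ### The number of evaluations -/

theorem innerRun_eval (s : ℕ) (ω : W) (start : StageStart p) (t : ℕ) :
    (innerRun M par B s ω start t).evalF = start.evalF + sz.b0 + t * (2 * sz.b1 + sz.b2) ∧
    (innerRun M par B s ω start t).evalJ = start.evalJ + sz.bh0 + t * (2 * sz.bh1 + sz.bh2) := by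
  induction t with
  | zero => simp [innerRun, initState]
  | succ t ih =>
    simp only [innerRun, innerStep, ih.1, ih.2]
    constructor <;> ring

theorem restartRun_eval (ω : W) (s : ℕ) :
    (restartRun M par B T x0 ω s).evalF = s * (sz.b0 + T * (2 * sz.b1 + sz.b2)) ∧
    (restartRun M par B T x0 ω s).evalJ = s * (sz.bh0 + T * (2 * sz.bh1 + sz.bh2)) := by
  induction s with
  | zero => simp [restartRun]
  | succ s ih =>
    simp only [restartRun, innerRun_eval, ih.1, ih.2]
    constructor <;> ring

end Output

/-! ### The parameters -/

/-- All exponents in the parameters are multiples of 1/4, so in terms of fourth roots every identity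
becomes rational. -/
theorem rpow_quarters {x : ℝ} (hx : 0 ≤ x) :
    x = (x ^ (1 / 4 : ℝ)) ^ 4 ∧ x ^ (1 / 2 : ℝ) = (x ^ (1 / 4 : ℝ)) ^ 2
      ∧ x ^ (3 / 4 : ℝ) = (x ^ (1 / 4 : ℝ)) ^ 3 := by
  refine ⟨?_, ?_, ?_⟩ <;> rw [← Real.rpow_natCast, ← Real.rpow_mul hx] <;> norm_num

section Parameters

variable {p q n : ℕ} {W Ω : Type*} [mW : MeasurableSpace W] [MeasurableSpace Ω] {sz : BatchSizes}
  {M : MinimaxProblem p q n Ω} {c : Constants} {par : StepParams} {B : MiniBatches W Ω sz}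
  {μ : Measure W} [IsProbabilityMeasure μ] {c0 : ℝ} {b bh0 S T : ℕ} {x0 : Vec p}

/-- The convergence estimate, for any number of stages that is covered by the sampling. -/
theorem expSqGradMap_le (hM : StandingAssumption M) (hF : AssumptionF M c)
    (hpsi : AssumptionPsi M c) (hsc : EStronglyConvex 1 M.psi) (hK : M.K ≠ 0)
    (hx0 : x0 ∈ M.domPsi0)
    (hc0 : 0 < c0) (hB : B.IsSampling μ M.law S T) (hb : 1 ≤ b) (hbh0 : 1 ≤ bh0)
    (hsz_b0 : (sz.b0 : ℝ) = c0 * bh0) (hsz_bh0 : sz.bh0 = bh0)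
    (hsz_b1 : (sz.b1 : ℝ) = c0 * b) (hsz_b2 : (sz.b2 : ℝ) = c0 * b)
    (hsz_bh1 : sz.bh1 = b) (hsz_bh2 : sz.bh2 = b) {P Q L : ℝ}
    (hP : P = constP c ‖M.K‖ c0 (B.kappa μ S T) (B.kappaHat μ S T))
    (hQ : Q = constQ c ‖M.K‖ c0 (B.kappa μ S T) (B.kappaHat μ S T))
    (hL : L = constL c ‖M.K‖) (hb_le : b ≤ bh0 * (T + 1))
    (hcfg : L ^ 4 / P ^ 4 < (bh0 : ℝ) * (T + 1) / (b : ℝ) ^ 3)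
    (hpar : par = stepParams L P b bh0 T) {S' : ℕ} (hS'1 : 1 ≤ S') (hS' : S' ≤ S) :
    expSqGradMap M par B μ T x0 S' ≤ ENNReal.ofReal
      (16 * P * (bh0 : ℝ) ^ (1 / 4 : ℝ) / (S' * ((b : ℝ) * (T + 1)) ^ (3 / 4 : ℝ))
          * ((M.Psi0 x0).toReal - M.Psi0Star.toReal)
        + 16 * Q / ((bh0 : ℝ) * b * (T + 1)) ^ (1 / 2 : ℝ)) := by
  have hψ := hpsi.psi_pcc
  have hK0 : 0 < ‖M.K‖ := norm_pos_iff.2 hK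
  have hκ := B.one_le_kappa μ S T
  have hκh := B.one_le_kappaHat μ S T
  have hMF := hF.MF_pos
  have hLF := hF.LF_pos
  have hMψ := hpsi.Mpsi_pos
  have hL0 : 0 < L := by rw [hL]; unfold constL; positivity
  have hP0 : 0 < P := by
    rw [hP]; unfold constP
    have : 0 < B.kappa μ S T := by linarith
    positivity
  have hQ0 : 0 ≤ Q := by rw [hQ]; unfold constQ; positivity
  have hbR : (1 : ℝ) ≤ b := by exact_mod_cast hb
  have hbh0R : (1 : ℝ) ≤ bh0 := by exact_mod_cast hbh0
  have hS'R : (1 : ℝ) ≤ S' := by exact_mod_cast hS'1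
  have hT1 : (0 : ℝ) ≤ T := Nat.cast_nonneg T
  have hbleR : (b : ℝ) ≤ bh0 * (T + 1) := by exact_mod_cast hb_le
  obtain ⟨u4, u2, u3⟩ := rpow_quarters (show (0 : ℝ) ≤ b by linarith)
  obtain ⟨v4, v2, _⟩ := rpow_quarters (show (0 : ℝ) ≤ bh0 by linarith)
  obtain ⟨τ4, τ2, τ3⟩ := rpow_quarters (show (0 : ℝ) ≤ T + 1 by linarith)
  set u := (b : ℝ) ^ (1 / 4 : ℝ) with hu
  set v := (bh0 : ℝ) ^ (1 / 4 : ℝ) with hv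
  set τ := ((T : ℝ) + 1) ^ (1 / 4 : ℝ) with hτ
  have hu0 : 0 < u := Real.rpow_pos_of_pos (by linarith) _
  have hv0 : 0 < v := Real.rpow_pos_of_pos (by linarith) _
  have hτ0 : 0 < τ := Real.rpow_pos_of_pos (by linarith) _
  have hβ : par.beta = 1 - u ^ 2 / (v ^ 2 * τ ^ 2) := by
    rw [hpar, stepParams, Real.mul_rpow (by linarith) (by linarith), u2, v2, τ2]
  have hθ : par.theta = L * u ^ 3 / (P * (v * τ)) := by
    rw [hpar]
    change L * (b : ℝ) ^ (3 / 4 : ℝ) / (P * ((bh0 : ℝ) * (T + 1)) ^ (1 / 4 : ℝ)) = _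
    rw [Real.mul_rpow (by linarith) (by linarith), u3]
  have hη : par.eta = 2 / (L * (3 + par.theta)) := by
    rw [hpar, stepParams]
  have hθ0 : 0 < par.theta := by rw [hθ]; positivity
  -- The assumed lower bound on b̂₀(T+1)/b³ says exactly that θ⁴ < 1.
  have hθ1 : par.theta ≤ 1 := by
    rw [hθ, div_le_one (by positivity)]
    rw [div_lt_div_iff₀ (by positivity) (by positivity), u4, v4, τ4] at hcfg
    refine (lt_of_pow_lt_pow_left₀ 4 (by positivity) ?_).le
    calc (L * u ^ 3) ^ 4 = L ^ 4 * (u ^ 4) ^ 3 := by ring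
      _ < _ := hcfg
      _ = _ := by ring
  set r := u ^ 2 / (v ^ 2 * τ ^ 2) with hr
  have hr0 : 0 < r := by positivity
  have hr1 : r ≤ 1 := by
    rw [hr, div_le_one (by positivity)]
    rw [u4, v4, τ4] at hbleR
    refine le_of_sq_le_sq ?_ (by positivity)
    calc (u ^ 2) ^ 2 = u ^ 4 := by ring
      _ ≤ _ := hbleR
      _ = _ := by ring
  -- With r = 1 - β and weight w = θ/(Lr), the condition reduces to r + (1 - r)² ≤ 1.
  have hw1 : par.theta / L + par.theta / (L * r) * par.beta ^ 2 ≤ par.theta / (L * r) := by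
    have e : par.theta / L = par.theta / (L * r) * r := by field_simp
    rw [e, ← mul_add, hβ]
    refine mul_le_of_le_one_right (by positivity) ?_
    nlinarith only [mul_nonneg hr0.le (sub_nonneg.2 hr1)]
  -- After β² ≤ 1 this is an equality, θ²P² = L²br, which is what determines θ.
  have hw2 : par.theta / (L * r) * (par.beta ^ 2 * P ^ 2 / (2 * b)) ≤ L / (2 * par.theta) := by
    have h1 : par.beta ^ 2 ≤ 1 := by
      rw [hβ]
      nlinarith only [mul_nonneg hr0.le (sub_nonneg.2 hr1), hr0]
    calc par.theta / (L * r) * (par.beta ^ 2 * P ^ 2 / (2 * b))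
        ≤ par.theta / (L * r) * (1 * P ^ 2 / (2 * b)) := by gcongr
      _ = L / (2 * par.theta) := by
        rw [hθ, hr, u4]; field_simp
  have hη0 : 0 < par.eta := by rw [hη]; positivity
  have hmain := sum_lintegral_gradMap_le hM hF hpsi hsc hx0 hc0 hB hb hbh0 hsz_b0 hsz_bh0 hsz_b1
    hsz_b2 hsz_bh1 hsz_bh2 hP hQ hL hL0 hθ0 hθ1 hη (w := par.theta / (L * r)) (by positivity)
    hw1 hw2 hS'
  rw [expSqGradMap_eq hM hF hpsi hsc hx0 hB hη0 hθ0.le hθ1 hS'1 hS']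
  set tot := ∑ s ∈ Finset.range S', ∑ t ∈ Finset.range (T + 1), ∫⁻ ω, ENNReal.ofReal
          (‖M.gradMap par.eta (restartState M par B T x0 s t ω).x‖ ^ 2) ∂μ
  have hgap := hM.Psi0Star_le hψ hsc hx0
  set gap := (M.Psi0 x0).toReal - M.Psi0Star.toReal
  have hgap0 : 0 ≤ gap := sub_nonneg.2 hgap
  have e1 : tot ≤ ENNReal.ofReal (16 * L / par.theta * (gap + S' * (par.theta / (L * r)
      * (Q / (2 * bh0) + T * ((1 - par.beta) ^ 2 * Q / (2 * b)))))) := by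
    rw [ENNReal.ofReal_mul (by positivity)]
    calc tot = ENNReal.ofReal (16 * L / par.theta)
          * (ENNReal.ofReal (par.theta / (16 * L)) * tot) := by
          rw [← mul_assoc, ← ENNReal.ofReal_mul (by positivity),
            show 16 * L / par.theta * (par.theta / (16 * L)) = 1 by field_simp, ENNReal.ofReal_one,
            one_mul]
      _ ≤ _ := by gcongr
  have e2 : ((S' : ℝ≥0∞) * (T + 1))⁻¹ = ENNReal.ofReal (1 / (S' * (T + 1))) := by
    rw [one_div, ENNReal.ofReal_inv_of_pos (by positivity), ENNReal.ofReal_mul (by positivity),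
      ENNReal.ofReal_add hT1 zero_le_one]
    simp
  rw [e2]
  refine (mul_le_mul' le_rfl e1).trans ?_
  rw [← ENNReal.ofReal_mul (by positivity)]
  refine ENNReal.ofReal_le_ofReal ?_
  have e3 : 1 / (S' * ((T : ℝ) + 1)) * (16 * L / par.theta * (gap + S' * (par.theta / (L * r)
      * (Q / (2 * bh0) + T * ((1 - par.beta) ^ 2 * Q / (2 * b))))))
      = 16 * (L / (par.theta * (T + 1))) / S' * gap
        + 16 * (1 / (r * (T + 1)) * (Q / (2 * bh0) + T * (r ^ 2 * Q / (2 * b)))) := by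
    rw [hβ]; field_simp; ring
  rw [e3]
  refine add_le_add (le_of_eq ?_) ?_
  · rw [Real.mul_rpow (by linarith) (by linarith), u3, τ3, hθ, τ4]
    field_simp
  · have e4 : ((bh0 : ℝ) * b * (T + 1)) ^ (1 / 2 : ℝ) = u ^ 2 * v ^ 2 * τ ^ 2 := by
      rw [Real.mul_rpow (by positivity) (by linarith), Real.mul_rpow (by linarith) (by linarith),
        u2, v2, τ2]
      ring
    -- Since r² = b/(b̂₀(T+1)), the initial error equals T + 1 times the noise of one step. This is
    -- the balance behind β; with T ≤ T + 1 it yields the constant 16.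
    have e5 : Q / (2 * bh0) = (T + 1) * (r ^ 2 * Q / (2 * b)) := by
      rw [hr, u4, v4, τ4]; field_simp
    have e6 : 1 / (r * (T + 1)) * ((T + 1) * (r ^ 2 * Q / (2 * b)) + T * (r ^ 2 * Q / (2 * b)))
        ≤ 1 / (r * (T + 1)) * ((T + 1) * (r ^ 2 * Q / (2 * b)) + (T + 1) * (r ^ 2 * Q / (2 * b))) := by
      gcongr
      linarith
    rw [e5, e4]
    have e7 : 1 / (r * (T + 1)) * ((T + 1) * (r ^ 2 * Q / (2 * b)) + (T + 1) * (r ^ 2 * Q / (2 * b)))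
        = Q / (u ^ 2 * v ^ 2 * τ ^ 2) := by
      rw [hr, u4]; field_simp; ring
    rw [e7] at e6
    calc _ ≤ 16 * (Q / (u ^ 2 * v ^ 2 * τ ^ 2)) := by gcongr
      _ = _ := by ring

end Parameters

/-! ### The complexity estimates -/

section Complexity

/-- Here m is the ideal initial batch size and x² the fraction of it kept by rounding. In the first
term both roundings help; in the second, the loss is the factor 1/x. -/
theorem accuracy_bound_le {P Q D ε gap s m x : ℝ} {b bh0 T S' : ℕ} (hP : 0 < P) (hQ : 0 < Q)
    (hε : 0 < ε) (hD : 0 < D) (hgap : gap ≤ D) (hb : 1 ≤ b) (hbh0 : 1 ≤ bh0) (hS' : 1 ≤ S')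
    (hm : m = 48 * Q / ε ^ 2) (hbm : (bh0 : ℝ) ≤ m) (hmb : m ≤ b * (T + 1)) (hx : 0 < x)
    (hxm : x ^ 2 * m = bh0) (hs : s = 8 * P * D / (ε * Real.sqrt (3 * Q))) :
    16 * P * (bh0 : ℝ) ^ (1 / 4 : ℝ) / (S' * ((b : ℝ) * (T + 1)) ^ (3 / 4 : ℝ)) * gap
        + 16 * Q / ((bh0 : ℝ) * b * (T + 1)) ^ (1 / 2 : ℝ)
      ≤ ε ^ 2 * (s / (2 * S') + 1 / (3 * x)) := by
  have hm0 : 0 < m := by rw [hm]; positivity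
  have hS'R : (1 : ℝ) ≤ S' := by exact_mod_cast hS'
  have hbR : (1 : ℝ) ≤ b := by exact_mod_cast hb
  have hbh0R : (1 : ℝ) ≤ bh0 := by exact_mod_cast hbh0
  obtain ⟨m4, m2, m3⟩ := rpow_quarters hm0.le
  set y := m ^ (1 / 4 : ℝ) with hy
  have hy0 : 0 < y := Real.rpow_pos_of_pos hm0 _
  set g := Real.sqrt (3 * Q) with hg
  have hg0 : 0 < g := Real.sqrt_pos.2 (by positivity)
  have hg2 : g ^ 2 = 3 * Q := Real.sq_sqrt (by positivity)
  have hyg : y ^ 2 * ε = 4 * g := by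
    have h1 : (y ^ 2 * ε) ^ 2 = (4 * g) ^ 2 := by
      have : m * ε ^ 2 = 48 * Q := by rw [hm]; field_simp
      calc (y ^ 2 * ε) ^ 2 = y ^ 4 * ε ^ 2 := by ring
        _ = 48 * Q := by rw [← m4, this]
        _ = 16 * g ^ 2 := by rw [hg2]; ring
        _ = _ := by ring
    exact (sq_eq_sq₀ (by positivity) (by positivity)).1 h1
  rw [mul_add (ε ^ 2)]
  refine add_le_add ?_ ?_
  · have h1 : (bh0 : ℝ) ^ (1 / 4 : ℝ) ≤ y := Real.rpow_le_rpow (by positivity) hbm (by norm_num)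
    have h2 : y ^ 3 ≤ ((b : ℝ) * (T + 1)) ^ (3 / 4 : ℝ) := by
      rw [← m3]
      exact Real.rpow_le_rpow hm0.le hmb (by norm_num)
    calc 16 * P * (bh0 : ℝ) ^ (1 / 4 : ℝ) / (S' * ((b : ℝ) * (T + 1)) ^ (3 / 4 : ℝ)) * gap
        ≤ 16 * P * (bh0 : ℝ) ^ (1 / 4 : ℝ) / (S' * ((b : ℝ) * (T + 1)) ^ (3 / 4 : ℝ)) * D := by
          gcongr
      _ ≤ 16 * P * y / (S' * y ^ 3) * D := by gcongr
      _ = 16 * P * D / (S' * y ^ 2) := by field_simp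
      _ = ε ^ 2 * (s / (2 * S')) := by
          have : y ^ 2 = 4 * g / ε := by rw [← hyg]; field_simp
          rw [hs, this]; field_simp; norm_num
  · have h1 : (bh0 * m) ^ (1 / 2 : ℝ) ≤ ((bh0 : ℝ) * b * (T + 1)) ^ (1 / 2 : ℝ) := by
      refine Real.rpow_le_rpow (by positivity) ?_ (by norm_num)
      rw [mul_assoc]
      gcongr
    have h2 : ((bh0 : ℝ) * m) ^ (1 / 2 : ℝ) = x * m := by
      rw [← hxm, ← Real.sqrt_eq_rpow, show x ^ 2 * m * m = (x * m) ^ 2 by ring,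
        Real.sqrt_sq (by positivity)]
    rw [h2] at h1
    calc 16 * Q / ((bh0 : ℝ) * b * (T + 1)) ^ (1 / 2 : ℝ) ≤ 16 * Q / (x * m) := by gcongr
      _ = _ := by rw [hm]; field_simp; norm_num

/-- The two terms are at most 16/31 and 15/31: the room in 1/2 + 1/3 < 1 covers the worst rounding
x² = 1/2 and a deficit of one stage in 32. -/
theorem stage_ratio_le {s x S' : ℝ} (hx0 : 1 / 2 ≤ x ^ 2) (hx : 0 < x) (hS' : 0 < S')
    (h : 31 / 32 * s ≤ S') : s / (2 * S') + 1 / (3 * x) ≤ 1 := by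
  have h1 : s / (2 * S') ≤ 16 / 31 := by
    rw [div_le_div_iff₀ (by positivity) (by norm_num)]
    linarith
  have h2 : 31 / 45 ≤ x := by
    refine le_of_sq_le_sq ?_ hx.le
    norm_num at hx0 ⊢
    linarith
  have h3 : 1 / (3 * x) ≤ 15 / 31 := by
    rw [div_le_div_iff₀ (by positivity) (by norm_num)]
    linarith
  linarith

/-- When the rounding is mild, three quarters of s suffice for S'x², the quantity to which the cost
bound is proportional. At S' = 3s/(4x²) the sum is 1 exactly for x = 1, and the slack factors as
(1-x)(2x²+2x-1)/(3x). -/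
theorem stage_ratio_le' {s x S' : ℝ} (hx0 : 25 / 32 ≤ x ^ 2) (hx1 : x ≤ 1) (hx : 0 < x)
    (hS' : 0 < S') (h : 3 / 4 * s ≤ S' * x ^ 2) : s / (2 * S') + 1 / (3 * x) ≤ 1 := by
  have h1 : s / (2 * S') ≤ 2 / 3 * x ^ 2 := by
    rw [div_le_iff₀ (by positivity)]
    linarith
  have h2 : 2 / 3 * x ^ 2 + 1 / (3 * x) ≤ 1 := by
    have h3 : 0 ≤ (1 - x) * (2 * x ^ 2 + 2 * x - 1) :=
      mul_nonneg (by linarith) (by linarith)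
    have h4 : 1 - (2 / 3 * x ^ 2 + 1 / (3 * x))
        = (1 - x) * (2 * x ^ 2 + 2 * x - 1) / (3 * x) := by
      field_simp; ring
    have h5 : 0 ≤ (1 - x) * (2 * x ^ 2 + 2 * x - 1) / (3 * x) := div_nonneg h3 (by positivity)
    linarith
  linarith

end Complexity

/-! ### Assembly: convergence, accuracy and evaluation counts -/

theorem mainTheorem7
    {p q n : ℕ} {Ω W : Type*} [MeasurableSpace Ω] [MeasurableSpace W]
    (M : MinimaxProblem p q n Ω) (c : Constants)
    (hM : StandingAssumption M) (hF : AssumptionF M c) (hpsi : AssumptionPsi M c)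
    (hsc : EStronglyConvex 1 M.psi) (hK : M.K ≠ 0)
    (x0 : Vec p) (hx0 : x0 ∈ M.domPsi0)
    -- batch sizes, number of iterations per stage, number of stages
    (c0 : ℝ) (hc0 : 0 < c0) (b bh0 T S : ℕ) (hb : 1 ≤ b) (hbh0 : 1 ≤ bh0) (hS : 1 ≤ S)
    (sz : BatchSizes) (hsz_b0 : (sz.b0 : ℝ) = c0 * bh0) (hsz_bh0 : sz.bh0 = bh0)
    (hsz_b1 : (sz.b1 : ℝ) = c0 * b) (hsz_b2 : (sz.b2 : ℝ) = c0 * b)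
    (hsz_bh1 : sz.bh1 = b) (hsz_bh2 : sz.bh2 = b)
    -- the random mini-batches
    (μ : Measure W) [IsProbabilityMeasure μ] (B : MiniBatches W Ω sz)
    (hB : B.IsSampling μ M.law S T)
    -- the constants and the parameter configuration
    (P Q L : ℝ)
    (hP : P = constP c ‖M.K‖ c0 (B.kappa μ S T) (B.kappaHat μ S T))
    (hQ : Q = constQ c ‖M.K‖ c0 (B.kappa μ S T) (B.kappaHat μ S T))
    (hL : L = constL c ‖M.K‖)
    (hb_le : b ≤ bh0 * (T + 1))
    (hcfg : L ^ 4 / P ^ 4 < (bh0 : ℝ) * (T + 1) / (b : ℝ) ^ 3)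
    (par : StepParams) (hpar : par = stepParams L P b bh0 T)
    (gap : ℝ) (hgap : gap = (M.Psi0 x0).toReal - M.Psi0Star.toReal) :
    -- the convergence estimate
    expSqGradMap M par B μ T x0 S ≤ ENNReal.ofReal
        (16 * P * (bh0 : ℝ) ^ (1 / 4 : ℝ) / (S * ((b : ℝ) * (T + 1)) ^ (3 / 4 : ℝ)) * gap
          + 24 * Q / ((bh0 : ℝ) * b * (T + 1)) ^ (1 / 2 : ℝ))
    ∧
    -- the complexity estimates
    (∀ ε D s : ℝ, 0 < ε → 0 < D → gap ≤ D →
      (b : ℝ) ≤ 48 * Q / ε ^ 2 →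
      T = ⌊48 * Q / (b * ε ^ 2)⌋₊ →
      bh0 = ⌊48 * Q / ε ^ 2⌋₊ →
      s = 8 * P * D / (ε * Real.sqrt (3 * Q)) →
      S = ⌈s⌉₊ →
      -- after `⌈s⌉` stages
      (expSqGradMap M par B μ T x0 S ≤ ENNReal.ofReal (ε ^ 2) ∧
        ∀ ω, ((restartRun M par B T x0 ω S).evalF : ℝ)
            ≤ c0 * (512 * P * Real.sqrt (3 * Q) * D / ε ^ 3 + 192 * Q / ε ^ 2) ∧
          ((restartRun M par B T x0 ω S).evalJ : ℝ)
            ≤ 512 * P * Real.sqrt (3 * Q) * D / ε ^ 3 + 192 * Q / ε ^ 2) ∧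
      -- already after some smaller or equal number of stages
      (∃ S', 1 ≤ S' ∧ S' ≤ S ∧ expSqGradMap M par B μ T x0 S' ≤ ENNReal.ofReal (ε ^ 2) ∧
        ∀ ω, ((restartRun M par B T x0 ω S').evalF : ℝ)
            ≤ c0 * (400 * P * Real.sqrt (3 * Q) * D / ε ^ 3 + 192 * Q / ε ^ 2) ∧
          ((restartRun M par B T x0 ω S').evalJ : ℝ)
            ≤ 400 * P * Real.sqrt (3 * Q) * D / ε ^ 3 + 192 * Q / ε ^ 2) ∧
      -- no rounding term when `s` is not small
      (32 ≤ s →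
        expSqGradMap M par B μ T x0 ⌊s⌋₊ ≤ ENNReal.ofReal (ε ^ 2) ∧
        ∃ S', 1 ≤ S' ∧ S' ≤ ⌊s⌋₊ ∧
          expSqGradMap M par B μ T x0 S' ≤ ENNReal.ofReal (ε ^ 2) ∧
          ∀ ω, ((restartRun M par B T x0 ω S').evalF : ℝ)
              ≤ c0 * (400 * P * Real.sqrt (3 * Q) * D / ε ^ 3) ∧
            ((restartRun M par B T x0 ω S').evalJ : ℝ)
              ≤ 400 * P * Real.sqrt (3 * Q) * D / ε ^ 3)) := by
  have hgap0 : 0 ≤ gap := by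
    rw [hgap]; exact sub_nonneg.2 (hM.Psi0Star_le hpsi.psi_pcc hsc hx0)
  have hκ := B.one_le_kappa μ S T
  have hκh := B.one_le_kappaHat μ S T
  have hK0 : 0 < ‖M.K‖ := norm_pos_iff.2 hK
  have hMF := hF.MF_pos
  have hσF := hF.sigmaF_pos
  have hκ0 : 0 < B.kappa μ S T := by linarith
  have hP0 : 0 < P := by rw [hP]; unfold constP; positivity
  have hQ0 : 0 < Q := by rw [hQ]; unfold constQ; positivity
  have hbR : (1 : ℝ) ≤ b := by exact_mod_cast hb
  have hbh0R : (1 : ℝ) ≤ bh0 := by exact_mod_cast hbh0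
  -- Stopping early keeps the parameters and the constants P, Q of the full sampling with S stages.
  have main : ∀ S', 1 ≤ S' → S' ≤ S → expSqGradMap M par B μ T x0 S' ≤ ENNReal.ofReal
        (16 * P * (bh0 : ℝ) ^ (1 / 4 : ℝ) / (S' * ((b : ℝ) * (T + 1)) ^ (3 / 4 : ℝ)) * gap
          + 16 * Q / ((bh0 : ℝ) * b * (T + 1)) ^ (1 / 2 : ℝ)) := fun S' h1 h2 => by
    rw [hgap]
    exact expSqGradMap_le hM hF hpsi hsc hK hx0 hc0 hB hb hbh0 hsz_b0 hsz_bh0 hsz_b1 hsz_b2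
      hsz_bh1 hsz_bh2 hP hQ hL hb_le hcfg hpar h1 h2
  refine ⟨(main S hS le_rfl).trans (ENNReal.ofReal_le_ofReal ?_), ?_⟩
  · gcongr
    norm_num
  intro ε D s hε hD hgapD hbε hT hbh0ε hs hSs
  set m := 48 * Q / ε ^ 2 with hm
  have hm0 : 0 < m := by positivity
  have hbm : (bh0 : ℝ) ≤ m := by rw [hbh0ε]; exact Nat.floor_le hm0.le
  have hmlt : m < bh0 + 1 := by rw [hbh0ε]; exact Nat.lt_floor_add_one m
  have hmb' : 48 * Q / (b * ε ^ 2) = m / b := by rw [hm]; field_simp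
  rw [hmb'] at hT
  have hmb : m ≤ b * (T + 1) := by
    have : m / b < T + 1 := by rw [hT]; exact Nat.lt_floor_add_one _
    rw [div_lt_iff₀ (by positivity)] at this
    linarith
  -- Hence a stage costs at most b̂₀ + 3bT ≤ 4b̂₀ = 4x²m Jacobian evaluations, and c₀ times as many
  -- evaluations of 𝐅.
  have hbT : b * T ≤ bh0 := by
    rw [hbh0ε]
    refine Nat.le_floor ?_
    have : (T : ℝ) ≤ m / b := by rw [hT]; exact Nat.floor_le (by positivity)
    rw [le_div_iff₀ (by positivity)] at this
    push_cast
    linarith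
  have hbTR : (b : ℝ) * T ≤ bh0 := by exact_mod_cast hbT
  set x := Real.sqrt (bh0 / m) with hx
  have hx0 : 0 < x := Real.sqrt_pos.2 (by positivity)
  have hx2 : x ^ 2 = bh0 / m := Real.sq_sqrt (by positivity)
  have hxm : x ^ 2 * m = bh0 := by rw [hx2]; field_simp
  -- From b̂₀ ≥ 1, as m < b̂₀ + 1 ≤ 2b̂₀.
  have hxhalf : 1 / 2 ≤ x ^ 2 := by
    rw [hx2, div_le_div_iff₀ (by norm_num) hm0]
    linarith
  have hx1' : x ^ 2 ≤ 1 := by rw [hx2, div_le_one hm0]; exact hbm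
  have hx1 : x ≤ 1 := by
    refine le_of_sq_le_sq ?_ zero_le_one
    rwa [one_pow]
  have hg0 : 0 < Real.sqrt (3 * Q) := Real.sqrt_pos.2 (by positivity)
  have hs0 : 0 < s := by rw [hs]; positivity
  have hms : m * s = 128 * P * Real.sqrt (3 * Q) * D / ε ^ 3 := by
    have hg2 : Real.sqrt (3 * Q) ^ 2 = 3 * Q := Real.sq_sqrt (by positivity)
    have hQg : Q = Real.sqrt (3 * Q) ^ 2 / 3 := by rw [hg2]; ring
    rw [hs, hm]
    generalize Real.sqrt (3 * Q) = g at hg0 hQg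
    rw [hQg]; field_simp; norm_num
  have accuracy : ∀ S', 1 ≤ S' → S' ≤ S → s / (2 * (S' : ℝ)) + 1 / (3 * x) ≤ 1 →
      expSqGradMap M par B μ T x0 S' ≤ ENNReal.ofReal (ε ^ 2) := fun S' h1 h2 h3 => by
    refine (main S' h1 h2).trans (ENNReal.ofReal_le_ofReal ?_)
    refine (accuracy_bound_le hP0 hQ0 hε hD hgapD hb hbh0 h1 hm hbm hmb hx0 hxm hs).trans ?_
    exact mul_le_of_le_one_right (by positivity) h3
  have cost : ∀ (S' : ℕ) (C : ℝ), (S' : ℝ) * (4 * (x ^ 2 * m)) ≤ C → ∀ ω,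
      ((restartRun M par B T x0 ω S').evalF : ℝ) ≤ c0 * C ∧
      ((restartRun M par B T x0 ω S').evalJ : ℝ) ≤ C := fun S' C hC ω => by
    have h1 : (S' : ℝ) * (bh0 + T * (2 * b + b)) ≤ C := by
      refine le_trans ?_ hC
      rw [hxm]
      gcongr
      linarith
    rw [(restartRun_eval ω S').1, (restartRun_eval ω S').2, hsz_bh0, hsz_bh1, hsz_bh2]
    push_cast
    rw [hsz_b0, hsz_b1, hsz_b2]
    refine ⟨?_, h1⟩
    calc (S' : ℝ) * (c0 * bh0 + T * (2 * (c0 * b) + c0 * b))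
        = c0 * (S' * (bh0 + T * (2 * b + b))) := by ring
      _ ≤ c0 * C := by gcongr
  have hS1 : s ≤ S := by rw [hSs]; exact Nat.le_ceil s
  have hS2 : (S : ℝ) < s + 1 := by rw [hSs]; exact Nat.ceil_lt_add_one hs0.le
  have hSR : (1 : ℝ) ≤ S := by exact_mod_cast hS
  have accS : s / (2 * (S : ℝ)) + 1 / (3 * x) ≤ 1 :=
    stage_ratio_le hxhalf hx0 (by linarith) (by linarith)
  have e512 : 512 * P * Real.sqrt (3 * Q) * D / ε ^ 3 = 4 * (m * s) := by rw [hms]; ring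
  have e400 : 400 * P * Real.sqrt (3 * Q) * D / ε ^ 3 = 25 / 8 * (m * s) := by rw [hms]; ring
  have e192 : 192 * Q / ε ^ 2 = 4 * m := by rw [hm]; ring
  have hms0 : 0 < m * s := by positivity
  rw [e512, e400, e192]
  refine ⟨⟨accuracy S hS le_rfl accS, cost S _ ?_⟩, ?_, fun hs32 => ?_⟩
  · calc (S : ℝ) * (4 * (x ^ 2 * m)) ≤ (s + 1) * (4 * (1 * m)) := by gcongr
      _ = _ := by ring
  -- The target 400 is 25/32 of 512. If rounding already shrank the batches below this ratio, all S
  -- stages are cheap enough; otherwise r is the number of stages at which rx² = 25s/32, and r ≤ s.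
  · by_cases hcase : 25 / 32 ≤ x ^ 2
    · set r := 25 * s / (32 * x ^ 2) with hr
      have hr0 : 0 < r := by positivity
      have hrx : r * x ^ 2 = 25 / 32 * s := by rw [hr]; field_simp
      have hrs : r ≤ s := by
        rw [hr, div_le_iff₀ (by positivity)]
        linarith [mul_le_mul_of_nonneg_left hcase hs0.le]
      have h1 : r ≤ (⌈r⌉₊ : ℝ) := Nat.le_ceil r
      have h2 : (⌈r⌉₊ : ℝ) < r + 1 := Nat.ceil_lt_add_one hr0.le
      have h3 : ⌈r⌉₊ ≤ S := by rw [hSs]; exact Nat.ceil_le_ceil hrs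
      have h4 : 1 ≤ ⌈r⌉₊ := Nat.one_le_ceil_iff.2 hr0
      refine ⟨⌈r⌉₊, h4, h3, accuracy _ h4 h3
        (stage_ratio_le' hcase hx1 hx0 (by linarith) ?_), cost _ _ ?_⟩
      · have := mul_le_mul_of_nonneg_right h1 (sq_nonneg x)
        linarith
      · calc (⌈r⌉₊ : ℝ) * (4 * (x ^ 2 * m)) ≤ (r + 1) * (4 * (x ^ 2 * m)) := by gcongr
          _ = 4 * m * (r * x ^ 2) + 4 * m * x ^ 2 := by ring
          _ ≤ 4 * m * (r * x ^ 2) + 4 * m * 1 := by gcongr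
          _ = _ := by rw [hrx]; ring
    · push Not at hcase
      refine ⟨S, hS, le_rfl, accuracy S hS le_rfl accS, cost S _ ?_⟩
      calc (S : ℝ) * (4 * (x ^ 2 * m)) ≤ (s + 1) * (4 * (x ^ 2 * m)) := by gcongr
        _ = 4 * (m * s) * x ^ 2 + 4 * m * x ^ 2 := by ring
        _ ≤ 4 * (m * s) * (25 / 32) + 4 * m * 1 := by gcongr
        _ = _ := by ring
  · have hf1 : s < (⌊s⌋₊ : ℝ) + 1 := Nat.lt_floor_add_one s
    have hf2 : (⌊s⌋₊ : ℝ) ≤ s := Nat.floor_le hs0.le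
    have hf3 : 1 ≤ ⌊s⌋₊ := Nat.le_floor (by norm_num; linarith)
    have hf4 : ⌊s⌋₊ ≤ S := by rw [hSs]; exact Nat.floor_le_ceil s
    have accf := accuracy _ hf3 hf4
      (stage_ratio_le (S' := (⌊s⌋₊ : ℝ)) hxhalf hx0 (by linarith) (by linarith))
    refine ⟨accf, ?_⟩
    by_cases hcase : 25 / 32 ≤ x ^ 2
    · set r := 25 * s / (32 * x ^ 2) with hr
      have hr0 : 0 < r := by positivity
      have hrx : r * x ^ 2 = 25 / 32 * s := by rw [hr]; field_simp
      have hrs : r ≤ s := by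
        rw [hr, div_le_iff₀ (by positivity)]
        linarith [mul_le_mul_of_nonneg_left hcase hs0.le]
      -- This makes ⌊r⌋ positive. For accuracy, rounding r down costs at most x² ≤ 1 ≤ s/32, exactly
      -- the gap between 25/32 and the required 3/4.
      have hr25 : 25 ≤ r := by
        rw [hr, le_div_iff₀ (by positivity)]
        linarith
      have h1 : (⌊r⌋₊ : ℝ) ≤ r := Nat.floor_le hr0.le
      have h2 : r < (⌊r⌋₊ : ℝ) + 1 := Nat.lt_floor_add_one r
      have h3 : ⌊r⌋₊ ≤ ⌊s⌋₊ := Nat.floor_le_floor hrs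
      have h4 : 1 ≤ ⌊r⌋₊ := Nat.le_floor (by norm_num; linarith)
      refine ⟨⌊r⌋₊, h4, h3, accuracy _ h4 (h3.trans hf4)
        (stage_ratio_le' hcase hx1 hx0 (by linarith) ?_), cost _ _ ?_⟩
      · have h5 : (r - 1) * x ^ 2 ≤ (⌊r⌋₊ : ℝ) * x ^ 2 :=
          mul_le_mul_of_nonneg_right (by linarith) (sq_nonneg x)
        have h6 : (r - 1) * x ^ 2 = 25 / 32 * s - x ^ 2 := by rw [sub_mul, hrx, one_mul]
        linarith
      · calc (⌊r⌋₊ : ℝ) * (4 * (x ^ 2 * m)) ≤ r * (4 * (x ^ 2 * m)) := by gcongr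
          _ = 4 * m * (r * x ^ 2) := by ring
          _ = _ := by rw [hrx]; ring
    · push Not at hcase
      refine ⟨⌊s⌋₊, hf3, le_rfl, accf, cost _ _ ?_⟩
      calc (⌊s⌋₊ : ℝ) * (4 * (x ^ 2 * m)) ≤ s * (4 * (x ^ 2 * m)) := by gcongr
        _ = 4 * (m * s) * x ^ 2 := by ring
        _ ≤ 4 * (m * s) * (25 / 32) := by gcongr
        _ = _ := by ring
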